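/- **Setting.** A logic $\mathcal L$ consists of sentences, a class of models and a satisfaction relation; $\mathcal T\models\alpha$ means that every model of all elements of $\mathcal T$ is a model of $\alpha$. Sentences are non-empty words over a finite alphabet, $|\alpha|$ is the length of $\alpha$, and $|\mathcal T|=\sum_{\alpha\in\mathcal T}|\alpha|$ for a finite theory $\mathcal T$. A (finite, directed, labelled) hypergraph $H=(V,E,\ell)$ has hyperedges $(S,d)\in E$ with $S\subseteq V$, $d\in V$, and a labelling $\ell$ of $V$ by sentences; $|H|=\sum_{(S,d)\in E}\bigl(|\ell(d)|+\sum_{v\in S}|\ell(v)|\bigr)$. A leaf is a vertex without incoming hyperedge, a sink is a vertex without outgoing hyperedge (it lies in no $S$ with $(S,d)\in E$). A path from $s$ to $t$ is a sequence of hyperedges $(S_1,d_1),\dots,(S_q,d_q)$ with $s\in S_1$, $d_j\in S_{j+1}$ and $d_q=t$ (for $q=0$: $s=t$); $H$ is acyclic if it has no path of positive length from a vertex to itself, and a tree with root $t$ if $t$ is a sink and every other vertex has exactly one path to $t$. A derivation structure over a finite theory $\mathcal T$ is a hypergraph whose leaves are labelled by elements of $\mathcal T$ and with $\{\ell(v)\mid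 v\in S\}\models\ell(d)$ for all $(S,d)\in E$. A proof for $\mathcal T\models\eta$ is an acyclic derivation structure over $\mathcal T$ with exactly one sink, which is labelled by $\eta$; a tree proof is a proof that is a tree. A deriver $\mathfrak D$ consists of a set $C$ of sentences and a function assigning to every finite theory $\mathcal T$ and every $\eta\in C$ a derivation structure $\mathfrak D(\mathcal T,\eta)$ over $\mathcal T$, such that $\mathcal T\models\eta$ iff some substructure of $\mathfrak D(\mathcal T,\eta)$ is a proof for $\mathcal T\models\eta$. It is polynomial (exponential) if for some polynomial $p$ both the size and the number of vertices of $\mathfrak D(\mathcal T,\eta)$ are at most $p(|\mathcal T|+|\eta|)$ (at most $2^{p(|\mathcal T|+|\eta|)}$). A tree proof is admissible w.r.t. $\mathfrak D(\mathcal T,\eta)$ if it has a label-preserving homomorphism to $\mathfrak D(\mathcal T,\eta)$, i.e. a map $h$ of vertices such that $(h(S),h(d))$ is a hyperedge of $\mathfrak D(\mathcal T,\eta)$ for every hyperedge $(S,d)$ of the proof. The problem $\mathsf{MTP}_{\mathsf{binary}}(\mathfrak D)$ is: given $\mathcal T$, $\eta\in C$ and $n\in\mathbb N$ in binary, is there a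 tree proof for $\mathcal T\models\eta$ that is admissible w.r.t. $\mathfrak D(\mathcal T,\eta)$ and has at most $n$ vertices? The description of a hypergraph lists its vertices, numbered $0,\dots,m-1$ in binary, with their labels, and its hyperedges; numbering and orders are arbitrary. A Turing machine has access to the derivation structure if on instance $(\mathcal T,\eta,n)$ it also finds, on its input tape after the instance, an arbitrary description of $\mathfrak D(\mathcal T,\eta)$, whose length does not count as input length: time bounds refer to the length of the instance $(\mathcal T,\eta,n)$ alone. **Theorem.** Let $\mathfrak D$ be a deriver. 1. If $\mathfrak D$ is polynomial, then $\mathsf{MTP}_{\mathsf{binary}}(\mathfrak D)$ is in $\mathrm P$ (decidable in polynomial time) for deterministic Turing machines with access to the derivation structure. 2. If $\mathfrak D$ is exponential, then $\mathsf{MTP}_{\mathsf{binary}}(\mathfrak D)$ is in $\mathrm{ExpTime}$ (decidable in time $2^{q(\cdot)}$ for a polynomial $q$) for deterministic Turing machines with access to the derivation structure. 3. If a description of $\mathfrak D(\mathcal T,\eta)$ can be computed from $(\mathcal T,\eta)$ in polynomial time, then $\mathsf{MTP}_{\mathsf{binary}}(\mathfrak D)$ is in $\mathrm P$ for ordinary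 Turing machines, without such access. 4. If a description of $\mathfrak D(\mathcal T,\eta)$ can be computed from $(\mathcal T,\eta)$ in time $2^{q(\cdot)}$ for a polynomial $q$, then $\mathsf{MTP}_{\mathsf{binary}}(\mathfrak D)$ is in $\mathrm{ExpTime}$ for ordinary Turing machines, without such access. -/

import Mathlib

open Turing

namespace MinTreeProof

/-! ## Logics -/

/-- A logic with model-based consequence. Sentences are non-empty words over a finite alphabet
(through an injective coding). -/
structure SententialLogic where
  Sentence : Type*
  Model : Type*
  Sat : Model → Sentence → Prop
  Alphabet : Type
  alphabet_finite : Finite Alphabet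
  code : Sentence → List Alphabet
  code_injective : Function.Injective code
  code_ne_nil : ∀ α, code α ≠ []

namespace SententialLogic

variable (L : SententialLogic)

/-- `T ⊨ α`: every model of all elements of `T` is a model of `α`. -/
def Entails (T : Set L.Sentence) (α : L.Sentence) : Prop :=
  ∀ M : L.Model, (∀ β ∈ T, L.Sat M β) → L.Sat M α

/-- The size of a sentence: its number of symbols. -/
def size (α : L.Sentence) : ℕ := (L.code α).length

/-- The size of a finite theory. -/
def theorySize (T : Finset L.Sentence) : ℕ := ∑ α ∈ T, L.size α

end SententialLogic

/-! ## Hypergraphs -/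

/-- A finite directed hypergraph with vertices in `V` and labels in `S`; only the labels of
elements of `verts` are meaningful. -/
structure Hypergraph (S V : Type*) where
  verts : Finset V
  edges : Finset (Finset V × V)
  premise_mem : ∀ e ∈ edges, e.1 ⊆ verts
  conclusion_mem : ∀ e ∈ edges, e.2 ∈ verts
  label : V → S

namespace Hypergraph

variable {S V W : Type*}

/-- A vertex without incoming hyperedges. -/
def IsLeaf (H : Hypergraph S V) (v : V) : Prop :=
  v ∈ H.verts ∧ ∀ e ∈ H.edges, e.2 ≠ v

/-- A vertex without outgoing hyperedges. -/
def IsSink (H : Hypergraph S V) (v : V) : Prop :=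
  v ∈ H.verts ∧ ∀ e ∈ H.edges, v ∉ e.1

/-- `H.IsPath s p t`: the hyperedges `p = [(S₁, d₁), …, (S_q, d_q)]` form a path
`(s, (S₁, d₁), d₁, …, (S_q, d_q), d_q)` with `d_q = t`. -/
def IsPath (H : Hypergraph S V) : V → List (Finset V × V) → V → Prop
  | s, [], t => s = t
  | s, e :: p, t => e ∈ H.edges ∧ s ∈ e.1 ∧ IsPath H e.2 p t

/-- There is no cycle, that is, no path of positive length from a vertex to itself. -/
def IsAcyclic (H : Hypergraph S V) : Prop :=
  ∀ v p, H.IsPath v p v → p = []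

/-- `H` is a tree with root `t`. -/
def IsTreeWithRoot (H : Hypergraph S V) (t : V) : Prop :=
  H.IsSink t ∧ ∀ v ∈ H.verts, v ≠ t → ∃! p, H.IsPath v p t

/-- `H` is a substructure of `H'`. -/
def IsSubstructure (H H' : Hypergraph S V) : Prop :=
  H.verts ⊆ H'.verts ∧ H.edges ⊆ H'.edges ∧ ∀ v ∈ H.verts, H.label v = H'.label v

open scoped Classical in
/-- `h` is a homomorphism from `H` to `H'`. -/
def IsHom (H : Hypergraph S V) (H' : Hypergraph S W) (h : V → W) : Prop :=
  (∀ v ∈ H.verts, h v ∈ H'.verts ∧ H'.label (h v) = H.label v) ∧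
    ∀ e ∈ H.edges, (e.1.image h, h e.2) ∈ H'.edges

end Hypergraph

/-! ## Derivation structures, proofs and derivers -/

section Proofs

variable (L : SententialLogic) {V : Type*}

/-- The size of a hypergraph, measured by the labels of its hyperedges. -/
def hypergraphSize (H : Hypergraph L.Sentence V) : ℕ :=
  ∑ e ∈ H.edges, (L.size (H.label e.2) + ∑ v ∈ e.1, L.size (H.label v))

/-- `H` is a derivation structure over `T`: grounded and sound. -/
def IsDerivationStructure (T : Finset L.Sentence) (H : Hypergraph L.Sentence V) : Prop :=
  (∀ v, H.IsLeaf v → H.label v ∈ T) ∧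
    ∀ e ∈ H.edges, L.Entails {α | ∃ v ∈ e.1, H.label v = α} (H.label e.2)

/-- `H` is a proof for `T ⊨ η`. -/
def IsProof (T : Finset L.Sentence) (η : L.Sentence) (H : Hypergraph L.Sentence V) : Prop :=
  IsDerivationStructure L T H ∧
    (∃ v, H.IsSink v ∧ H.label v = η ∧ ∀ w, H.IsSink w → w = v) ∧ H.IsAcyclic

/-- `H` is a tree proof for `T ⊨ η`. -/
def IsTreeProof (T : Finset L.Sentence) (η : L.Sentence) (H : Hypergraph L.Sentence V) : Prop :=
  IsProof L T η H ∧ ∃ t, H.IsTreeWithRoot t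

end Proofs

/-- A deriver: a set of allowed goals and an assignment of derivation structures such that
`T ⊨ η` holds iff the structure for `(T, η)` contains a proof for `T ⊨ η`. -/
structure Deriver (L : SententialLogic) where
  goals : Set L.Sentence
  Vertex : Type*
  struct : Finset L.Sentence → goals → Hypergraph L.Sentence Vertex
  struct_isDerivationStructure : ∀ T η, IsDerivationStructure L T (struct T η)
  entails_iff : ∀ (T : Finset L.Sentence) (η : goals), L.Entails (T : Set L.Sentence) η ↔
    ∃ P : Hypergraph L.Sentence Vertex, P.IsSubstructure (struct T η) ∧ IsProof L T η P

namespace Deriver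

variable {L : SententialLogic} (D : Deriver L)

/-- The size of the derivation structure and its number of vertices are bounded polynomially.
(The size alone does not see vertices that lie on no hyperedge.) -/
def IsPolynomial : Prop :=
  ∃ p : Polynomial ℕ, ∀ (T : Finset L.Sentence) (η : D.goals),
    hypergraphSize L (D.struct T η) ≤ p.eval (L.theorySize T + L.size η) ∧
      (D.struct T η).verts.card ≤ p.eval (L.theorySize T + L.size η)

/-- The size of the derivation structure and its number of vertices are bounded exponentially. -/
def IsExponential : Prop :=
  ∃ p : Polynomial ℕ, ∀ (T : Finset L.Sentence) (η : D.goals),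
    hypergraphSize L (D.struct T η) ≤ 2 ^ p.eval (L.theorySize T + L.size η) ∧
      (D.struct T η).verts.card ≤ 2 ^ p.eval (L.theorySize T + L.size η)

/-- There is a tree proof for `T ⊨ η`, admissible w.r.t. the derivation structure for `(T, η)`,
with at most `n` vertices. (Being finite, tree proofs may be taken with vertices in `ℕ`.) -/
def MTP (T : Finset L.Sentence) (η : D.goals) (n : ℕ) : Prop :=
  ∃ P : Hypergraph L.Sentence ℕ, IsTreeProof L T η P ∧
    (∃ h : ℕ → D.Vertex, P.IsHom (D.struct T η) h) ∧ P.verts.card ≤ n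

end Deriver

/-! ## Input strings -/

/-- Input symbols: symbols of sentences, binary digits and three separators. -/
inductive Symbol (A : Type) where
  | letter (a : A)
  | digit (b : Bool)
  | comma
  | colon
  | bar

/-- A natural number in binary. -/
def binary {A : Type} (n : ℕ) : List (Symbol A) :=
  (Computability.encodeNat n).map Symbol.digit

/-- A sentence as a word of input symbols. -/
def word (L : SententialLogic) (α : L.Sentence) : List (Symbol L.Alphabet) :=
  (L.code α).map Symbol.letter

/-- A pair `(T, η)`, with the elements of `T` listed in some order without repetition. -/
structure Query {L : SententialLogic} (D : Deriver L) where
  theory : Finset L.Sentence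
  theoryList : List L.Sentence
  theoryList_eq : (theoryList : Multiset L.Sentence) = theory.val
  goal : D.goals

/-- `α₁,…,α_k,|η|` -/
def Query.string {L : SententialLogic} {D : Deriver L} (q : Query D) :
    List (Symbol L.Alphabet) :=
  q.theoryList.flatMap (fun α => word L α ++ [Symbol.comma]) ++ [Symbol.bar] ++
    word L q.goal ++ [Symbol.bar]

/-- An instance of the minimal tree proof problem. -/
structure Instance {L : SententialLogic} (D : Deriver L) where
  query : Query D
  bound : ℕ

/-- `α₁,…,α_k,|η|n|` with `n` in binary -/
def Instance.string {L : SententialLogic} {D : Deriver L} (x : Instance D) :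
    List (Symbol L.Alphabet) :=
  x.query.string ++ binary x.bound ++ [Symbol.bar]

/-- `x` is a yes-instance. -/
def Instance.Holds {L : SententialLogic} {D : Deriver L} (x : Instance D) : Prop :=
  D.MTP x.query.theory x.query.goal x.bound

/-- A way to write down a hypergraph: its vertices are numbered `0, …, m - 1`, and its vertices,
its hyperedges and the premises of each hyperedge are listed, each in some order without
repetition. -/
structure Listing {S V : Type*} (H : Hypergraph S V) where
  number : V → ℕ
  number_injOn : Set.InjOn number H.verts
  number_lt : ∀ v ∈ H.verts, number v < H.verts.card
  vertexList : List V
  vertexList_eq : (vertexList : Multiset V) = H.verts.val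
  edgeList : List (Finset V × V)
  edgeList_eq : (edgeList : Multiset (Finset V × V)) = H.edges.val
  premiseList : Finset V × V → List V
  premiseList_eq : ∀ e ∈ H.edges, (premiseList e : Multiset V) = e.1.val

/-- The description of a hypergraph: an item `i:ℓ(vᵢ),` for every vertex, a bar, an item
`i₁,…,i_k,:d,` for every hyperedge, and a bar; vertices are given by their numbers in binary. -/
def Listing.string (L : SententialLogic) {V : Type*} {H : Hypergraph L.Sentence V}
    (l : Listing H) : List (Symbol L.Alphabet) :=
  l.vertexList.flatMap
      (fun v => binary (l.number v) ++ [Symbol.colon] ++ word L (H.label v) ++ [Symbol.comma]) ++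
    [Symbol.bar] ++
    l.edgeList.flatMap
      (fun e => (l.premiseList e).flatMap (fun v => binary (l.number v) ++ [Symbol.comma]) ++
        [Symbol.colon] ++ binary (l.number e.2) ++ [Symbol.comma]) ++
    [Symbol.bar]

/-! ## Computation by Turing machines -/

/-- Some Turing machine outputs `output a` when started on `input a`, for every `a : α`, and
makes at most `time a` steps. -/
def ComputableWithin {α : Type*} {A B : Type} (input : α → List A) (output : α → List B)
    (time : α → ℕ) : Prop :=
  ∃ M : TM2ComputableAux A B, ∀ a, Nonempty (TM2OutputsInTime M.tm
    ((input a).map M.inputAlphabet.invFun) (some ((output a).map M.outputAlphabet.invFun))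
    (time a))

open scoped Classical in
/-- Some Turing machine, started on `input a`, outputs whether `P a` holds, and makes at most
`time a` steps. -/
def DecidableWithin {α : Type*} {A : Type} (input : α → List A) (P : α → Prop)
    (time : α → ℕ) : Prop :=
  ComputableWithin input (fun a => [decide (P a)]) time

/-- The problem `P`, with its instances given as strings, is in P. -/
def InP {α : Type*} {A : Type} (input : α → List A) (P : α → Prop) : Prop :=
  ∃ p : Polynomial ℕ, DecidableWithin input P (fun a => p.eval (input a).length)

/-- The problem `P`, with its instances given as strings, is in ExpTime. -/
def InExpTime {α : Type*} {A : Type} (input : α → List A) (P : α → Prop) : Prop :=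
  ∃ p : Polynomial ℕ, DecidableWithin input P (fun a => 2 ^ p.eval (input a).length)

namespace Deriver

variable {L : SententialLogic} (D : Deriver L)

/-- An instance together with a listing of the derivation structure for it. -/
structure AccessInstance where
  inst : Instance D
  listing : Listing (D.struct inst.query.theory inst.query.goal)

/-- The minimal tree proof problem, with `n` in binary, is in P for machines with access to the
derivation structure: a description of it follows the instance on the input tape, but the time
bound is a polynomial in the length of the instance alone. -/
def MTPInPWithAccess : Prop :=
  ∃ p : Polynomial ℕ, DecidableWithin
    (fun x : D.AccessInstance => x.inst.string ++ x.listing.string)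
    (fun x => x.inst.Holds) (fun x => p.eval x.inst.string.length)

/-- The same for ExpTime. -/
def MTPInExpTimeWithAccess : Prop :=
  ∃ p : Polynomial ℕ, DecidableWithin
    (fun x : D.AccessInstance => x.inst.string ++ x.listing.string)
    (fun x => x.inst.Holds) (fun x => 2 ^ p.eval x.inst.string.length)

/-- A description of the derivation structure can be computed from `(T, η)` in polynomial time. -/
def IsPolyTimeComputable : Prop :=
  ∃ (l : ∀ q : Query D, Listing (D.struct q.theory q.goal)) (p : Polynomial ℕ),
    ComputableWithin (fun q : Query D => q.string) (fun q => (l q).string)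
      (fun q => p.eval q.string.length)

/-- A description of the derivation structure can be computed from `(T, η)` in exponential
time. -/
def IsExpTimeComputable : Prop :=
  ∃ (l : ∀ q : Query D, Listing (D.struct q.theory q.goal)) (p : Polynomial ℕ),
    ComputableWithin (fun q : Query D => q.string) (fun q => (l q).string)
      (fun q => 2 ^ p.eval q.string.length)

end Deriver

end MinTreeProof

/-! Admissible tree proofs are unravellings of the derivation structure. If `h` maps a tree proof to
the structure, then below any vertex `v` of the tree one reads off, by recursion, a derivation of `h
v` in which every vertex is either closed, because its label lies in `T`, or concluded by a
hyperedge whose premises are derived again (`exists_unravels`). Conversely, such a derivation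
becomes a tree by giving every premise its own disjoint copy of its subtree
(`Unravels.exists_tree`). Hence a tree proof with at most `n` vertices exists iff some vertex
labelled by the goal unravels with size at most `n` (`Deriver.mtp_iff`).

The least sizes are found as in the algorithm of Bellman and Ford. A vertex starts with cost `1` if
its label is in `T`, and with `n + 1` otherwise; a hyperedge lowers the cost of its conclusion to
one plus the sum of the costs of its premises. A cost of at most `n` always stands for an actual
tree. In a smallest tree the subtrees at the premises are strictly smaller, so the vertices receive
their final costs in the order of these sizes, and as many rounds as there are vertices suffice
(`cost_le_iff`). Trees can be exponentially larger than the structure, but costs never rise above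
their initial values and are kept in binary, so everything is polynomial in the length of the
instance and the description together.

To obtain Turing machines, data are coded as binary trees in prefix notation on one stack. The
functions computable on such codes by program fragments in polynomial time (`PT`) contain the
constants and projections and are closed under composition, pairing, case distinction and iteration
with polynomial bounds on rounds and sizes; this gives lists, binary arithmetic and finally the
procedure `solve` (`PT.solve`, correct by `solve_eq`).

With access, it remains to bound the length of a description by a polynomial in the bound on size
and vertices (`Listing.length_string_le`). Without access, the given machine is embedded as a
fragment, run on a copy of the query, and its output is appended to the instance; its running time
bounds the length of that output (`exists_output_length_le`). In the exponential cases, a polynomial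
in an exponential bound is again exponential (`exists_eval_add_two_pow_le`). -/

namespace MinTreeProof

/-! ## Program fragments -/

/-- Symbols on the work stacks: the two constructors of binary trees and a bottom mark. -/
inductive Mark where
  | nil
  | cons
  | bottom
  deriving DecidableEq

instance : Fintype Mark := ⟨{.nil, .cons, .bottom}, fun a => by cases a <;> simp⟩

/-- The work stacks. -/
inductive Work where
  | main
  | left
  | right
  | count
  deriving DecidableEq

instance : Fintype Work := ⟨{.main, .left, .right, .count}, fun a => by cases a <;> simp⟩

/-- What a machine has in addition to the work stacks: an input alphabet, whose symbols can be held
in the register, further stacks and a further state. -/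
structure Env where
  Input : Type
  Stack : Type
  [dec : DecidableEq Stack]
  Sym : Stack → Type
  State : Type

namespace Env

variable (E : Env)

instance : DecidableEq E.Stack := E.dec

abbrev K : Type := Work ⊕ E.Stack

abbrev Γ : E.K → Type
  | .inl _ => Mark
  | .inr k => E.Sym k

/-- Holds the last symbol popped by a fragment, `none` for an empty stack. It is kept apart from
`State`, so that fragments leave the state of an embedded machine alone. -/
abbrev Reg : Type := Option (Mark ⊕ E.Input)

abbrev σ : Type := E.Reg × E.State

abbrev Stk : Type := ∀ k : E.K, List (E.Γ k)

/-- The stacks with contents `w` of the work stacks and `y` of the other stacks. -/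
def combine (w : Work → List Mark) (y : ∀ k, List (E.Sym k)) : E.Stk
  | .inl k => w k
  | .inr k => y k

variable {E}

@[simp] theorem combine_inl (w : Work → List Mark) (y : ∀ k, List (E.Sym k)) (k : Work) :
    E.combine w y (.inl k) = w k := rfl

@[simp] theorem combine_inr (w : Work → List Mark) (y : ∀ k, List (E.Sym k)) (k : E.Stack) :
    E.combine w y (.inr k) = y k := rfl

@[simp] theorem update_combine_inl (w : Work → List Mark) (y : ∀ k, List (E.Sym k)) (k : Work)
    (l : List Mark) :
    Function.update (E.combine w y) (.inl k) l = E.combine (Function.update w k l) y := by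
  funext j
  rcases j with j | j
  · by_cases h : j = k
    · subst h; simp
    · simp [h]
  · simp

@[simp] theorem update_combine_inr (w : Work → List Mark) (y : ∀ k, List (E.Sym k)) (k : E.Stack)
    (l : List (E.Sym k)) :
    Function.update (E.combine w y) (.inr k) l = E.combine w (Function.update y k l) := by
  funext j
  rcases j with j | j
  · simp
  · by_cases h : j = k
    · subst h; simp
    · simp [h]

end Env

/-- Contents of the work stacks. -/
def works (m l r c : List Mark) : Work → List Mark
  | .main => m
  | .left => l
  | .right => r
  | .count => c

section works

variable (m l r c x : List Mark)

@[simp] theorem works_main : works m l r c .main = m := rfl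
@[simp] theorem works_left : works m l r c .left = l := rfl
@[simp] theorem works_right : works m l r c .right = r := rfl
@[simp] theorem works_count : works m l r c .count = c := rfl

@[simp] theorem update_works_main : Function.update (works m l r c) .main x = works x l r c := by
  funext k; cases k <;> simp

@[simp] theorem update_works_left : Function.update (works m l r c) .left x = works m x r c := by
  funext k; cases k <;> simp

@[simp] theorem update_works_right : Function.update (works m l r c) .right x = works m l x c := by
  funext k; cases k <;> simp

@[simp] theorem update_works_count : Function.update (works m l r c) .count x = works m l r x := by
  funext k; cases k <;> simp

end works

/-! ### Reachability of configurations within a time bound. -/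

section Reach

variable {K : Type} [DecidableEq K] {Γ : K → Type} {Λ σ : Type} (M : Λ → TM2.Stmt Γ Λ σ)

/-- The configuration `c'` is reached from `c` in at most `t` steps. -/
def Reach (t : ℕ) (c c' : TM2.Cfg Γ Λ σ) : Prop :=
  ∃ n ≤ t, (flip bind (TM2.step M))^[n] (some c) = some c'

variable {M}

theorem Reach.refl (c : TM2.Cfg Γ Λ σ) : Reach M 0 c c := ⟨0, le_rfl, rfl⟩

theorem Reach.trans {t t' : ℕ} {c c' c'' : TM2.Cfg Γ Λ σ} (h : Reach M t c c')
    (h' : Reach M t' c' c'') : Reach M (t + t') c c'' := by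
  obtain ⟨n, hn, e⟩ := h
  obtain ⟨n', hn', e'⟩ := h'
  exact ⟨n' + n, by omega, by rw [Function.iterate_add_apply, e, e']⟩

theorem Reach.mono {t t' : ℕ} {c c' : TM2.Cfg Γ Λ σ} (h : Reach M t c c') (ht : t ≤ t') :
    Reach M t' c c' := by
  obtain ⟨n, hn, e⟩ := h
  exact ⟨n, hn.trans ht, e⟩

theorem Reach.step {l : Λ} {v : σ} {S : ∀ k, List (Γ k)} {c : TM2.Cfg Γ Λ σ}
    (h : TM2.stepAux (M l) v S = c) : Reach M 1 ⟨some l, v, S⟩ c :=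
  ⟨1, le_rfl, by subst h; rfl⟩

end Reach

/-- A program fragment with its own labels, to be placed in a machine with labels `Λ` by means of
an embedding of its labels and of a label to which control is passed at the end. -/
structure Frag (E : Env) where
  Lab : Type
  fin : Finite Lab
  entry : Lab
  code : ∀ {Λ : Type}, (Lab → Λ) → Λ → Lab → TM2.Stmt E.Γ Λ E.σ

namespace Frag

variable {E : Env}

/-- Wherever the fragment is placed, it transforms state `x` and stacks `S` into `x'` and `S'`
within `t` steps. -/
def Runs (F : Frag E) (t : ℕ) (x : E.State) (S : E.Stk) (x' : E.State) (S' : E.Stk) : Prop :=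
  ∀ (Λ : Type) (M : Λ → TM2.Stmt E.Γ Λ E.σ) (ι : F.Lab → Λ) (exit : Λ),
    (∀ l, M (ι l) = F.code ι exit l) → ∀ r, ∃ r',
      Reach M t ⟨some (ι F.entry), (r, x), S⟩ ⟨some exit, (r', x'), S'⟩

theorem Runs.mono {F : Frag E} {t t' : ℕ} {x x' : E.State} {S S' : E.Stk}
    (h : F.Runs t x S x' S') (ht : t ≤ t') : F.Runs t' x S x' S' := by
  intro Λ M ι exit hM r
  obtain ⟨r', hr⟩ := h Λ M ι exit hM r
  exact ⟨r', hr.mono ht⟩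

theorem Runs.of_eq {F : Frag E} {t t' : ℕ} {x x' : E.State} {S S' S'' : E.Stk}
    (h : F.Runs t x S x' S') (ht : t ≤ t') (hS : S' = S'') : F.Runs t' x S x' S'' :=
  hS ▸ h.mono ht

def skip : Frag E where
  Lab := Unit
  fin := inferInstance
  entry := ()
  code _ exit _ := .goto fun _ => exit

theorem skip_runs (x : E.State) (S : E.Stk) : (skip : Frag E).Runs 1 x S x S := by
  intro Λ M ι exit hM r
  exact ⟨r, Reach.step (by rw [hM]; rfl)⟩

def push (k : E.K) (a : E.Γ k) : Frag E where
  Lab := Unit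
  fin := inferInstance
  entry := ()
  code _ exit _ := .push k (fun _ => a) (.goto fun _ => exit)

theorem push_runs (k : E.K) (a : E.Γ k) (x : E.State) (S : E.Stk) :
    (push k a).Runs 1 x S x (Function.update S k (a :: S k)) := by
  intro Λ M ι exit hM r
  exact ⟨r, Reach.step (by rw [hM]; rfl)⟩

def seq (F G : Frag E) : Frag E where
  Lab := F.Lab ⊕ G.Lab
  fin := by have := F.fin; have := G.fin; infer_instance
  entry := .inl F.entry
  code ι exit
    | .inl l => F.code (ι ∘ .inl) (ι (.inr G.entry)) l
    | .inr l => G.code (ι ∘ .inr) exit l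

theorem seq_runs {F G : Frag E} {t t' : ℕ} {x x' x'' : E.State} {S S' S'' : E.Stk}
    (hF : F.Runs t x S x' S') (hG : G.Runs t' x' S' x'' S'') :
    (F.seq G).Runs (t + t') x S x'' S'' := by
  intro Λ M ι exit hM r
  obtain ⟨r', h'⟩ := hF Λ M (ι ∘ .inl) (ι (.inr G.entry)) (fun l => hM (.inl l)) r
  obtain ⟨r'', h''⟩ := hG Λ M (ι ∘ .inr) exit (fun l => hM (.inr l)) r'
  exact ⟨r'', h'.trans h''⟩

/-- Pop a symbol from stack `k` and select a fragment to be executed (or leave if there is none);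
after that start again or leave. -/
def pop (k : E.K) (conv : E.Γ k → Mark ⊕ E.Input) {I : Type} [Finite I] (sel : E.Reg → Option I)
    (again : Bool) (F : I → Frag E) : Frag E where
  Lab := Unit ⊕ (Σ i, (F i).Lab)
  fin := by have := fun i => (F i).fin; infer_instance
  entry := .inl ()
  code ι exit
    | .inl _ => .pop k (fun v o => (o.map conv, v.2)) (.goto fun v =>
        match sel v.1 with
        | none => exit
        | some i => ι (.inr ⟨i, (F i).entry⟩))
    | .inr ⟨i, l⟩ => (F i).code (fun l => ι (.inr ⟨i, l⟩)) (if again then ι (.inl ()) else exit) l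

section pop

variable {k : E.K} {conv : E.Γ k → Mark ⊕ E.Input} {I : Type} [Finite I] {sel : E.Reg → Option I}
  {F : I → Frag E} {x x' x'' : E.State} {S S' S'' : E.Stk} {t t' : ℕ} {i : I}

/-- The popped symbol is lost even when it selects nothing. This is how a loop consumes the mark
that stops it. -/
theorem pop_runs_none {again : Bool} (h : sel ((S k).head?.map conv) = none) :
    (pop k conv sel again F).Runs 1 x S x (Function.update S k (S k).tail) := by
  intro Λ M ι exit hM r
  refine ⟨(S k).head?.map conv, Reach.step ?_⟩
  refine (congrArg (fun q => TM2.stepAux q (r, x) S) (hM (.inl ()))).trans ?_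
  simp only [pop, TM2.stepAux]
  rw [h]

theorem pop_runs_once (h : sel ((S k).head?.map conv) = some i)
    (hF : (F i).Runs t x (Function.update S k (S k).tail) x' S') :
    (pop k conv sel false F).Runs (t + 1) x S x' S' := by
  intro Λ M ι exit hM r
  obtain ⟨r', h'⟩ := hF Λ M (fun l => ι (.inr ⟨i, l⟩)) exit (fun l => hM (.inr ⟨i, l⟩))
    ((S k).head?.map conv)
  refine ⟨r', ?_⟩
  rw [add_comm]
  refine Reach.trans (Reach.step ?_) h'
  refine (congrArg (fun q => TM2.stepAux q (r, x) S) (hM (.inl ()))).trans ?_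
  simp only [pop, TM2.stepAux]
  rw [h]

theorem pop_runs_again (h : sel ((S k).head?.map conv) = some i)
    (hF : (F i).Runs t x (Function.update S k (S k).tail) x' S')
    (hL : (pop k conv sel true F).Runs t' x' S' x'' S'') :
    (pop k conv sel true F).Runs (t + 1 + t') x S x'' S'' := by
  intro Λ M ι exit hM r
  obtain ⟨r', h'⟩ := hF Λ M (fun l => ι (.inr ⟨i, l⟩)) (ι (.inl ())) (fun l => hM (.inr ⟨i, l⟩))
    ((S k).head?.map conv)
  obtain ⟨r'', h''⟩ := hL Λ M ι exit hM r'
  refine ⟨r'', Reach.trans ?_ h''⟩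
  rw [add_comm]
  refine Reach.trans (Reach.step ?_) h'
  refine (congrArg (fun q => TM2.stepAux q (r, x) S) (hM (.inl ()))).trans ?_
  simp only [pop, TM2.stepAux]
  rw [h]

end pop

/-! ### Fragments on the work stacks -/

/-- The mark in the register, if it is not the bottom mark. -/
def properMark : E.Reg → Option Mark
  | some (.inl .nil) => some .nil
  | some (.inl .cons) => some .cons
  | _ => none

/-- The mark in the register. -/
def anyMark : E.Reg → Option Mark
  | some (.inl a) => some a
  | _ => none

/-- Pop symbols from work stack `k`, and execute a fragment for each, until a mark. -/
def workLoop (k : Work) (F : Mark → Frag E) : Frag E :=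
  pop (.inl k) .inl properMark true F

/-- Branch according to a symbol popped from work stack `k`. -/
def workCase (k : Work) (F : Mark → Frag E) : Frag E :=
  pop (.inl k) .inl anyMark false F

variable {x : E.State} {w w' w'' : Work → List Mark} {y : ∀ k, List (E.Sym k)} {k : Work}
  {F : Mark → Frag E} {l : List Mark}

theorem workPush_runs (k : Work) (a : Mark) :
    (push (.inl k) a : Frag E).Runs 1 x (E.combine w y) x (E.combine (Function.update w k (a :: w k)) y) := by
  simpa using push_runs (E := E) (.inl k) a x (E.combine w y)

theorem workLoop_runs_bottom (h : w k = .bottom :: l) :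
    (workLoop k F).Runs 1 x (E.combine w y) x (E.combine (Function.update w k l) y) := by
  have := pop_runs_none (E := E) (k := .inl k) (conv := .inl) (again := true) (F := F)
    (S := E.combine w y) (x := x) (sel := properMark) (by simp [h, properMark])
  simp only [Env.combine_inl, h, List.tail_cons, Env.update_combine_inl] at this
  exact this

theorem workLoop_runs_cons {a : Mark} {t t' : ℕ} (ha : a ≠ .bottom) (h : w k = a :: l)
    (hF : (F a).Runs t x (E.combine (Function.update w k l) y) x (E.combine w' y))
    (hL : (workLoop k F).Runs t' x (E.combine w' y) x (E.combine w'' y)) :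
    (workLoop k F).Runs (t + 1 + t') x (E.combine w y) x (E.combine w'' y) := by
  refine pop_runs_again (i := a) ?_ ?_ hL
  · simp only [Env.combine_inl, h]
    cases a <;> simp_all [properMark]
  · simpa [h] using hF

theorem workCase_runs {a : Mark} {t : ℕ} (h : w k = a :: l) {x' : E.State} {S' : E.Stk}
    (hF : (F a).Runs t x (E.combine (Function.update w k l) y) x' S') :
    (workCase k F).Runs (t + 1) x (E.combine w y) x' S' := by
  refine pop_runs_once (i := a) ?_ ?_
  · simp [h, anyMark]
  · simpa [h] using hF

/-- Move symbols from `k` to `d` until a mark. -/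
def pour (k d : Work) : Frag E := workLoop k fun a => push (.inl d) a

/-- Each symbol costs a pop and a push; the last pop removes the bottom mark, which is why `l` must
be free of it. -/
theorem pour_runs {k d : Work} (hkd : k ≠ d) {rest : List Mark} (hl : .bottom ∉ l)
    (h : w k = l ++ .bottom :: rest) :
    (pour k d : Frag E).Runs (2 * l.length + 1) x (E.combine w y) x
      (E.combine (Function.update (Function.update w k rest) d (l.reverse ++ w d)) y) := by
  induction l generalizing w with
  | nil =>
    refine (workLoop_runs_bottom (by simpa using h)).of_eq (by simp) (congrArg (E.combine · y) ?_)
    funext j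
    by_cases hj : j = d
    · subst hj; simp [hkd.symm]
    · simp [hj]
  | cons a l ih =>
    have ha : a ≠ .bottom := fun e => hl (by simp [e])
    refine (workLoop_runs_cons ha (by simpa using h) (workPush_runs d a)
      (ih (fun e => hl (by simp [e])) (by simp [hkd]))).of_eq (by simp; omega)
      (congrArg (E.combine · y) ?_)
    funext j
    by_cases hj : j = d
    · subst hj; simp [hkd.symm]
    · by_cases hj' : j = k
      · subst hj'; simp [hkd]
      · simp [hj, hj']

end Frag

end MinTreeProof

namespace MinTreeProof

/-! ## Binary trees on the main stack -/

/-- Binary trees, the universal data type. -/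
inductive Data where
  | nil
  | node (x y : Data)
  deriving DecidableEq

namespace Data

/-- Prefix notation. -/
def str : Data → List Mark
  | nil => [.nil]
  | node x y => .cons :: (x.str ++ y.str)

def size (x : Data) : ℕ := x.str.length

@[simp] theorem size_nil : nil.size = 1 := rfl

@[simp] theorem size_node (x y : Data) : (node x y).size = x.size + y.size + 1 := by
  simp [size, str]

theorem size_pos (x : Data) : 0 < x.size := by cases x <;> simp

theorem bottom_notMem_str (x : Data) : Mark.bottom ∉ x.str := by
  induction x with
  | nil => simp [str]
  | node x y hx hy => simp [str, hx, hy]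

end Data

namespace Frag

variable {E : Env} {x : E.State} {w : Work → List Mark} {y : ∀ k, List (E.Sym k)}
  {m l r c : List Mark}

/-- Executed after one pending tree has been taken off `count`: a `nil` completes this tree, while a
`cons` replaces it by two pending subtrees. -/
def shiftBody (d : Work) : Mark → Frag E
  | .nil => push (.inl d) .nil
  | .cons => (push (.inl d) .cons).seq ((push (.inl .count) .nil).seq (push (.inl .count) .nil))
  | .bottom => skip

/-- Move trees from the main stack to stack `d`, counting the trees to be read on stack `count`. -/
def shiftLoop (d : Work) : Frag E :=
  workLoop .count fun _ => workCase .main (shiftBody d)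

def shift (d : Work) : Frag E :=
  (push (.inl .count) .bottom).seq ((push (.inl .count) .nil).seq (shiftLoop d))

/-- In prefix notation a counter of pending trees suffices to find the end of a tree. The induction
is on the number of symbols left, for an arbitrary list of pending trees; a symbol costs two pops
and at most three pushes. -/
theorem shiftLoop_runs {d : Work} (hd : d = .left ∨ d = .right) (n : ℕ) (ts : List Data)
    (hn : (ts.flatMap Data.str).length = n) (hm : w .main = ts.flatMap Data.str ++ m)
    (hc : w .count = List.replicate ts.length .nil ++ .bottom :: c) :
    (shiftLoop d : Frag E).Runs (5 * n + 1) x (E.combine w y) x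
      (E.combine (Function.update (Function.update (Function.update w .main m) .count c) d
        ((ts.flatMap Data.str).reverse ++ w d)) y) := by
  induction n generalizing ts w with
  | zero =>
    obtain rfl : ts = [] := by
      cases ts with
      | nil => rfl
      | cons t ts => have := t.size_pos; simp_all [Data.size]
    refine (workLoop_runs_bottom (by simpa using hc)).of_eq (by simp) (congrArg (E.combine · y) ?_)
    funext j
    rcases hd with rfl | rfl <;> cases j <;> simp_all
  | succ n ih =>
    obtain - | ⟨t, ts⟩ := ts
    · simp at hn
    obtain - | ⟨t₁, t₂⟩ := t
    · refine (workLoop_runs_cons (l := List.replicate ts.length .nil ++ .bottom :: c)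
        (a := .nil) (by simp) (by simpa [List.replicate_succ] using hc)
        (workCase_runs (a := .nil) (F := shiftBody d) (l := ts.flatMap Data.str ++ m)
          (by rcases hd with rfl | rfl <;> simpa [Data.str] using hm) (workPush_runs d .nil)) (ih ts
          (by simpa [Data.str] using hn) ?_ ?_)).of_eq (by omega)
        (congrArg (E.combine · y) ?_)
      · rcases hd with rfl | rfl <;> simp
      · rcases hd with rfl | rfl <;> simp
      · funext j
        rcases hd with rfl | rfl <;> cases j <;> simp [Data.str]
    · refine (workLoop_runs_cons (l := List.replicate ts.length .nil ++ .bottom :: c)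
        (a := .nil) (by simp) (by simpa [List.replicate_succ] using hc)
        (workCase_runs (a := .cons) (F := shiftBody d) (l := (t₁ :: t₂ :: ts).flatMap Data.str ++ m)
          (by rcases hd with rfl | rfl <;> simpa [Data.str] using hm) (seq_runs (workPush_runs d .cons)
            (seq_runs (workPush_runs .count .nil) (workPush_runs .count .nil))))
        (ih (t₁ :: t₂ :: ts)
          (by simp [Data.str] at hn ⊢; omega) ?_ ?_)).of_eq (by omega)
          (congrArg (E.combine · y) ?_)
      · rcases hd with rfl | rfl <;> simp
      · rcases hd with rfl | rfl <;> simp [List.replicate_succ]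
      · funext j
        rcases hd with rfl | rfl <;> cases j <;> simp [Data.str]

theorem shift_left_runs (t : Data) :
    (shift .left : Frag E).Runs (5 * t.size + 3) x (E.combine (works (t.str ++ m) l r c) y) x
      (E.combine (works m (t.str.reverse ++ l) r c) y) := by
  refine (seq_runs (workPush_runs _ _) (seq_runs (workPush_runs _ _)
    (shiftLoop_runs (.inl rfl) t.size [t] (by simp [Data.size]) (m := m) (c := c) ?_ ?_))).of_eq
    (by omega) ?_ <;> simp

theorem shift_right_runs (t : Data) :
    (shift .right : Frag E).Runs (5 * t.size + 3) x (E.combine (works (t.str ++ m) l r c) y) x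
      (E.combine (works m l (t.str.reverse ++ r) c) y) := by
  refine (seq_runs (workPush_runs _ _) (seq_runs (workPush_runs _ _)
    (shiftLoop_runs (.inr rfl) t.size [t] (by simp [Data.size]) (m := m) (c := c) ?_ ?_))).of_eq
    (by omega) ?_ <;> simp

theorem workPush_main_runs (a : Mark) :
    (push (.inl .main) a : Frag E).Runs 1 x (E.combine (works m l r c) y) x
      (E.combine (works (a :: m) l r c) y) := by
  simpa using workPush_runs (E := E) (x := x) (w := works m l r c) (y := y) .main a

theorem workPush_left_runs (a : Mark) :
    (push (.inl .left) a : Frag E).Runs 1 x (E.combine (works m l r c) y) x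
      (E.combine (works m (a :: l) r c) y) := by
  simpa using workPush_runs (E := E) (x := x) (w := works m l r c) (y := y) .left a

theorem workPush_right_runs (a : Mark) :
    (push (.inl .right) a : Frag E).Runs 1 x (E.combine (works m l r c) y) x
      (E.combine (works m l (a :: r) c) y) := by
  simpa using workPush_runs (E := E) (x := x) (w := works m l r c) (y := y) .right a

theorem pour_left_runs (t : Data) :
    (pour .left .main : Frag E).Runs (2 * t.size + 1) x
      (E.combine (works m (t.str.reverse ++ .bottom :: l) r c) y) x
      (E.combine (works (t.str ++ m) l r c) y) := by
  refine (pour_runs (by simp) (l := t.str.reverse) (rest := l) ?_ ?_).of_eq ?_ ?_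
  · simpa using t.bottom_notMem_str
  · simp
  · simp [Data.size]
  · simp

theorem pour_right_runs (t : Data) :
    (pour .right .main : Frag E).Runs (2 * t.size + 1) x
      (E.combine (works m l (t.str.reverse ++ .bottom :: r) c) y) x
      (E.combine (works (t.str ++ m) l r c) y) := by
  refine (pour_runs (by simp) (l := t.str.reverse) (rest := r) ?_ ?_).of_eq ?_ ?_
  · simpa using t.bottom_notMem_str
  · simp
  · simp [Data.size]
  · simp

/-- Pouring restores the order of symbols within each tree, so the tree that is poured first ends up
below. -/
def swap : Frag E :=
  (push (.inl .left) .bottom).seq <| (shift .left).seq <| (push (.inl .right) .bottom).seq <|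
    (shift .right).seq <| (pour .left .main).seq (pour .right .main)

theorem swap_runs (s t : Data) :
    (swap : Frag E).Runs (7 * s.size + 7 * t.size + 10) x
      (E.combine (works (s.str ++ (t.str ++ m)) l r c) y) x
      (E.combine (works (t.str ++ (s.str ++ m)) l r c) y) :=
  (seq_runs (workPush_left_runs _) <| seq_runs (shift_left_runs s) <|
    seq_runs (workPush_right_runs _) <| seq_runs (shift_right_runs t) <|
    seq_runs (pour_left_runs s) (pour_right_runs t)).mono (by omega)

/-- Remove the tree on top of the main stack. -/
def drop : Frag E :=
  (push (.inl .left) .bottom).seq <| (shift .left).seq <| workLoop .left fun _ => skip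

theorem drop_runs (t : Data) :
    (drop : Frag E).Runs (7 * t.size + 5) x (E.combine (works (t.str ++ m) l r c) y) x
      (E.combine (works m l r c) y) := by
  have key : ∀ s : List Mark, .bottom ∉ s → (workLoop .left fun _ => skip : Frag E).Runs
      (2 * s.length + 1) x (E.combine (works m (s ++ .bottom :: l) r c) y) x
      (E.combine (works m l r c) y) := by
    intro s hs
    induction s with
    | nil => exact (workLoop_runs_bottom (l := l) (by simp)).of_eq (by simp) (by simp)
    | cons a s ih =>
      refine (workLoop_runs_cons (l := s ++ .bottom :: l) (a := a) (fun e => hs (by simp [e]))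
        (by simp) (skip_runs _ _) ?_).of_eq (t := 1 + 1 + (2 * s.length + 1))
        (by simp; omega) rfl
      simpa using ih (fun e => hs (by simp [e]))
  exact (seq_runs (workPush_left_runs _) <| seq_runs (shift_left_runs t) <|
    key t.str.reverse (by simpa using t.bottom_notMem_str)).mono (by simp [Data.size]; omega)

/-- Double the tree on top of the main stack. -/
def dup : Frag E :=
  (push (.inl .left) .bottom).seq <| (shift .left).seq <| (push (.inl .right) .bottom).seq <|
    (workLoop .left fun a => (push (.inl .main) a).seq (push (.inl .right) a)).seq <|
    (push (.inl .left) .bottom).seq <| (pour .right .left).seq (pour .left .main)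

/-- Unloading `left` reverses the word once more, so both `main` and `right` receive it in the
proper order. The second copy takes a detour over `left`, as moving it directly from `right` to
`main` would reverse it. -/
theorem dup_runs (t : Data) :
    (dup : Frag E).Runs (12 * t.size + 9) x (E.combine (works (t.str ++ m) l r c) y) x
      (E.combine (works (t.str ++ (t.str ++ m)) l r c) y) := by
  have key : ∀ (s m r : List Mark), .bottom ∉ s → (workLoop .left
      fun a => (push (.inl .main) a).seq (push (.inl .right) a) : Frag E).Runs
      (3 * s.length + 1) x (E.combine (works m (s ++ .bottom :: l) r c) y) x
      (E.combine (works (s.reverse ++ m) l (s.reverse ++ r) c) y) := by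
    intro s m r hs
    induction s generalizing m r with
    | nil => exact (workLoop_runs_bottom (l := l) (by simp)).of_eq (by simp) (by simp)
    | cons a s ih =>
      refine (workLoop_runs_cons (l := s ++ .bottom :: l) (a := a) (fun e => hs (by simp [e]))
        (by simp) (seq_runs (workPush_runs _ _) (workPush_runs _ _)) ?_).of_eq
        (t := 1 + 1 + 1 + (3 * s.length + 1)) (by simp; omega) rfl
      simpa using ih (a :: m) (a :: r) (fun e => hs (by simp [e]))
  have hk := key t.str.reverse m (.bottom :: r) (by simpa using t.bottom_notMem_str)
  have hp : (pour .right .left : Frag E).Runs (2 * t.size + 1) x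
      (E.combine (works (t.str ++ m) (.bottom :: l) (t.str ++ .bottom :: r) c) y) x
      (E.combine (works (t.str ++ m) (t.str.reverse ++ .bottom :: l) r c) y) := by
    refine (pour_runs (by simp) (l := t.str) (rest := r) t.bottom_notMem_str ?_).of_eq ?_ ?_ <;>
      simp [Data.size]
  rw [List.reverse_reverse] at hk
  exact (seq_runs (workPush_left_runs _) <| seq_runs (shift_left_runs t) <|
    seq_runs (workPush_right_runs _) <| seq_runs hk <| seq_runs (workPush_left_runs _) <|
    seq_runs hp (pour_left_runs t)).mono (by simp [Data.size]; omega)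

/-- Push the marks in `s` on the main stack. -/
def pushAll (s : List Mark) : Frag E := s.foldr (fun a F => (push (.inl .main) a).seq F) skip

theorem pushAll_runs (s m : List Mark) :
    (pushAll s : Frag E).Runs (s.length + 1) x (E.combine (works m l r c) y) x
      (E.combine (works (s.reverse ++ m) l r c) y) := by
  induction s generalizing m with
  | nil => exact skip_runs _ _
  | cons a s ih =>
    have := seq_runs (workPush_main_runs a) (ih (a :: m))
    simpa [pushAll, add_comm, add_left_comm] using this

theorem pushAll_str_runs (t : Data) :
    (pushAll t.str.reverse : Frag E).Runs (t.size + 1) x (E.combine (works m l r c) y) x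
      (E.combine (works (t.str ++ m) l r c) y) := by
  simpa [Data.size] using pushAll_runs (E := E) t.str.reverse m

/-- Replace the tree on top of the main stack by `t`. -/
def const (t : Data) : Frag E := drop.seq (pushAll t.str.reverse)

theorem const_runs (s t : Data) :
    (const t : Frag E).Runs (7 * s.size + 6 + t.size) x (E.combine (works (s.str ++ m) l r c) y) x
      (E.combine (works (t.str ++ m) l r c) y) :=
  (seq_runs (drop_runs s) (pushAll_str_runs t)).mono (by omega)

def popMain : Frag E := workCase .main fun _ => skip

theorem popMain_runs (a : Mark) (m : List Mark) :
    (popMain : Frag E).Runs 2 x (E.combine (works (a :: m) l r c) y) x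
      (E.combine (works m l r c) y) :=
  workCase_runs (a := a) (l := m) rfl (by simpa using skip_runs _ _)

/-- Branch according to the first symbol on the main stack. -/
def test (F G : Frag E) : Frag E := workCase .main fun
  | .cons => F
  | _ => G

theorem test_runs_cons {F G : Frag E} {t : ℕ} {x' : E.State} {S' : E.Stk}
    (h : F.Runs t x (E.combine (works m l r c) y) x' S') :
    (test F G).Runs (t + 1) x (E.combine (works (.cons :: m) l r c) y) x' S' :=
  workCase_runs (a := .cons) (l := m) rfl (by simpa using h)

theorem test_runs_nil {F G : Frag E} {t : ℕ} {x' : E.State} {S' : E.Stk}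
    (h : G.Runs t x (E.combine (works m l r c) y) x' S') :
    (test F G).Runs (t + 1) x (E.combine (works (.nil :: m) l r c) y) x' S' :=
  workCase_runs (a := .nil) (l := m) rfl (by simpa using h)

def consMark : E.Reg → Option Unit
  | some (.inl .cons) => some ()
  | _ => none

/-- Repeat while the first symbol on the main stack is `cons`. -/
def testLoop (F : Frag E) : Frag E := pop (.inl .main) .inl consMark true fun _ => F

theorem testLoop_runs_nil {F : Frag E} :
    (testLoop F).Runs 1 x (E.combine (works (.nil :: m) l r c) y) x
      (E.combine (works m l r c) y) :=
  (pop_runs_none (by simp [consMark])).of_eq le_rfl (by simp)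

theorem testLoop_runs_cons {F : Frag E} {t t' : ℕ} {S' S'' : E.Stk}
    (h : F.Runs t x (E.combine (works m l r c) y) x S') (h' : (testLoop F).Runs t' x S' x S'') :
    (testLoop F).Runs (t + 1 + t') x (E.combine (works (.cons :: m) l r c) y) x S'' :=
  pop_runs_again (i := ()) (by simp [consMark]) (by simpa using h) h'

end Frag

end MinTreeProof

namespace MinTreeProof

/-- Holds because the coefficients are natural numbers. -/
theorem polynomial_eval_mono (p : Polynomial ℕ) {a b : ℕ} (h : a ≤ b) : p.eval a ≤ p.eval b := by
  induction p using Polynomial.induction_on' with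
  | add p q hp hq => simpa using add_le_add hp hq
  | monomial n c => simpa using Nat.mul_le_mul_left c (Nat.pow_le_pow_left h n)

/-! ## Functions computable in polynomial time -/

/-- An encoding by binary trees. -/
class Enc (α : Type) where
  enc : α → Data
  enc_injective : Function.Injective enc

open Enc

/-- Both codes have five symbols, which makes `encSize` constant, and they already differ in the
second symbol, so that a test needs only two pops. -/
instance : Enc Bool where
  enc b := if b then .node (.node .nil .nil) .nil else .node .nil (.node .nil .nil)
  enc_injective := by intro a b; cases a <;> cases b <;> simp

instance {α β : Type} [Enc α] [Enc β] : Enc (α × β) where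
  enc a := .node (enc a.1) (enc a.2)
  enc_injective := by
    rintro ⟨a, b⟩ ⟨c, d⟩ h
    simpa [enc_injective.eq_iff] using h

/-- The proof is not coded, so entering or leaving a subtype is free. Branches of case distinctions
are treated as functions on the subtype of arguments that reach them. -/
instance {α : Type} [Enc α] {p : α → Prop} : Enc {a // p a} where
  enc a := enc a.1
  enc_injective _ _ h := Subtype.ext (enc_injective h)

section List

variable {α : Type} [Enc α]

def encList : List α → Data
  | [] => .nil
  | a :: l => .node (enc a) (encList l)

instance : Enc (List α) where
  enc := encList
  enc_injective := by
    intro l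
    induction l with
    | nil => intro l' h; cases l' <;> simp_all [encList]
    | cons a l ih =>
      intro l' h
      cases l' with
      | nil => simp [encList] at h
      | cons b l' =>
        simp only [encList, Data.node.injEq, enc_injective.eq_iff] at h
        rw [h.1, ih h.2]

end List

instance : Enc Data := ⟨id, Function.injective_id⟩

def encSize {α : Type} [Enc α] (a : α) : ℕ := (enc a).size

section encSize

variable {α β : Type} [Enc α] [Enc β]

theorem encSize_pos (a : α) : 0 < encSize a := Data.size_pos _

@[simp] theorem encSize_prod (a : α × β) : encSize a = encSize a.1 + encSize a.2 + 1 :=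
  Data.size_node _ _

@[simp] theorem encSize_nil : encSize ([] : List α) = 1 := rfl

@[simp] theorem encSize_cons (a : α) (l : List α) :
    encSize (a :: l) = encSize a + encSize l + 1 :=
  Data.size_node _ _

@[simp] theorem encSize_subtype {p : α → Prop} (a : {a // p a}) : encSize a = encSize a.1 := rfl

@[simp] theorem encSize_bool (b : Bool) : encSize b = 5 := by cases b <;> decide

end encSize

/-- `f` is computable in polynomial time on the main stack, with anything below the argument. -/
@[fun_prop]
def PT (E : Env) {α β : Type} [Enc α] [Enc β] (f : α → β) : Prop :=
  ∃ (F : Frag E) (p : Polynomial ℕ), ∀ a, encSize (f a) ≤ p.eval (encSize a) ∧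
    ∀ m l r c x y, F.Runs (p.eval (encSize a))
      x (E.combine (works ((enc a).str ++ m) l r c) y)
      x (E.combine (works ((enc (f a)).str ++ m) l r c) y)

namespace PT

variable {E : Env} {α β γ δ : Type} [Enc α] [Enc β] [Enc γ] [Enc δ]

/-- A function that does not change the encoding. -/
theorem of_enc_eq {f : α → β} (h : ∀ a, enc (f a) = enc a) : PT E f :=
  ⟨.skip, Polynomial.X + 1, fun a => ⟨by simp [encSize, h], fun m l r c x y => by
    rw [h]; exact (Frag.skip_runs _ _).mono (by simp)⟩⟩

@[fun_prop]
theorem id : PT E (fun a : α => a) := of_enc_eq fun _ => rfl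

@[fun_prop]
theorem const (b : β) : PT E (fun _ : α => b) :=
  ⟨.const (enc b), 7 * Polynomial.X + 6 + (encSize b : Polynomial ℕ), fun a => ⟨by simp,
    fun m l r c x y => (Frag.const_runs (enc a) (enc b)).mono (by simp [encSize])⟩⟩

@[fun_prop]
theorem comp {g : β → γ} {f : α → β} (hg : PT E g) (hf : PT E f) : PT E (fun a => g (f a)) := by
  obtain ⟨F, p, hF⟩ := hf
  obtain ⟨G, q, hG⟩ := hg
  -- The second fragment works on an argument of size at most `p`; for this purpose `PT` also bounds
  -- the size of the result.
  refine ⟨F.seq G, p + q.comp p, fun a => ⟨?_, fun m l r c x y => ?_⟩⟩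
  · simpa using ((hG (f a)).1.trans (polynomial_eval_mono q (hF a).1)).trans (Nat.le_add_left _ _)
  · refine (Frag.seq_runs ((hF a).2 m l r c x y) ((hG (f a)).2 m l r c x y)).mono ?_
    simpa using polynomial_eval_mono q (hF a).1

-- The second component is computed first, since in prefix notation the first one must lie above it,
-- directly below the final `cons`.
@[fun_prop]
theorem prodMk {f : α → β} {g : α → γ} (hf : PT E f) (hg : PT E g) :
    PT E (fun a => (f a, g a)) := by
  obtain ⟨F, p, hF⟩ := hf
  obtain ⟨G, q, hG⟩ := hg
  refine ⟨Frag.dup.seq <| G.seq <| Frag.swap.seq <| F.seq <| Frag.push (.inl .main) .cons,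
    12 * Polynomial.X + 9 + q + (7 * q + 7 * Polynomial.X + 10) + p + 1,
    fun a => ⟨?_, fun m l r c x y => ?_⟩⟩
  · have := (hF a).1
    have := (hG a).1
    simp
    omega
  · refine (Frag.seq_runs (Frag.dup_runs (enc a)) <| Frag.seq_runs ((hG a).2 _ l r c x y) <|
      Frag.seq_runs (Frag.swap_runs (enc (g a)) (enc a)) <|
      Frag.seq_runs ((hF a).2 _ l r c x y) <| Frag.workPush_main_runs .cons).of_eq ?_ ?_
    · have := (hG a).1
      simp [encSize] at this ⊢
      omega
    · simp [enc, Data.str]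

theorem fst : PT E (Prod.fst : α × β → α) := by
  refine ⟨Frag.popMain.seq <| Frag.swap.seq Frag.drop,
    14 * Polynomial.X + 20, fun a => ⟨by simp; omega, fun m l r c x y => ?_⟩⟩
  have : (enc a).str ++ m = .cons :: ((enc a.1).str ++ ((enc a.2).str ++ m)) := by
    simp [enc, Data.str]
  rw [this]
  refine (Frag.seq_runs (Frag.popMain_runs .cons _) <|
    Frag.seq_runs (Frag.swap_runs (enc a.1) (enc a.2)) (Frag.drop_runs (enc a.2))).mono ?_
  have := encSize_prod a
  simp [encSize] at this ⊢
  omega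

theorem snd : PT E (Prod.snd : α × β → β) := by
  refine ⟨Frag.popMain.seq Frag.drop,
    7 * Polynomial.X + 20, fun a => ⟨by simp; omega, fun m l r c x y => ?_⟩⟩
  have : (enc a).str ++ m = .cons :: ((enc a.1).str ++ ((enc a.2).str ++ m)) := by
    simp [enc, Data.str]
  rw [this]
  refine (Frag.seq_runs (Frag.popMain_runs .cons _) (Frag.drop_runs (enc a.1))).mono ?_
  have := encSize_prod a
  simp [encSize] at this ⊢
  omega

@[fun_prop]
theorem fst_comp {f : α → β × γ} (hf : PT E f) : PT E (fun a => (f a).1) := fst.comp hf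

@[fun_prop]
theorem snd_comp {f : α → β × γ} (hf : PT E f) : PT E (fun a => (f a).2) := snd.comp hf

theorem subtype_val {p : α → Prop} : PT E (Subtype.val : {a // p a} → α) := of_enc_eq fun _ => rfl

theorem restrict {f : α → β} (hf : PT E f) (p : α → Prop) : PT E (fun a : {a // p a} => f a.1) :=
  hf.comp subtype_val

/-- Computing a condition, with a result that can be told from its first symbol. -/
theorem exists_test {c : α → Bool} (hc : PT E c) : ∃ (C : Frag E) (p : Polynomial ℕ),
    ∀ a m l r c' x y, C.Runs (p.eval (encSize a))
      x (E.combine (works ((enc a).str ++ m) l r c') y)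
      x (E.combine (works ((bif c a then [.cons, .nil, .nil] else [.nil]) ++ m) l r c') y) := by
  obtain ⟨C, p, hC⟩ := hc
  refine ⟨C.seq <| Frag.popMain.seq <| Frag.test
    (Frag.drop.seq <| Frag.push (.inl .main) .cons)
    (Frag.drop.seq <| Frag.push (.inl .main) .nil),
    p + 100, fun a m l r c' x y => ?_⟩
  have h1 := (hC a).2 m l r c' x y
  cases h : c a <;> rw [h] at h1
  · refine (Frag.seq_runs h1 <| Frag.seq_runs (Frag.popMain_runs .cons _) <| Frag.test_runs_nil <|
      Frag.seq_runs (Frag.drop_runs (.node .nil .nil)) <| Frag.workPush_main_runs _).mono ?_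
    simp
  · refine (Frag.seq_runs h1 <| Frag.seq_runs (Frag.popMain_runs .cons _) <| Frag.test_runs_cons <|
      Frag.seq_runs (Frag.drop_runs .nil) <| Frag.workPush_main_runs _).mono ?_
    simp

/-- The test consumes a duplicate of the argument. Each branch is required only where it is taken,
so it may rely on the condition, for instance on a list being non-empty. -/
theorem cond {c : α → Bool} {f : α → β} (hc : PT E c)
    (h1 : PT E (fun a : {a // c a = true} => f a.1))
    (h0 : PT E (fun a : {a // c a = false} => f a.1)) : PT E f := by
  obtain ⟨C, p, hC⟩ := exists_test hc
  obtain ⟨F, q, hF⟩ := h1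
  obtain ⟨G, q', hG⟩ := h0
  -- A positive test answers `cons, nil, nil`; after `cons` has been popped, two one-symbol trees
  -- remain to be dropped.
  refine ⟨Frag.dup.seq <| C.seq <| Frag.test (Frag.drop.seq <| Frag.drop.seq F) G,
    12 * Polynomial.X + p + q + q' + 50, fun a => ⟨?_, fun m l r c' x y => ?_⟩⟩
  · cases h : c a
    · have := (hG ⟨a, h⟩).1
      simp at this ⊢; omega
    · have := (hF ⟨a, h⟩).1
      simp at this ⊢; omega
  · have h0 := Frag.dup_runs (E := E) (x := x) (y := y) (m := m) (l := l) (r := r) (c := c') (enc a)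
    have h1 := hC a ((enc a).str ++ m) l r c' x y
    cases h : c a
    · have h2 := (hG ⟨a, h⟩).2 m l r c' x y
      rw [h] at h1
      refine (Frag.seq_runs h0 <| Frag.seq_runs h1 <| Frag.test_runs_nil h2).mono ?_
      simp [encSize, show enc (⟨a, h⟩ : {a // c a = _}) = enc a from rfl]; omega
    · have h2 := (hF ⟨a, h⟩).2 m l r c' x y
      rw [h] at h1
      refine (Frag.seq_runs h0 <| Frag.seq_runs h1 <| Frag.test_runs_cons <|
        Frag.seq_runs (Frag.drop_runs .nil) <| Frag.seq_runs (Frag.drop_runs .nil) h2).mono ?_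
      simp [encSize, show enc (⟨a, h⟩ : {a // c a = _}) = enc a from rfl]; omega

/-- Iteration while a condition holds. The number of iterations and the sizes of the intermediate
results have to be bounded polynomially. -/
theorem iterate {c : α → Bool} {f g : α → α} (hc : PT E c) (hf : PT E f) (b : Polynomial ℕ)
    (h : ∀ a, ∃ n ≤ b.eval (encSize a), f^[n] a = g a ∧ c (g a) = false ∧
      (∀ i < n, c (f^[i] a) = true) ∧ ∀ i ≤ n, encSize (f^[i] a) ≤ b.eval (encSize a)) :
    PT E g := by
  obtain ⟨C, p, hC⟩ := exists_test hc
  obtain ⟨F, q, hF⟩ := hf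
  let B : Frag E := Frag.drop.seq <| Frag.drop.seq <| F.seq <| Frag.dup.seq C
  -- The summand `b` bounds the size of the result. The factor `b + 2` counts the initial test and
  -- at most `b + 1` visits to the head of the loop, each within the bound called `T` below.
  refine ⟨(Frag.dup.seq C).seq (Frag.testLoop B),
    b + (12 * b + p.comp b + 50 + q.comp b) * (b + 2), fun a => ?_⟩
  obtain ⟨n, hn, hg, hcg, hci, hs⟩ := h a
  refine ⟨?_, fun m l r c' x y => ?_⟩
  · have := hs n le_rfl
    rw [hg] at this
    simp; omega
  · set N := b.eval (encSize a)
    set T := 12 * N + p.eval N + 50 + q.eval N with hT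
    have hstep : ∀ a', encSize a' ≤ N → (Frag.dup.seq C : Frag E).Runs (12 * N + 9 + p.eval N)
        x (E.combine (works ((enc a').str ++ m) l r c') y)
        x (E.combine (works ((bif c a' then [.cons, .nil, .nil] else [.nil]) ++
          ((enc a').str ++ m)) l r c') y) := by
      intro a' ha'
      have := polynomial_eval_mono p ha'
      refine (Frag.seq_runs (Frag.dup_runs (enc a')) (hC a' _ _ _ _ _ _)).mono ?_
      simp only [encSize] at *
      omega
    have key : ∀ k a', (∀ i ≤ k, encSize (f^[i] a') ≤ N) → (∀ i < k, c (f^[i] a') = true) →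
        c (f^[k] a') = false → (Frag.testLoop B).Runs ((k + 1) * T)
        x (E.combine (works ((bif c a' then [.cons, .nil, .nil] else [.nil]) ++
          ((enc a').str ++ m)) l r c') y)
        x (E.combine (works ((enc (f^[k] a')).str ++ m) l r c') y) := by
      intro k
      induction k with
      | zero =>
        intro a' _ _ h0
        simp only [Function.iterate_zero, id_eq] at h0 ⊢
        rw [h0]
        exact Frag.testLoop_runs_nil.mono (by omega)
      | succ k ih =>
        intro a' h1 h2 h3
        have h0 := h2 0 (by omega)
        simp only [Function.iterate_zero, id_eq] at h0
        have hq := polynomial_eval_mono q (h1 0 (by omega))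
        have h4 := ih (f a') (fun i hi => h1 (i + 1) (by omega)) (fun i hi => h2 (i + 1) (by omega))
          h3
        have h5 := hstep (f a') (h1 1 (by omega))
        rw [h0]
        refine (Frag.testLoop_runs_cons (Frag.seq_runs (Frag.drop_runs .nil) <|
          Frag.seq_runs (Frag.drop_runs .nil) <| Frag.seq_runs ((hF a').2 m l r c' x y) h5)
          h4).mono ?_
        simp only [Function.iterate_zero, id_eq] at hq
        have : (k + 1 + 1) * T = T + (k + 1) * T := by ring
        simp only [Data.size_nil]
        omega
    have h6 := key n a hs hci (by rw [hg, hcg])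
    rw [hg] at h6
    refine (Frag.seq_runs (hstep a (hs 0 (by omega))) h6).mono ?_
    have h7 : (n + 1) * T ≤ (N + 1) * T := Nat.mul_le_mul_right _ (by omega)
    have h8 : T * (N + 2) = T + (N + 1) * T := by ring
    simp only [Polynomial.eval_add, Polynomial.eval_mul, Polynomial.eval_comp,
      Polynomial.eval_ofNat]
    change _ ≤ N + T * (N + 2)
    omega

end PT

end MinTreeProof

namespace MinTreeProof

open Enc

def Data.isNode : Data → Bool
  | .nil => false
  | .node _ _ => true

namespace PT

variable {E : Env} {α β γ δ : Type} [Enc α] [Enc β] [Enc γ] [Enc δ]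

/-! ### Case distinctions -/

theorem of_eq {f g : α → β} (hf : PT E f) (h : ∀ a, f a = g a) : PT E g := funext h ▸ hf

theorem subtype_mk {p : β → Prop} {f : α → β} (hf : PT E f) (h : ∀ a, p (f a)) :
    PT E (fun a => (⟨f a, h a⟩ : {b // p b})) := hf

theorem encode : PT E (enc : α → Data) := of_enc_eq fun _ => rfl

theorem isNode : PT E Data.isNode := by
  refine ⟨Frag.test (Frag.drop.seq <| .const (enc true))
    ((Frag.push (.inl .main) .nil).seq <| .const (enc false)), 14 * Polynomial.X + 100,
    fun a => ⟨by simp, fun m l r c x y => ?_⟩⟩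
  cases a with
  | nil =>
    refine (Frag.test_runs_nil <| Frag.seq_runs (Frag.workPush_main_runs .nil) <|
      Frag.const_runs .nil (enc false)).mono ?_
    simp only [Polynomial.eval_add, Polynomial.eval_mul, Polynomial.eval_ofNat, Polynomial.eval_X,
      Data.size_nil, show (enc false).size = 5 from rfl]
    omega
  | node s t =>
    rw [show (enc (s.node t)).str ++ m = .cons :: (s.str ++ (t.str ++ m)) by simp [enc, Data.str]]
    refine (Frag.test_runs_cons <| Frag.seq_runs (Frag.drop_runs s) <|
      Frag.const_runs t (enc true)).mono ?_
    have : encSize (s.node t) = s.size + t.size + 1 := Data.size_node _ _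
    simp only [Polynomial.eval_add, Polynomial.eval_mul, Polynomial.eval_ofNat, Polynomial.eval_X,
      this, show (enc true).size = 5 from rfl]
    omega

/-- A node has the same code as the pair of its subtrees, so on the subtype of nodes taking apart is
the identity on codes (`u` below). -/
theorem data_cases {d : α → Data} {k g : α → γ} {h : α × Data × Data → γ} (hd : PT E d)
    (hg : PT E g) (hh : PT E h) (hnil : ∀ a, d a = .nil → k a = g a)
    (hnode : ∀ a x y, d a = .node x y → k a = h (a, x, y)) : PT E k := by
  refine cond (c := fun a => (d a).isNode) (isNode.comp hd) ?_ ?_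
  · let u : {d : Data // d.isNode = true} → Data × Data := fun
      | ⟨.node x y, _⟩ => (x, y)
      | ⟨.nil, h⟩ => by cases h
    have hu : PT E u := of_enc_eq fun
      | ⟨.node x y, _⟩ => rfl
      | ⟨.nil, h⟩ => by cases h
    have hu' : ∀ (z : {d : Data // d.isNode = true}) x y, z.1 = .node x y → u z = (x, y) := by
      rintro ⟨_, h⟩ x y rfl; rfl
    have hs : PT E (fun a : {a // (d a).isNode = true} =>
        (⟨d a.1, a.2⟩ : {d : Data // d.isNode = true})) := subtype_mk (hd.restrict _) _
    refine (hh.comp (subtype_val.prodMk (hu.comp hs))).of_eq ?_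
    rintro ⟨a, ha⟩
    obtain ⟨x, y, h⟩ : ∃ x y, d a = .node x y := by
      cases h : d a with
      | nil => rw [h] at ha; cases ha
      | node x y => exact ⟨x, y, rfl⟩
    rw [hnode a x y h, hu' ⟨d a, ha⟩ x y h]
  · refine (hg.restrict _).of_eq ?_
    rintro ⟨a, ha⟩
    cases h : d a with
    | nil => exact (hnil a h).symm
    | node x y => rw [h] at ha; cases ha

/-- As for trees: a non-empty list has the code of the pair of its head and tail. -/
theorem list_cases {l : α → List β} {k g : α → γ} {h : α × β × List β → γ} (hl : PT E l)
    (hg : PT E g) (hh : PT E h) (hnil : ∀ a, l a = [] → k a = g a)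
    (hcons : ∀ a b t, l a = b :: t → k a = h (a, b, t)) : PT E k := by
  refine cond (c := fun a => (enc (l a)).isNode) (isNode.comp (encode.comp hl)) ?_ ?_
  · let u : {l : List β // (enc l).isNode = true} → β × List β := fun
      | ⟨b :: t, _⟩ => (b, t)
      | ⟨[], h⟩ => by cases h
    have hu : PT E u := of_enc_eq fun
      | ⟨b :: t, _⟩ => rfl
      | ⟨[], h⟩ => by cases h
    have hu' : ∀ (z : {l : List β // (enc l).isNode = true}) x y, z.1 = x :: y →
        u z = (x, y) := by
      rintro ⟨_, h⟩ x y rfl; rfl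
    have hs : PT E (fun a : {a // (enc (l a)).isNode = true} =>
        (⟨l a.1, a.2⟩ : {l : List β // (enc l).isNode = true})) := subtype_mk (hl.restrict _) _
    refine (hh.comp (subtype_val.prodMk (hu.comp hs))).of_eq ?_
    rintro ⟨a, ha⟩
    obtain ⟨x, y, h⟩ : ∃ x y, l a = x :: y := by
      cases h : l a with
      | nil => rw [h] at ha; cases ha
      | cons x y => exact ⟨x, y, rfl⟩
    rw [hcons a x y h, hu' ⟨l a, ha⟩ x y h]
  · refine (hg.restrict _).of_eq ?_
    rintro ⟨a, ha⟩
    cases h : l a with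
    | nil => exact (hnil a h).symm
    | cons x y => rw [h] at ha; cases ha

@[fun_prop]
theorem cond' {c : α → Bool} {f g : α → β} (hc : PT E c) (hf : PT E f) (hg : PT E g) :
    PT E (fun a => bif c a then f a else g a) :=
  cond hc ((hf.restrict _).of_eq fun a => by rw [a.2]; rfl)
    ((hg.restrict _).of_eq fun a => by rw [a.2]; rfl)

@[fun_prop]
theorem not {c : α → Bool} (hc : PT E c) : PT E (fun a => !c a) :=
  (cond' hc (const false) (const true)).of_eq fun a => by cases c a <;> rfl

@[fun_prop]
theorem and {c d : α → Bool} (hc : PT E c) (hd : PT E d) : PT E (fun a => c a && d a) :=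
  (cond' hc hd (const false)).of_eq fun a => by cases c a <;> rfl

@[fun_prop]
theorem or {c d : α → Bool} (hc : PT E c) (hd : PT E d) : PT E (fun a => c a || d a) :=
  (cond' hc (const true) hd).of_eq fun a => by cases c a <;> rfl

@[fun_prop]
theorem xor {c d : α → Bool} (hc : PT E c) (hd : PT E d) : PT E (fun a => c a ^^ d a) :=
  (cond' hc (not hd) hd).of_eq fun a => by cases c a <;> cases d a <;> rfl

/-! ### Lists -/

@[fun_prop]
theorem list_cons {f : α → β} {l : α → List β} (hf : PT E f) (hl : PT E l) :
    PT E (fun a => f a :: l a) :=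
  (of_enc_eq (f := fun p : β × List β => p.1 :: p.2) fun _ => rfl).comp (hf.prodMk hl)

@[fun_prop]
theorem headD {f : α → β} {l : α → List β} (hf : PT E f) (hl : PT E l) :
    PT E (fun a => (l a).headD (f a)) :=
  list_cases (h := fun p => p.2.1) hl hf (by fun_prop) (by simp +contextual)
    (by simp +contextual)

@[fun_prop]
theorem tail {l : α → List β} (hl : PT E l) : PT E (fun a => (l a).tail) :=
  list_cases (h := fun p => p.2.2) hl (const []) (by fun_prop) (by simp +contextual)
    (by simp +contextual)

@[fun_prop]
theorem isEmpty {l : α → List β} (hl : PT E l) : PT E (fun a => (l a).isEmpty) :=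
  list_cases (h := fun _ => false) hl (const true) (const _) (by simp +contextual)
    (by simp +contextual)

theorem encSize_length_le (l : List β) : l.length ≤ encSize l := by
  induction l with
  | nil => simp
  | cons a l ih => simp; omega

theorem encSize_append (l l' : List β) : encSize (l ++ l') + 1 = encSize l + encSize l' := by
  induction l with
  | nil => simp; omega
  | cons a l ih => simp; omega

theorem encSize_take_le (l : List β) (n : ℕ) : encSize (l.take n) ≤ encSize l := by
  have := encSize_append (l.take n) (l.drop n)
  have := encSize_pos (l.drop n)
  rw [List.take_append_drop] at *
  omega

theorem encSize_drop_le (l : List β) (n : ℕ) : encSize (l.drop n) ≤ encSize l := by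
  have := encSize_append (l.take n) (l.drop n)
  have := encSize_pos (l.take n)
  rw [List.take_append_drop] at *
  omega

/-- Iterates on triples of parameter, accumulator and remaining list until the list is empty. The
intermediate accumulators are folds over prefixes of the list, which is why `hq` speaks of all
lists. -/
theorem foldl {f : α → β → γ → β} {b : α → β} {l : α → List γ}
    (hf : PT E (fun p : α × β × γ => f p.1 p.2.1 p.2.2)) (hb : PT E b) (hl : PT E l)
    (q : Polynomial ℕ) (hq : ∀ a b (l : List γ), encSize (l.foldl (f a) b) ≤
      q.eval (encSize a + encSize b + encSize l)) :
    PT E (fun a => (l a).foldl (f a) (b a)) := by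
  let step : α × β × List γ → α × β × List γ := fun s => match s.2.2 with
    | [] => s
    | c :: t => (s.1, f s.1 s.2.1 c, t)
  have hstep : PT E step := list_cases (l := fun s => s.2.2) (g := fun s => s)
    (h := fun p => (p.1.1, f p.1.1 p.1.2.1 p.2.1, p.2.2)) (by fun_prop) (by fun_prop)
    ((by fun_prop : PT E fun p : (α × β × List γ) × γ × List γ => p.1.1).prodMk
      ((hf.comp (by fun_prop : PT E fun p : (α × β × List γ) × γ × List γ =>
        (p.1.1, p.1.2.1, p.2.1))).prodMk (by fun_prop)))
    (fun a h => by simp only [step, h]) (fun a b t h => by simp only [step, h])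
  have hit : ∀ i a b l, step^[i] (a, b, l) = (a, (l.take i).foldl (f a) b, l.drop i) := by
    intro i
    induction i with
    | zero => simp
    | succ i ih =>
      intro a b l
      rw [Function.iterate_succ_apply]
      cases l with
      | nil => simpa [step] using ih a b []
      | cons c t => simpa [step] using ih a (f a b c) t
  have hloop : PT E (fun s : α × β × List γ => (s.1, s.2.2.foldl (f s.1) s.2.1, ([] : List γ))) := by
    refine iterate (c := fun s => !s.2.2.isEmpty) (by fun_prop) hstep
      (Polynomial.X + q + 2) fun s => ?_
    obtain ⟨a, b, l⟩ := s
    refine ⟨l.length, ?_, by simp [hit], by simp, fun i hi => by simpa [hit] using hi,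
      fun i hi => ?_⟩
    · have := encSize_length_le l
      simp; omega
    · have h1 := hq a b (l.take i)
      have h2 := encSize_take_le l i
      have h3 := encSize_drop_le l i
      have h4 := polynomial_eval_mono q (show encSize a + encSize b + encSize (l.take i) ≤
        encSize (a, b, l) by simp; omega)
      have h5 : encSize (a, b, l) = encSize a + (encSize b + encSize l + 1) + 1 := by simp
      rw [hit]
      simp only [Polynomial.eval_add, Polynomial.eval_ofNat, Polynomial.eval_X]
      rw [encSize_prod, encSize_prod]
      simp only
      omega
  let pick : α → α × β × List γ := fun a => (a, b a, l a)
  have hpick : PT E pick := id.prodMk (hb.prodMk hl)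
  have := hloop.comp hpick
  exact (by fun_prop : PT E fun s : α × β × List γ => s.2.1).comp this

/-- A version of `foldl` where every step increases the size by a bounded amount. -/
theorem foldl_of_growth {f : α → β → γ → β} {b : α → β} {l : α → List γ}
    (hf : PT E (fun p : α × β × γ => f p.1 p.2.1 p.2.2)) (hb : PT E b) (hl : PT E l)
    (q : Polynomial ℕ) (hq : ∀ a b c, encSize (f a b c) ≤ encSize b +
      q.eval (encSize a + encSize c)) :
    PT E (fun a => (l a).foldl (f a) (b a)) := by
  -- The initial size, and at most as many increments as the list has symbols.
  refine foldl hf hb hl (Polynomial.X + Polynomial.X * q) fun a b l => ?_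
  have key : ∀ (l : List γ) (b : β) (n : ℕ), encSize l ≤ n → encSize (l.foldl (f a) b) ≤
      encSize b + l.length * q.eval (encSize a + n) := by
    intro l
    induction l with
    | nil => simp
    | cons c l ih =>
      intro b n hn
      simp only [encSize_cons] at hn
      have h1 := ih (f a b c) n (by omega)
      have h2 := hq a b c
      have h3 := polynomial_eval_mono q (show encSize a + encSize c ≤ encSize a + n by omega)
      simp only [List.foldl_cons, List.length_cons, add_mul]
      omega
  refine (key l b _ le_rfl).trans ?_
  simp only [Polynomial.eval_add, Polynomial.eval_mul, Polynomial.eval_X]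
  have h1 := encSize_length_le l
  have h2 := polynomial_eval_mono q
    (show encSize a + encSize l ≤ encSize a + encSize b + encSize l by omega)
  have := Nat.mul_le_mul (show l.length ≤ encSize a + encSize b + encSize l by omega) h2
  omega

@[fun_prop]
theorem reverse {l : α → List β} (hl : PT E l) : PT E (fun a => (l a).reverse) :=
  (foldl_of_growth (f := fun _ (t : List β) c => c :: t) (b := fun _ => []) (by fun_prop)
    (by fun_prop) hl (Polynomial.X + 1) (fun a b c => by simp; omega)).of_eq fun a => by
    simp

@[fun_prop]
theorem append {l l' : α → List β} (hl : PT E l) (hl' : PT E l') :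
    PT E (fun a => l a ++ l' a) :=
  (foldl_of_growth (f := fun _ (t : List β) c => c :: t) (l := fun a => (l a).reverse)
    (by fun_prop) hl' (by fun_prop) (Polynomial.X + 1) (fun a b c => by simp; omega)).of_eq
    fun a => by simp

theorem exists_size_bound {f : α → β} (hf : PT E f) :
    ∃ p : Polynomial ℕ, ∀ a, encSize (f a) ≤ p.eval (encSize a) := by
  obtain ⟨F, p, h⟩ := hf
  exact ⟨p, fun a => (h a).1⟩

theorem map {f : α → β → γ} {l : α → List β} (hf : PT E (fun p : α × β => f p.1 p.2))
    (hl : PT E l) : PT E (fun a => (l a).map (f a)) := by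
  obtain ⟨p, hp⟩ := exists_size_bound hf
  refine (reverse (foldl_of_growth (f := fun a (t : List γ) c => f a c :: t) (b := fun _ => [])
    ?_ (by fun_prop) hl (p.comp (Polynomial.X + 1) + 1) fun a b c => ?_)).of_eq fun a => ?_
  · exact list_cons (hf.comp (by fun_prop : PT E fun p : α × List γ × β => (p.1, p.2.2)))
      (by fun_prop)
  · have := hp (a, c)
    simp at this ⊢; omega
  · have key : ∀ (l : List β) (t : List γ), l.foldl (fun t c => f a c :: t) t =
        (l.map (f a)).reverse ++ t := by
      intro l
      induction l with
      | nil => simp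
      | cons c l ih => simp [ih]
    simp [key]

theorem any {f : α → β → Bool} {l : α → List β} (hf : PT E (fun p : α × β => f p.1 p.2))
    (hl : PT E l) : PT E (fun a => (l a).any (f a)) := by
  refine (foldl_of_growth (f := fun a t c => t || f a c) (b := fun _ => false)
    ?_ (by fun_prop) hl 0 fun a b c => by simp).of_eq fun a => ?_
  · exact or (by fun_prop) (hf.comp (by fun_prop : PT E fun p : α × Bool × β => (p.1, p.2.2)))
  · have key : ∀ (l : List β) (t : Bool), l.foldl (fun t c => t || f a c) t = (t || l.any (f a)) := by
      intro l
      induction l with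
      | nil => simp
      | cons c l ih => simp [ih, Bool.or_assoc]
    simp [key]

/-! ### Equality -/

/-- One step of the comparison of two trees. -/
def eqStep (s : List (Data × Data) × Bool) : List (Data × Data) × Bool :=
  match s with
  | ([], b) => ([], b)
  | ((.nil, .nil) :: t, b) => (t, b)
  | ((.node x y, .node x' y') :: t, b) => ((x, x') :: (y, y') :: t, b)
  | ((.nil, .node _ _) :: _, _) => ([], false)
  | ((.node _ _, .nil) :: _, _) => ([], false)

theorem eqStep_pt : PT E eqStep := by
  refine list_cases (l := fun s => s.1) (g := fun s => s)
    (h := fun p => eqStep (p.2.1 :: p.2.2, p.1.2))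
    (by fun_prop) (by fun_prop) ?_ ?_ ?_
  · refine data_cases (d := fun p => p.2.1.1)
      (g := fun p => bif p.2.1.2.isNode then ([], false) else (p.2.2, p.1.2))
      (h := fun r => eqStep ((.node r.2.1 r.2.2, r.1.2.1.2) :: r.1.2.2, r.1.1.2))
      (by fun_prop) (cond' (isNode.comp (by fun_prop)) (by fun_prop) (by fun_prop)) ?_ ?_ ?_
    · refine data_cases (d := fun r => r.1.2.1.2) (g := fun _ => ([], false))
        (h := fun r => ((r.1.2.1, r.2.1) :: (r.1.2.2, r.2.2) :: r.1.1.2.2, r.1.1.1.2))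
        (by fun_prop) (by fun_prop) (by fun_prop) ?_ ?_
      · intro a h; simp only [h, eqStep]
      · intro a x y h; simp only [h, eqStep]
    · rintro ⟨⟨s, b⟩, ⟨x, y⟩, t⟩ h
      simp only at h
      subst h
      cases y <;> simp [eqStep, Data.isNode]
    · rintro ⟨⟨s, b⟩, ⟨x, y⟩, t⟩ x' y' h
      simp only at h
      subst h
      rfl
  · rintro ⟨s, b⟩ h
    simp only at h
    subst h
    rfl
  · rintro ⟨s, b⟩ p t h
    simp only at h
    subst h
    rfl

/-- The total size of the first components of the pending pairs decreases: two subtrees together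
have one symbol less than their parent, and a mismatch empties the list. For the same reason the
state never grows. -/
theorem eqStep_iterate (n : ℕ) : ∀ s : List (Data × Data) × Bool,
    (s.1.map fun p => p.1.size).sum = n → ∃ k ≤ n,
      eqStep^[k] s = ([], s.2 && s.1.all fun p => decide (p.1 = p.2)) ∧
      (∀ i < k, (eqStep^[i] s).1 ≠ []) ∧ ∀ i ≤ k, encSize (eqStep^[i] s) ≤ encSize s := by
  induction n using Nat.strong_induction_on with
  | _ n ih =>
    have step : ∀ s s' : List (Data × Data) × Bool, eqStep s = s' → s.1 ≠ [] →
        (s.1.map fun p => p.1.size).sum = n → (s'.1.map fun p => p.1.size).sum < n →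
        encSize s' ≤ encSize s →
        (s'.2 && s'.1.all fun p => decide (p.1 = p.2)) =
          (s.2 && s.1.all fun p => decide (p.1 = p.2)) → ∃ k ≤ n,
        eqStep^[k] s = ([], s.2 && s.1.all fun p => decide (p.1 = p.2)) ∧
        (∀ i < k, (eqStep^[i] s).1 ≠ []) ∧ ∀ i ≤ k, encSize (eqStep^[i] s) ≤ encSize s := by
      rintro s s' rfl hs hn hn' hsize hr
      obtain ⟨k, hk, h1, h2, h3⟩ := ih _ hn' _ rfl
      refine ⟨k + 1, by omega, by rw [Function.iterate_succ_apply, h1, hr], fun i hi => ?_,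
        fun i hi => ?_⟩
      · cases i with
        | zero => exact hs
        | succ i => rw [Function.iterate_succ_apply]; exact h2 i (by omega)
      · cases i with
        | zero => exact le_rfl
        | succ i => rw [Function.iterate_succ_apply]; exact (h3 i (by omega)).trans hsize
    rintro ⟨l, b⟩ hn
    match l, hn with
    | [], hn =>
      refine ⟨0, by omega, by simp, by simp, fun i hi => ?_⟩
      obtain rfl : i = 0 := by omega
      exact le_rfl
    | (.nil, .nil) :: t, hn =>
      refine step _ _ rfl (by simp) hn ?_ ?_ ?_
      · simp [eqStep] at hn ⊢; omega
      · simp [eqStep]; omega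
      · simp [eqStep]
    | (.node x y, .node x' y') :: t, hn =>
      refine step _ _ rfl (by simp) hn ?_ ?_ ?_
      · simp [eqStep] at hn ⊢; omega
      · have h1 : encSize (x.node y) = encSize x + encSize y + 1 := Data.size_node _ _
        have h2 : encSize (x'.node y') = encSize x' + encSize y' + 1 := Data.size_node _ _
        simp [eqStep, h1, h2]; omega
      · simp [eqStep, Bool.and_assoc]
    | (.nil, .node _ _) :: t, hn =>
      refine step _ _ rfl (by simp) hn ?_ ?_ ?_
      · simp [eqStep] at hn ⊢; omega
      · simp [eqStep]
      · simp [eqStep]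
    | (.node _ _, .nil) :: t, hn =>
      refine step _ _ rfl (by simp) hn ?_ ?_ ?_
      · simp [eqStep] at hn ⊢; omega
      · simp [eqStep]
      · simp [eqStep]

theorem data_eq {f g : α → Data} (hf : PT E f) (hg : PT E g) :
    PT E (fun a => decide (f a = g a)) := by
  have : PT E (fun s : List (Data × Data) × Bool =>
      (([] : List (Data × Data)), s.2 && s.1.all fun p => decide (p.1 = p.2))) := by
    refine iterate (c := fun s => !s.1.isEmpty) (by fun_prop) eqStep_pt Polynomial.X fun s => ?_
    obtain ⟨k, hk, h1, h2, h3⟩ := eqStep_iterate _ s rfl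
    refine ⟨k, hk.trans ?_, h1, by simp, fun i hi => by simpa using h2 i hi, by simpa using h3⟩
    have key : ∀ l : List (Data × Data), (l.map fun p => p.1.size).sum ≤ encSize l := by
      intro l
      induction l with
      | nil => simp
      | cons a l ih =>
        simp
        have : encSize a.1 = a.1.size := rfl
        omega
    have := key s.1
    simp; omega
  refine ((by fun_prop : PT E fun s : List (Data × Data) × Bool => s.2).comp <|
    this.comp (by fun_prop : PT E fun a => ([(f a, g a)], true))).of_eq fun a => by simp

/-- Equality test by means of the encodings. -/
def _root_.MinTreeProof.encEq (b b' : β) : Bool := decide (enc b = enc b')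

@[simp] theorem _root_.MinTreeProof.encEq_iff {b b' : β} : encEq b b' = true ↔ b = b' := by
  simp [encEq, enc_injective.eq_iff]

@[fun_prop]
theorem encEq {f g : α → β} (hf : PT E f) (hg : PT E g) : PT E (fun a => encEq (f a) (g a)) :=
  data_eq (encode.comp hf) (encode.comp hg)

end PT

end MinTreeProof

namespace MinTreeProof

open Enc

/-! ## Binary arithmetic -/

theorem foldr_bit_bits (n : ℕ) : n.bits.foldr Nat.bit 0 = n := by
  induction n using Nat.binaryRec' with
  | zero => simp
  | bit b n h ih => rw [Nat.bits_append_bit _ _ h, List.foldr_cons, ih]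

/-- Binary digits, least significant first, are essential: the bound and the sizes of trees can be
exponential in the length of the input. Since a number and its list of digits have the same code,
arithmetic reduces to lists of truth values. -/
instance : Enc ℕ where
  enc n := enc n.bits
  enc_injective a b h := by
    rw [← foldr_bit_bits a, ← foldr_bit_bits b, enc_injective h]

theorem encSize_nat (n : ℕ) : encSize n = 6 * n.size + 1 := by
  have key : ∀ l : List Bool, encSize l = 6 * l.length + 1 := by
    intro l
    induction l with
    | nil => simp
    | cons b l ih => simp [ih]; omega
  rw [← Nat.size_eq_bits_len]
  exact key n.bits

theorem encSize_nat_mono {m n : ℕ} (h : m ≤ n) : encSize m ≤ encSize n := by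
  simpa [encSize_nat] using Nat.size_le_size h

theorem size_add_le (m n : ℕ) : (m + n).size ≤ m.size + n.size + 1 := by
  rw [Nat.size_le]
  have h1 := Nat.lt_size_self m
  have h2 := Nat.lt_size_self n
  have h3 : 2 ^ m.size ≤ 2 ^ (m.size + n.size) := Nat.pow_le_pow_right (by omega) (by omega)
  have h4 : 2 ^ n.size ≤ 2 ^ (m.size + n.size) := Nat.pow_le_pow_right (by omega) (by omega)
  rw [pow_succ]
  omega

theorem encodeNat_eq_bits (n : ℕ) : Computability.encodeNat n = n.bits := by
  have key : ∀ p : PosNum, Computability.encodePosNum p = (p : ℕ).bits := by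
    intro p
    induction p with
    | one => simp [Computability.encodePosNum]
    | bit0 p ih =>
      rw [Computability.encodePosNum, ih, PosNum.cast_bit0, ← two_mul,
        Nat.bit0_bits _ (PosNum.cast_pos p).ne']
    | bit1 p ih =>
      rw [Computability.encodePosNum, ih, PosNum.cast_bit1, ← two_mul, Nat.bit1_bits]
  have h := Num.to_of_nat n
  unfold Computability.encodeNat
  cases h' : (n : Num) with
  | zero => rw [h'] at h; simp at h; subst h; simp [Computability.encodeNum]
  | pos p =>
    rw [h'] at h
    simp only [Num.cast_pos] at h
    rw [Computability.encodeNum, key, h]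

namespace PT

variable {E : Env} {α β γ δ : Type} [Enc α] [Enc β] [Enc γ] [Enc δ]

@[fun_prop]
theorem bits {f : α → ℕ} (hf : PT E f) : PT E (fun a => (f a).bits) := hf

theorem of_bits {f : α → ℕ} (hf : PT E (fun a => (f a).bits)) : PT E f := hf

@[fun_prop]
theorem bodd {f : α → ℕ} (hf : PT E f) : PT E (fun a => (f a).bodd) :=
  (by fun_prop : PT E fun a => (f a).bits.headD false).of_eq fun a => by
    rw [Nat.bodd_eq_bits_head]; cases (f a).bits <;> rfl

@[fun_prop]
theorem div2 {f : α → ℕ} (hf : PT E f) : PT E (fun a => (f a).div2) :=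
  of_bits <| (by fun_prop : PT E fun a => (f a).bits.tail).of_eq fun a =>
    (Nat.div2_bits_eq_tail _).symm

@[fun_prop]
theorem natBit {b : α → Bool} {f : α → ℕ} (hb : PT E b) (hf : PT E f) :
    PT E (fun a => Nat.bit (b a) (f a)) :=
  -- The most significant digit must not be zero, so a zero digit put before the empty list is
  -- discarded.
  of_bits <| (by fun_prop : PT E fun a => _root_.cond ((f a).bits.isEmpty && !b a) []
    (b a :: (f a).bits)).of_eq fun a => by
      by_cases h : f a = 0 → b a = true
      · rw [Nat.bits_append_bit _ _ h]
        cases hb : b a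
        · have h0 : f a ≠ 0 := fun e => by simp [h e] at hb
          have : (f a).bits ≠ [] := fun e => h0 (by rw [← foldr_bit_bits (f a), e]; rfl)
          simp [List.isEmpty_eq_false_iff.2 this]
        · simp
      · push Not at h
        have hb : b a = false := by simpa using h.2
        simp [h.1, hb]

/-- One step of binary addition; the state holds the two numbers, the carry and the digits of the
result. -/
def addStep (s : ℕ × ℕ × Bool × List Bool) : ℕ × ℕ × Bool × List Bool :=
  (s.1.div2, s.2.1.div2,
    (s.1.bodd && s.2.1.bodd) || (s.1.bodd && s.2.2.1) || (s.2.1.bodd && s.2.2.1),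
    (s.1.bodd ^^ s.2.1.bodd ^^ s.2.2.1) :: s.2.2.2)

/-- The invariant of addition with carry: the unread parts plus the carry, with the digits already
written appended below, always represent the same number. -/
theorem addStep_sum (s : ℕ × ℕ × Bool × List Bool) :
    (addStep s).2.2.2.foldl (fun n b => Nat.bit b n)
      ((addStep s).1 + (addStep s).2.1 + (addStep s).2.2.1.toNat) =
    s.2.2.2.foldl (fun n b => Nat.bit b n) (s.1 + s.2.1 + s.2.2.1.toNat) := by
  obtain ⟨x, y, c, l⟩ := s
  simp only [addStep, List.foldl_cons]
  congr 1
  have hx := Nat.bodd_add_div2 x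
  have hy := Nat.bodd_add_div2 y
  rw [Nat.bit_val]
  generalize x.div2 = x' at *
  generalize y.div2 = y' at *
  cases h1 : x.bodd <;> cases h2 : y.bodd <;> cases c <;> simp_all <;> omega

theorem div2_iterate_eq_zero (n k : ℕ) (h : n.size ≤ k) : Nat.div2^[k] n = 0 := by
  induction k generalizing n with
  | zero =>
    have : n < 2 ^ 0 := Nat.size_le.1 h
    simp at this ⊢; omega
  | succ k ih =>
    rw [Function.iterate_succ_apply]
    apply ih
    have := Nat.size_le.1 h
    rw [Nat.size_le, Nat.div2_val]
    rw [pow_succ] at this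
    omega

theorem foldl_const_eq_iterate {α β : Type*} (f : α → α) (l : List β) (a : α) :
    l.foldl (fun a _ => f a) a = f^[l.length] a := by
  induction l generalizing a with
  | nil => rfl
  | cons b l ih => simp [ih]

theorem addStep_iterate_fst (k : ℕ) (s : ℕ × ℕ × Bool × List Bool) :
    (addStep^[k] s).1 = Nat.div2^[k] s.1 ∧ (addStep^[k] s).2.1 = Nat.div2^[k] s.2.1 := by
  induction k generalizing s with
  | zero => simp
  | succ k ih => simpa [Function.iterate_succ_apply, addStep] using ih (addStep s)

/-- The list `x.bits ++ y.bits` is only a clock, long enough to use up both summands; the extra step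
writes out the last carry. -/
theorem add_eq (x y : ℕ) :
    (addStep ((x.bits ++ y.bits).foldl (fun s _ => addStep s) (x, y, false, []))).2.2.2.foldl
      (fun n b => Nat.bit b n) 0 = x + y := by
  rw [foldl_const_eq_iterate]
  set k := (x.bits ++ y.bits).length with hk
  have hk' : k = x.size + y.size := by simp [hk, Nat.size_eq_bits_len]
  obtain ⟨h1, h2⟩ := addStep_iterate_fst k (x, y, false, [])
  rw [div2_iterate_eq_zero _ _ (by simp only; omega)] at h1 h2
  set s := addStep^[k] (x, y, false, []) with hs
  have h3 : (addStep s).1 = 0 := by simp [addStep, h1]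
  have h4 : (addStep s).2.1 = 0 := by simp [addStep, h2]
  have h5 : (addStep s).2.2.1.toNat = 0 := by simp [addStep, h1, h2]
  have h6 : ∀ k s, (addStep^[k] s).2.2.2.foldl (fun n b => Nat.bit b n)
      ((addStep^[k] s).1 + (addStep^[k] s).2.1 + (addStep^[k] s).2.2.1.toNat) =
    s.2.2.2.foldl (fun n b => Nat.bit b n) (s.1 + s.2.1 + s.2.2.1.toNat) := by
    intro k
    induction k with
    | zero => simp
    | succ k ih => intro s; rw [Function.iterate_succ_apply, ih, addStep_sum]
  have h7 := addStep_sum s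
  rw [h3, h4, h5, hs, h6] at h7
  simpa using h7

theorem bit_size_le (b : Bool) (n : ℕ) : (Nat.bit b n).size ≤ n.size + 1 := by
  by_cases h : Nat.bit b n = 0
  · simp [h]
  · rw [Nat.size_bit h]

theorem foldl_bit {l : α → List Bool} (hl : PT E l) :
    PT E (fun a => (l a).foldl (fun n b => Nat.bit b n) 0) :=
  foldl_of_growth (f := fun _ n b => Nat.bit b n) (b := fun _ => 0) (by fun_prop) (by fun_prop) hl
    6 fun a n b => by
      have := bit_size_le b n
      simp [encSize_nat]; omega

theorem addStep_pt : PT E addStep := by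
  unfold addStep
  fun_prop

@[fun_prop]
theorem add {f g : α → ℕ} (hf : PT E f) (hg : PT E g) : PT E (fun a => f a + g a) := by
  refine (foldl_bit ((by fun_prop : PT E fun s : ℕ × ℕ × Bool × List Bool => s.2.2.2).comp <|
    addStep_pt.comp <| foldl_of_growth (f := fun _ s _ => addStep s)
      (b := fun a => (f a, g a, false, [])) (l := fun a => (f a).bits ++ (g a).bits) ?_ ?_ ?_ 6
      fun a s b => ?_)).of_eq fun a => add_eq _ _
  · exact addStep_pt.comp (by fun_prop)
  · fun_prop
  · fun_prop
  · have h1 : encSize s.1.div2 ≤ encSize s.1 := encSize_nat_mono (by rw [Nat.div2_val]; omega)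
    have h2 : encSize s.2.1.div2 ≤ encSize s.2.1 :=
      encSize_nat_mono (by rw [Nat.div2_val]; omega)
    simp [addStep]; omega

/-- Digits are compared from the least significant one upwards, and every later difference overrides
the flag. Thus the flag decides when the unread parts agree. -/
def leStep (s : ℕ × ℕ × Bool) : ℕ × ℕ × Bool :=
  (s.1.div2, s.2.1.div2, bif s.1.bodd ^^ s.2.1.bodd then s.2.1.bodd else s.2.2)

theorem leStep_lt (s : ℕ × ℕ × Bool) : ((leStep s).1 < (leStep s).2.1 ∨
    (leStep s).1 = (leStep s).2.1 ∧ (leStep s).2.2 = true) ↔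
    (s.1 < s.2.1 ∨ s.1 = s.2.1 ∧ s.2.2 = true) := by
  obtain ⟨x, y, c⟩ := s
  simp only [leStep]
  have hx := Nat.bodd_add_div2 x
  have hy := Nat.bodd_add_div2 y
  generalize x.div2 = x' at *
  generalize y.div2 = y' at *
  cases h1 : x.bodd <;> cases h2 : y.bodd <;> cases c <;> simp_all <;> omega

theorem le_eq (x y : ℕ) :
    ((x.bits ++ y.bits).foldl (fun s _ => leStep s) (x, y, true)).2.2 = decide (x ≤ y) := by
  rw [foldl_const_eq_iterate]
  have h1 : ∀ k s, (leStep^[k] s).1 = Nat.div2^[k] s.1 ∧ (leStep^[k] s).2.1 = Nat.div2^[k] s.2.1 ∧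
      (((leStep^[k] s).1 < (leStep^[k] s).2.1 ∨
        (leStep^[k] s).1 = (leStep^[k] s).2.1 ∧ (leStep^[k] s).2.2 = true) ↔
      (s.1 < s.2.1 ∨ s.1 = s.2.1 ∧ s.2.2 = true)) := by
    intro k
    induction k with
    | zero => simp
    | succ k ih =>
      intro s
      rw [← leStep_lt s]
      exact ih (leStep s)
  obtain ⟨h2, h3, h4⟩ := h1 (x.bits ++ y.bits).length (x, y, true)
  rw [div2_iterate_eq_zero _ _ (by simp [Nat.size_eq_bits_len])] at h2 h3
  rw [h2, h3] at h4
  simp only [lt_irrefl, true_and, false_or, and_true] at h4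
  rw [Bool.eq_iff_iff, h4, decide_eq_true_iff]
  omega

@[fun_prop]
theorem le {f g : α → ℕ} (hf : PT E f) (hg : PT E g) : PT E (fun a => decide (f a ≤ g a)) := by
  have hstep : PT E leStep := by unfold leStep; fun_prop
  refine ((by fun_prop : PT E fun s : ℕ × ℕ × Bool => s.2.2).comp <|
    foldl_of_growth (f := fun _ s _ => leStep s)
      (b := fun a => (f a, g a, true)) (l := fun a => (f a).bits ++ (g a).bits) ?_ ?_ ?_ 6
      fun a s b => ?_).of_eq fun a => le_eq _ _
  · exact hstep.comp (by fun_prop)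
  · fun_prop
  · fun_prop
  · have h1 : encSize s.1.div2 ≤ encSize s.1 := encSize_nat_mono (by rw [Nat.div2_val]; omega)
    have h2 : encSize s.2.1.div2 ≤ encSize s.2.1 :=
      encSize_nat_mono (by rw [Nat.div2_val]; omega)
    simp [leStep]; omega

@[fun_prop]
theorem min {f g : α → ℕ} (hf : PT E f) (hg : PT E g) : PT E (fun a => Min.min (f a) (g a)) :=
  (by fun_prop : PT E fun a => _root_.cond (decide (f a ≤ g a)) (f a) (g a)).of_eq fun a => by
    rw [Bool.cond_decide]; rfl

@[fun_prop]
theorem sum {l : α → List ℕ} (hl : PT E l) : PT E (fun a => (l a).sum) := by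
  -- Every summand adds at most its own number of digits and one carry, both covered by its share of
  -- the code.
  have key : ∀ (l : List ℕ) (b : ℕ), (l.foldl (· + ·) b).size ≤ b.size + encSize l := by
    intro l
    induction l with
    | nil => simp
    | cons c l ih =>
      intro b
      have h1 := ih (b + c)
      have h2 := size_add_le b c
      have h3 := encSize_nat c
      simp
      omega
  refine (foldl (f := fun _ b c => b + c) (b := fun _ => 0) (by fun_prop) (by fun_prop) hl
    (6 * Polynomial.X + 1) fun a b l => ?_).of_eq fun a => List.sum_eq_foldl.symm
  have h1 := key l b
  have h2 := encSize_nat b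
  rw [encSize_nat]
  simp
  omega

end PT

end MinTreeProof

namespace MinTreeProof

open Enc

/-! ## The decision procedure -/

/-- Unary numerals. -/
def Data.num : ℕ → Data
  | 0 => .nil
  | n + 1 => .node .nil (num n)

theorem Data.num_injective : Function.Injective Data.num := by
  intro m
  induction m with
  | zero => intro n h; cases n <;> simp_all [num]
  | succ m ih =>
    intro n h
    cases n with
    | zero => simp [num] at h
    | succ n => simp only [num, Data.node.injEq, true_and] at h; rw [ih h]

instance {A : Type} [Finite A] : Finite (Symbol A) := by
  let f : Symbol A → A ⊕ Bool ⊕ Fin 3 := fun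
    | .letter a => .inl a
    | .digit b => .inr (.inl b)
    | .comma => .inr (.inr 0)
    | .colon => .inr (.inr 1)
    | .bar => .inr (.inr 2)
  refine Finite.of_injective f fun x y h => ?_
  cases x <;> cases y <;> simp_all [f]

noncomputable instance {A : Type} [Finite A] : Enc (Symbol A) where
  enc s := .num (Finite.equivFin (Symbol A) s)
  enc_injective := Data.num_injective.comp
    (Fin.val_injective.comp (Finite.equivFin (Symbol A)).injective)

namespace PT

variable {E : Env} {α β γ : Type} [Enc α] [Enc β] [Enc γ]

/-- The table of values is built into the program as nested equality tests; any value serves as the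
innermost default. -/
theorem of_finite [Finite α] (f : α → β) : PT E f := by
  classical
  have := Fintype.ofFinite α
  by_cases hα : Nonempty α
  · obtain ⟨a₀⟩ := hα
    have key : ∀ l : List α, ∃ g : α → β, PT E g ∧ ∀ a ∈ l, g a = f a := by
      intro l
      induction l with
      | nil => exact ⟨fun _ => f a₀, const _, by simp⟩
      | cons b l ih =>
        obtain ⟨g, hg, h⟩ := ih
        refine ⟨fun a => _root_.cond (MinTreeProof.encEq a b) (f b) (g a), by fun_prop, ?_⟩
        intro a ha
        by_cases hab : a = b
        · subst hab; simp only [encEq_iff.2, cond_true]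
        · have : MinTreeProof.encEq a b = false := by
            rw [← Bool.not_eq_true, encEq_iff]; exact hab
          simp only [this, cond_false]
          exact h a (by simpa [hab] using ha)
    obtain ⟨g, hg, h⟩ := key Finset.univ.toList
    exact hg.of_eq fun a => h a (by simp)
  · refine ⟨.skip, 0, fun a => (hα ⟨a⟩).elim⟩

end PT

section Solve

variable {A : Type} [Finite A]

/-- The word is read from its end. The head of `acc` is the item under construction, and a separator
opens a new one. -/
noncomputable def splitStep (sep : Symbol A) (acc : List (List (Symbol A))) (s : Symbol A) :
    List (List (Symbol A)) :=
  bif encEq s sep then [] :: acc else (s :: acc.headD []) :: acc.tail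

/-- Split at a separator; a separator at the end does not give an empty item. -/
noncomputable def split (sep : Symbol A) (w : List (Symbol A)) : List (List (Symbol A)) :=
  w.reverse.foldl (splitStep sep) []

def digitValue : Symbol A → Bool
  | .digit b => b
  | _ => false

noncomputable def readNat (w : List (Symbol A)) : ℕ :=
  (w.reverse.map digitValue).foldl (fun n b => Nat.bit b n) 0

/-- The row of a vertex: its number, its label and the size of the best tree known. -/
abbrev Row (A : Type) : Type := List (Symbol A) × List (Symbol A) × ℕ

/-- The numbers of the conclusion and of the premises. -/
abbrev EdgeCode (A : Type) : Type := List (Symbol A) × List (List (Symbol A))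

/-- Items are read from the last one back: a conclusion, marked by its colon, opens a hyperedge, and
the items before it are its premises. -/
noncomputable def readEdgesStep (acc : List (EdgeCode A)) (w : List (Symbol A)) :
    List (EdgeCode A) :=
  -- The number zero is written as the empty word; the default `.bar` makes it count as a premise.
  bif encEq (w.headD .bar) .colon then (w.tail, []) :: acc
  else ((acc.headD ([], [])).1, w :: (acc.headD ([], [])).2) :: acc.tail

noncomputable def readEdges (ws : List (List (Symbol A))) : List (EdgeCode A) :=
  ws.reverse.foldl readEdgesStep []

/-- The value `n + 1` plays the role of infinity, as only sizes up to `n` matter. -/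
noncomputable def initialRow (thy : List (List (Symbol A))) (n : ℕ) (v : List (List (Symbol A))) :
    Row A :=
  (v.headD [], v.tail.headD [], bif thy.any (encEq (v.tail.headD [])) then 1 else n + 1)

noncomputable def rowCost (tbl : List (Row A)) (i : List (Symbol A)) : ℕ :=
  tbl.foldl (fun k r => bif encEq r.1 i then r.2.2 else k) 0

noncomputable def relaxRow (d : List (Symbol A)) (k : ℕ) (r : Row A) : Row A :=
  bif encEq r.1 d then (r.1, r.2.1, min r.2.2 k) else r

/-- Take an edge into account. -/
noncomputable def relaxTable (tbl : List (Row A)) (e : EdgeCode A) : List (Row A) :=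
  tbl.map (relaxRow e.1 (1 + (e.2.map (rowCost tbl)).sum))

noncomputable def relaxAll (es : List (EdgeCode A)) (tbl : List (Row A)) : List (Row A) :=
  es.foldl relaxTable tbl

/-- The initial table serves as the clock: one round for each vertex. -/
noncomputable def finalTable (tbl : List (Row A)) (es : List (EdgeCode A)) : List (Row A) :=
  tbl.foldl (fun t _ => relaxAll es t) tbl

noncomputable def accepts (goal : List (Symbol A)) (n : ℕ) (tbl : List (Row A)) : Bool :=
  tbl.any fun r => encEq r.2.1 goal && decide (r.2.2 ≤ n)

noncomputable def solveParts (thy goal n vs es : List (Symbol A)) : Bool :=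
  accepts goal (readNat n) <| finalTable
    ((split .comma vs).map fun w => initialRow (split .comma thy) (readNat n) (split .colon w))
    (readEdges (split .comma es))

/-- The decision procedure, applied to the reversed input. -/
noncomputable def solve (w : List (Symbol A)) : Bool :=
  let l := w.foldl (splitStep .bar) []
  solveParts (l.headD []) (l.tail.headD []) (l.tail.tail.headD []) (l.tail.tail.tail.headD [])
    (l.tail.tail.tail.tail.headD [])

/-! ### Polynomial running time of the decision procedure. -/

namespace PT

variable {E : Env} {α β γ : Type} [Enc α] [Enc β] [Enc γ]

theorem encSize_headD_tail (l : List β) (b : β) :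
    encSize (l.headD b) + encSize l.tail ≤ encSize l + encSize b := by
  cases l <;> simp
  omega

theorem splitFold {f : α → List (Symbol A)} (sep : Symbol A) (hf : PT E f) :
    PT E (fun a => (f a).foldl (splitStep sep) []) := by
  refine foldl_of_growth (f := fun _ => splitStep sep) (b := fun _ => []) ?_ (by fun_prop) hf
    (Polynomial.X + 10) fun a b c => ?_
  · unfold splitStep; fun_prop
  · have := encSize_headD_tail b ([] : List (Symbol A))
    unfold splitStep
    cases MinTreeProof.encEq c sep
    · simp only [cond_false, encSize_cons, encSize_nil, Polynomial.eval_add, Polynomial.eval_X,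
        Polynomial.eval_ofNat] at *
      omega
    · simp; omega

@[fun_prop]
theorem split {f : α → List (Symbol A)} (sep : Symbol A) (hf : PT E f) :
    PT E (fun a => split sep (f a)) :=
  splitFold sep (reverse hf)

@[fun_prop]
theorem readNat {f : α → List (Symbol A)} (hf : PT E f) : PT E (fun a => readNat (f a)) :=
  foldl_bit (map (f := fun _ => digitValue) ((of_finite digitValue).comp snd) (reverse hf))

@[fun_prop]
theorem readEdges {f : α → List (List (Symbol A))} (hf : PT E f) :
    PT E (fun a => readEdges (f a)) := by
  refine foldl_of_growth (f := fun _ => readEdgesStep) (b := fun _ => []) ?_ (by fun_prop)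
    (reverse hf) (Polynomial.X + 10 + (encSize (.bar : Symbol A) : Polynomial ℕ)) fun a b c => ?_
  · unfold readEdgesStep; fun_prop
  · have h1 := encSize_headD_tail b (([], []) : EdgeCode A)
    have h2 := encSize_headD_tail c (.bar : Symbol A)
    unfold readEdgesStep
    cases MinTreeProof.encEq (c.headD .bar) .colon
    · simp only [cond_false, encSize_cons, encSize_prod, encSize_nil, Polynomial.eval_add, Polynomial.eval_natCast,
        Polynomial.eval_X, Polynomial.eval_ofNat] at *
      omega
    · have : encSize c.tail ≤ encSize c := by cases c <;> simp; omega
      simp; omega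

@[fun_prop]
theorem initialRow {f : α → List (List (Symbol A))} {n : α → ℕ} {g : α → List (List (Symbol A))}
    (hf : PT E f) (hn : PT E n) (hg : PT E g) : PT E (fun a => initialRow (f a) (n a) (g a)) := by
  have : PT E (fun a => (f a).any fun x => MinTreeProof.encEq ((g a).tail.headD []) x) :=
    any (encEq (headD (const _) (tail (hg.comp fst))) snd) hf
  unfold MinTreeProof.initialRow
  fun_prop

@[fun_prop]
theorem rowCost {f : α → List (Row A)} {g : α → List (Symbol A)} (hf : PT E f) (hg : PT E g) :
    PT E (fun a => rowCost (f a) (g a)) := by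
  refine foldl_of_growth (f := fun a (k : ℕ) (r : Row A) =>
    _root_.cond (MinTreeProof.encEq r.1 (g a)) r.2.2 k) (b := fun _ => 0) (by fun_prop)
    (by fun_prop) hf Polynomial.X fun a b c => ?_
  cases MinTreeProof.encEq c.1 (g a) <;> simp
  omega

@[fun_prop]
theorem relaxTable {f : α → List (Row A)} {g : α → EdgeCode A} (hf : PT E f) (hg : PT E g) :
    PT E (fun a => relaxTable (f a) (g a)) := by
  have h1 : PT E (fun a => ((g a).2.map fun i => MinTreeProof.rowCost (f a) i).sum) :=
    sum (map (by fun_prop) (by fun_prop))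
  have h2 : PT E (fun p : α × Row A => relaxRow (g p.1).1
      (1 + ((g p.1).2.map fun i => MinTreeProof.rowCost (f p.1) i).sum) p.2) := by
    have := h1.comp (fst : PT E (Prod.fst : α × Row A → α))
    unfold relaxRow
    fun_prop
  exact map h2 hf

theorem encSize_map_le (f : β → β) (hf : ∀ b, encSize (f b) ≤ encSize b) (l : List β) :
    encSize (l.map f) ≤ encSize l := by
  induction l with
  | nil => simp
  | cons b l ih => have := hf b; simp; omega

/-- Words are kept and costs only decrease. This keeps the iterated relaxation polynomial, however
large the trees are. -/
theorem encSize_relaxAll_le (es : List (EdgeCode A)) (tbl : List (Row A)) :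
    encSize (relaxAll es tbl) ≤ encSize tbl := by
  unfold relaxAll
  induction es generalizing tbl with
  | nil => simp
  | cons e es ih =>
    refine (ih _).trans (encSize_map_le _ (fun r => ?_) _)
    unfold relaxRow
    cases MinTreeProof.encEq r.1 e.1
    · simp
    · have : ∀ k, encSize (Min.min r.2.2 k) ≤ encSize r.2.2 :=
        fun k => encSize_nat_mono (min_le_left _ _)
      simpa using this _

@[fun_prop]
theorem relaxAll {f : α → List (Row A)} {g : α → List (EdgeCode A)} (hf : PT E f) (hg : PT E g) :
    PT E (fun a => relaxAll (g a) (f a)) := by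
  refine foldl (f := fun _ => MinTreeProof.relaxTable) (by fun_prop) hf hg Polynomial.X
    fun a b l => ?_
  refine (encSize_relaxAll_le l b).trans ?_
  simp; omega

@[fun_prop]
theorem finalTable {f : α → List (Row A)} {g : α → List (EdgeCode A)} (hf : PT E f)
    (hg : PT E g) : PT E (fun a => finalTable (f a) (g a)) := by
  refine foldl (f := fun a t _ => MinTreeProof.relaxAll (g a) t) (by fun_prop) hf hf Polynomial.X
    fun a b l => ?_
  have : encSize (l.foldl (fun t _ => MinTreeProof.relaxAll (g a) t) b) ≤ encSize b := by
    induction l generalizing b with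
    | nil => simp
    | cons c l ih => exact (ih _).trans (encSize_relaxAll_le _ _)
  simp; omega

theorem solveParts {t g n v e : α → List (Symbol A)} (ht : PT E t) (hg : PT E g) (hn : PT E n)
    (hv : PT E v) (he : PT E e) : PT E (fun a => solveParts (t a) (g a) (n a) (v a) (e a)) := by
  have h1 : PT E (fun p : α × List (Symbol A) => MinTreeProof.initialRow
      (MinTreeProof.split .comma (t p.1)) (MinTreeProof.readNat (n p.1))
      (MinTreeProof.split .colon p.2)) :=
    initialRow (split _ (ht.comp fst)) (readNat (hn.comp fst)) (split _ snd)
  have h2 : PT E (fun p : α × Row A => MinTreeProof.encEq p.2.2.1 (g p.1) &&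
      decide (p.2.2.2 ≤ MinTreeProof.readNat (n p.1))) :=
    and (encEq (by fun_prop) (hg.comp fst)) (le (by fun_prop) (readNat (hn.comp fst)))
  exact any h2 (finalTable (map h1 (split _ hv)) (readEdges (split _ he)))

theorem solve : PT E (solve : List (Symbol A) → Bool) := by
  have h : PT E (fun w : List (Symbol A) => w.foldl (splitStep .bar) []) := splitFold _ id
  exact solveParts (headD (const _) h) (headD (const _) (tail h))
    (headD (const _) (tail (tail h))) (headD (const _) (tail (tail (tail h))))
    (headD (const _) (tail (tail (tail (tail h)))))

end PT

end Solve

end MinTreeProof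

namespace MinTreeProof

namespace Hypergraph

variable {S V W : Type*}

/-! ## Tree proofs and unravellings -/

section Path

variable {H : Hypergraph S V}

theorem IsPath.append {s u t : V} {p q : List (Finset V × V)} (hp : H.IsPath s p u)
    (hq : H.IsPath u q t) : H.IsPath s (p ++ q) t := by
  induction p generalizing s with
  | nil => cases hp; exact hq
  | cons e p ih => exact ⟨hp.1, hp.2.1, ih hp.2.2⟩

theorem IsPath.end_unique {s t t' : V} {p : List (Finset V × V)} (h : H.IsPath s p t)
    (h' : H.IsPath s p t') : t = t' := by
  induction p generalizing s with
  | nil => exact Eq.trans (Eq.symm h) h'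
  | cons e p ih => exact ih h.2.2 h'.2.2

theorem IsPath.singleton {e : Finset V × V} (he : e ∈ H.edges) {s : V} (hs : s ∈ e.1) :
    H.IsPath s [e] e.2 := ⟨he, hs, rfl⟩

theorem IsPath.rank_le {r : V → ℕ} (hr : ∀ e ∈ H.edges, ∀ s ∈ e.1, r e.2 < r s) {s t : V}
    {p : List (Finset V × V)} (h : H.IsPath s p t) : r t + p.length ≤ r s := by
  induction p generalizing s with
  | nil => cases h; simp
  | cons e p ih =>
    have h1 := ih h.2.2
    have h2 := hr e h.1 s h.2.1
    simp; omega

end Path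

/-- The vertex `v` is the root of an unravelled tree with `k` vertices whose leaves are labelled
with elements of `T`. -/
inductive Unravels (H : Hypergraph S V) (T : Set S) : ℕ → V → Prop
  | leaf {v : V} : v ∈ H.verts → H.label v ∈ T → Unravels H T 1 v
  | edge {e : Finset V × V} (c : V → ℕ) : e ∈ H.edges → (∀ s ∈ e.1, Unravels H T (c s) s) →
      Unravels H T (1 + ∑ s ∈ e.1, c s) e.2

variable {H : Hypergraph S V} {T : Set S}

theorem Unravels.mem_verts {k : ℕ} {v : V} (h : H.Unravels T k v) : v ∈ H.verts := by
  cases h with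
  | leaf h _ => exact h
  | edge _ he _ => exact H.conclusion_mem _ he

-- Induction on the number of vertices from which there is a path to `v`. For the premises of a
-- hyperedge with conclusion `v` these sets of vertices are disjoint, since a common vertex would
-- have two paths to the root, and they do not contain `v`, since there is no cycle. If `v` has
-- several incoming hyperedges, one of them is used and the others are ignored.
open scoped Classical in
theorem exists_unravels {P : Hypergraph S W} {h : W → V} (hP : P.IsHom H h) {t : W}
    (ht : P.IsTreeWithRoot t) (hac : P.IsAcyclic) (hleaf : ∀ v, P.IsLeaf v → P.label v ∈ T)
    {v : W} (hv : v ∈ P.verts) :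
    ∃ k ≤ (P.verts.filter fun w => ∃ p, P.IsPath w p v).card, H.Unravels T k (h v) := by
  set desc : W → Finset W := fun v => P.verts.filter fun w => ∃ p, P.IsPath w p v with hdesc
  have hself : ∀ v ∈ P.verts, v ∈ desc v := fun v hv =>
    Finset.mem_filter.2 ⟨hv, [], rfl⟩
  change ∃ k ≤ (desc v).card, _
  induction hn : (desc v).card using Nat.strong_induction_on generalizing v with
  | _ n ih =>
    by_cases hl : ∀ e ∈ P.edges, e.2 ≠ v
    · refine ⟨1, ?_, .leaf (hP.1 v hv).1 ?_⟩
      · rw [← hn]; exact Finset.card_pos.2 ⟨v, hself v hv⟩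
      · rw [(hP.1 v hv).2]; exact hleaf v ⟨hv, hl⟩
    push Not at hl
    obtain ⟨e, he, rfl⟩ := hl
    have hsub : ∀ s ∈ e.1, desc s ⊆ desc e.2 := by
      intro s hs w hw
      obtain ⟨hw, p, hp⟩ := Finset.mem_filter.1 hw
      exact Finset.mem_filter.2 ⟨hw, _, hp.append (.singleton he hs)⟩
    have hnot : ∀ s ∈ e.1, e.2 ∉ desc s := by
      intro s hs hw
      obtain ⟨hw, p, hp⟩ := Finset.mem_filter.1 hw
      have := hac _ _ (hp.append (.singleton he hs))
      simp at this
    have hdisj : ∀ s ∈ e.1, ∀ s' ∈ e.1, s ≠ s' → Disjoint (desc s) (desc s') := by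
      intro s hs s' hs' hne
      rw [Finset.disjoint_left]
      intro w hw hw'
      obtain ⟨hwv, p, hp⟩ := Finset.mem_filter.1 hw
      obtain ⟨-, p', hp'⟩ := Finset.mem_filter.1 hw'
      obtain ⟨q, hq⟩ : ∃ q, P.IsPath e.2 q t := by
        by_cases h : e.2 = t
        · exact ⟨[], h⟩
        · exact (ht.2 e.2 hv h).exists
      have h1 := (hp.append (.singleton he hs)).append hq
      have h2 := (hp'.append (.singleton he hs')).append hq
      have hwt : w ≠ t := by
        rintro rfl
        cases p with
        | nil => exact ht.1.2 e h1.1 h1.2.1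
        | cons e' p => exact ht.1.2 e' h1.1 h1.2.1
      -- Both paths from `w` to the root end with `e` followed by `q`; cancelling this leaves one
      -- list of hyperedges leading from `w` to `s` and to `s'`.
      have h3 := (ht.2 w hwv hwt).unique h1 h2
      have h4 := List.append_cancel_right (List.append_cancel_right h3)
      subst h4
      exact hne (hp.end_unique hp')
    have hcard : 1 + ∑ s ∈ e.1, (desc s).card ≤ n := by
      rw [← Finset.card_biUnion hdisj, ← hn, add_comm, ← Finset.card_insert_of_notMem (a := e.2)]
      · refine Finset.card_le_card (Finset.insert_subset (hself _ hv) ?_)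
        exact Finset.biUnion_subset.2 hsub
      · rw [Finset.mem_biUnion]
        rintro ⟨s, hs, hs'⟩
        exact hnot s hs hs'
    have hex : ∀ s ∈ e.1, ∃ k ≤ (desc s).card, H.Unravels T k (h s) := by
      intro s hs
      refine ih _ ?_ (P.premise_mem e he hs) rfl
      have := Finset.single_le_sum (f := fun s => (desc s).card) (fun _ _ => Nat.zero_le _) hs
      omega
    choose! k hk hk' using hex
    have : Nonempty W := ⟨e.2⟩
    have hpre : ∀ u ∈ e.1.image h, ∃ s ∈ e.1, h s = u := fun u hu => Finset.mem_image.1 hu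
    -- Several premises may have the same image under `h`. Keeping one of them for each image can
    -- only lower the size.
    choose! g hg hg' using hpre
    refine ⟨1 + ∑ u ∈ e.1.image h, k (g u), le_trans ?_ hcard, ?_⟩
    · refine Nat.add_le_add_left ?_ 1
      have hinj : Set.InjOn g (e.1.image h : Finset V) := fun u hu u' hu' huu => by
        rw [Finset.mem_coe] at hu hu'
        rw [← hg' u hu, ← hg' u' hu', huu]
      calc ∑ u ∈ e.1.image h, k (g u) = ∑ s ∈ (e.1.image h).image g, k s :=
            (Finset.sum_image hinj).symm
        _ ≤ ∑ s ∈ e.1, k s := Finset.sum_le_sum_of_subset (Finset.image_subset_iff.2 hg)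
        _ ≤ _ := Finset.sum_le_sum hk
    · refine Unravels.edge (e := (e.1.image h, h e.2)) (fun u => k (g u)) (hP.2 e he) fun u hu => ?_
      have := hk' _ (hg u hu)
      rwa [hg' u hu] at this

/-- A finite tree with root `t` that is mapped to `H`, in a form suitable for recursion. -/
structure IsTreeOver (P : Hypergraph S ℕ) (H : Hypergraph S V) (T : Set S) (t : ℕ) (h : ℕ → V) :
    Prop where
  root_mem : t ∈ P.verts
  root_sink : ∀ e ∈ P.edges, t ∉ e.1
  edge_unique : ∀ v ∈ P.verts, v ≠ t → ∃! e, e ∈ P.edges ∧ v ∈ e.1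
  exists_rank : ∃ r : ℕ → ℕ, ∀ e ∈ P.edges, ∀ s ∈ e.1, r e.2 < r s
  leaf_mem : ∀ v ∈ P.verts, (∃ e ∈ P.edges, e.2 = v) ∨ P.label v ∈ T
  hom : P.IsHom H h

namespace IsTreeOver

variable {P : Hypergraph S ℕ} {t : ℕ} {h : ℕ → V}

theorem isAcyclic (hP : P.IsTreeOver H T t h) : P.IsAcyclic := by
  intro v p hp
  obtain ⟨r, hr⟩ := hP.exists_rank
  have := hp.rank_le hr
  exact List.length_eq_zero_iff.1 (by omega)

theorem isSink (hP : P.IsTreeOver H T t h) : P.IsSink t := ⟨hP.root_mem, hP.root_sink⟩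

theorem eq_of_isSink (hP : P.IsTreeOver H T t h) {w : ℕ} (hw : P.IsSink w) : w = t := by
  by_contra hne
  obtain ⟨e, he, -⟩ := hP.edge_unique w hw.1 hne
  exact hw.2 e he.1 he.2

theorem path_unique (hP : P.IsTreeOver H T t h) {v : ℕ} {p q : List (Finset ℕ × ℕ)}
    (hp : P.IsPath v p t) (hq : P.IsPath v q t) : p = q := by
  induction p generalizing v q with
  | nil =>
    cases hp
    cases q with
    | nil => rfl
    | cons e q => exact (hP.root_sink e hq.1 hq.2.1).elim
  | cons e p ih =>
    cases q with
    | nil => cases hq; exact (hP.root_sink e hp.1 hp.2.1).elim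
    | cons e' q =>
      have hv : v ≠ t := by
        rintro rfl
        exact hP.root_sink e hp.1 hp.2.1
      obtain rfl := (hP.edge_unique v (P.premise_mem e hp.1 hp.2.1) hv).unique
        ⟨hp.1, hp.2.1⟩ ⟨hq.1, hq.2.1⟩
      rw [ih hp.2.2 hq.2.2]

theorem isTreeWithRoot (hP : P.IsTreeOver H T t h) : P.IsTreeWithRoot t := by
  refine ⟨hP.isSink, fun v hv hvt => ?_⟩
  obtain ⟨r, hr⟩ := hP.exists_rank
  have key : ∀ n, ∀ v ∈ P.verts, r v = n → ∃ p, P.IsPath v p t := by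
    intro n
    induction n using Nat.strong_induction_on with
    | _ n ih =>
      rintro v hv rfl
      by_cases hvt : v = t
      · exact ⟨[], hvt⟩
      obtain ⟨e, he, -⟩ := hP.edge_unique v hv hvt
      obtain ⟨p, hp⟩ := ih _ (hr e he.1 v he.2) e.2 (P.conclusion_mem e he.1) rfl
      exact ⟨e :: p, he.1, he.2, hp⟩
  obtain ⟨p, hp⟩ := key _ v hv rfl
  exact ⟨p, hp, fun q hq => hP.path_unique hq hp⟩

end IsTreeOver

/-- The code of vertex `x` of the subtree number `i` of a tree. -/
def subtreeCode (i x : ℕ) : ℕ := Nat.pair i x + 1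

theorem subtreeCode_inj {i x j y : ℕ} : subtreeCode i x = subtreeCode j y ↔ i = j ∧ x = y := by
  simp [subtreeCode, Nat.pair_eq_pair]

theorem subtreeCode_ne_zero {i x : ℕ} : subtreeCode i x ≠ 0 := by simp [subtreeCode]

/-- Definition of a function on the vertices of a tree from its values at the root and on the
subtrees. -/
def treeCases {X : Type*} (a : X) (b : ℕ → ℕ → X) : ℕ → X
  | 0 => a
  | n + 1 => b n.unpair.1 n.unpair.2

@[simp] theorem treeCases_zero {X : Type*} (a : X) (b : ℕ → ℕ → X) : treeCases a b 0 = a := rfl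

@[simp] theorem treeCases_subtreeCode {X : Type*} (a : X) (b : ℕ → ℕ → X) (i x : ℕ) :
    treeCases a b (subtreeCode i x) = b i x := by
  simp [treeCases, subtreeCode]

-- Disjoint copies of the trees for the premises are joined under the new root `0`, which no
-- `subtreeCode` takes. A vertex of `H` used by several premises is thereby copied. A vertex whose
-- label is in `T` gives a one-vertex tree, even if it is not a leaf of `H`.
open scoped Classical in
theorem Unravels.exists_tree {k : ℕ} {v : V} (hk : H.Unravels T k v) :
    ∃ (P : Hypergraph S ℕ) (t : ℕ) (h : ℕ → V), P.IsTreeOver H T t h ∧ h t = v ∧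
      P.verts.card = k := by
  induction hk with
  | @leaf v hv hl =>
    refine ⟨⟨{0}, ∅, by simp, by simp, fun _ => H.label v⟩, 0, fun _ => v,
      ⟨by simp, by simp, by simp, by simp, by simp [hl], ?_⟩, rfl, by simp⟩
    exact ⟨by simp [hv], by simp⟩
  | @edge e c he0 _ ih =>
    obtain ⟨S', v⟩ := e
    simp only at ih ⊢
    have : Inhabited (Hypergraph S ℕ) := ⟨⟨∅, ∅, by simp, by simp, fun _ => H.label v⟩⟩
    have : Nonempty V := ⟨v⟩
    choose! P t h hP ht hcard using ih
    have hrank : ∀ s ∈ S', ∃ r : ℕ → ℕ, ∀ e ∈ (P s).edges, ∀ x ∈ e.1, r e.2 < r x :=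
      fun s hs => (hP s hs).exists_rank
    choose! r hr using hrank
    -- The injection `f` numbers the subtrees by their premises, and `g` recovers the premise from
    -- the number.
    obtain ⟨f, hf⟩ := Set.countable_iff_exists_injOn.1 S'.countable_toSet
    let g : ℕ → V := Function.invFunOn f S'
    have hg : ∀ s ∈ S', g (f s) = s := fun s hs => hf.leftInvOn_invFunOn hs
    have hcode : ∀ s ∈ S', ∀ s' ∈ S', ∀ x y, subtreeCode (f s) x = subtreeCode (f s') y ↔
        s = s' ∧ x = y := by
      intro s hs s' hs' x y
      rw [subtreeCode_inj, hf.eq_iff hs hs']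
    have hinj : ∀ i, Function.Injective (subtreeCode i) := fun i x y hxy =>
      (subtreeCode_inj.1 hxy).2
    let Q : Hypergraph S ℕ :=
      { verts := insert 0 (S'.biUnion fun s => (P s).verts.image (subtreeCode (f s)))
        edges := insert (S'.image fun s => subtreeCode (f s) (t s), 0)
          (S'.biUnion fun s => (P s).edges.image fun e =>
            (e.1.image (subtreeCode (f s)), subtreeCode (f s) e.2))
        premise_mem := by
          intro e he
          rcases Finset.mem_insert.1 he with rfl | he
          · intro x hx
            obtain ⟨s, hs, rfl⟩ := Finset.mem_image.1 hx
            exact Finset.mem_insert_of_mem (Finset.mem_biUnion.2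
              ⟨s, hs, Finset.mem_image_of_mem _ (hP s hs).root_mem⟩)
          · obtain ⟨s, hs, he⟩ := Finset.mem_biUnion.1 he
            obtain ⟨e, he₁, rfl⟩ := Finset.mem_image.1 he
            intro x hx
            obtain ⟨y, hy, rfl⟩ := Finset.mem_image.1 hx
            exact Finset.mem_insert_of_mem (Finset.mem_biUnion.2
              ⟨s, hs, Finset.mem_image_of_mem _ ((P s).premise_mem e he₁ hy)⟩)
        conclusion_mem := by
          intro e he
          rcases Finset.mem_insert.1 he with rfl | he
          · simp
          · obtain ⟨s, hs, he⟩ := Finset.mem_biUnion.1 he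
            obtain ⟨e, he₁, rfl⟩ := Finset.mem_image.1 he
            exact Finset.mem_insert_of_mem (Finset.mem_biUnion.2
              ⟨s, hs, Finset.mem_image_of_mem _ ((P s).conclusion_mem e he₁)⟩)
        label := treeCases (H.label v) fun i x => (P (g i)).label x }
    have hroot : (S'.image fun s => subtreeCode (f s) (t s), 0) ∈ Q.edges :=
      Finset.mem_insert_self _ _
    have hsub : ∀ s ∈ S', ∀ e ∈ (P s).edges,
        (e.1.image (subtreeCode (f s)), subtreeCode (f s) e.2) ∈ Q.edges := fun s hs e he =>
      Finset.mem_insert_of_mem (Finset.mem_biUnion.2 ⟨s, hs, Finset.mem_image.2 ⟨e, he, rfl⟩⟩)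
    have hedges : ∀ e ∈ Q.edges, e = (S'.image fun s => subtreeCode (f s) (t s), 0) ∨
        ∃ s ∈ S', ∃ e' ∈ (P s).edges,
          e = (e'.1.image (subtreeCode (f s)), subtreeCode (f s) e'.2) := by
      intro e he
      rcases Finset.mem_insert.1 he with rfl | he
      · exact .inl rfl
      · obtain ⟨s, hs, he⟩ := Finset.mem_biUnion.1 he
        obtain ⟨e, he₁, rfl⟩ := Finset.mem_image.1 he
        exact .inr ⟨s, hs, e, he₁, rfl⟩
    have hverts : ∀ x ∈ Q.verts, x = 0 ∨ ∃ s ∈ S', ∃ y ∈ (P s).verts,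
        x = subtreeCode (f s) y := by
      intro x hx
      rcases Finset.mem_insert.1 hx with rfl | hx
      · exact .inl rfl
      · obtain ⟨s, hs, hx⟩ := Finset.mem_biUnion.1 hx
        obtain ⟨y, hy, rfl⟩ := Finset.mem_image.1 hx
        exact .inr ⟨s, hs, y, hy, rfl⟩
    refine ⟨Q, 0, treeCases v fun i x => h (g i) x, ⟨?_, ?_, ?_, ?_, ?_, ?_, ?_⟩, rfl, ?_⟩
    · exact Finset.mem_insert_self _ _
    · intro e he h0
      rcases hedges e he with rfl | ⟨s, hs, e, he, rfl⟩ <;>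
      · obtain ⟨x, -, hx⟩ := Finset.mem_image.1 h0
        exact subtreeCode_ne_zero hx
    · intro x hx hx0
      obtain rfl | ⟨s, hs, y, hy, rfl⟩ := hverts x hx
      · exact (hx0 rfl).elim
      by_cases hyt : y = t s
      · subst hyt
        refine ⟨_, ⟨hroot, Finset.mem_image.2 ⟨s, hs, rfl⟩⟩, ?_⟩
        rintro e ⟨he, hx⟩
        rcases hedges e he with rfl | ⟨s', hs', e, he₁, rfl⟩
        · rfl
        · obtain ⟨z, hz, hz'⟩ := Finset.mem_image.1 hx
          obtain ⟨rfl, rfl⟩ := (hcode _ hs' _ hs _ _).1 hz'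
          exact ((hP _ hs).root_sink e he₁ hz).elim
      · obtain ⟨e, ⟨he, hye⟩, huniq⟩ := (hP s hs).edge_unique y hy hyt
        refine ⟨_, ⟨hsub s hs e he, Finset.mem_image_of_mem _ hye⟩, ?_⟩
        rintro e' ⟨he', hx⟩
        rcases hedges e' he' with rfl | ⟨s', hs', e', he₁, rfl⟩
        · obtain ⟨z, hz, hz'⟩ := Finset.mem_image.1 hx
          obtain ⟨rfl, rfl⟩ := (hcode _ hz _ hs _ _).1 hz'
          exact (hyt rfl).elim
        · obtain ⟨z, hz, hz'⟩ := Finset.mem_image.1 hx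
          obtain ⟨rfl, rfl⟩ := (hcode _ hs' _ hs _ _).1 hz'
          rw [huniq e' ⟨he₁, hz⟩]
    · refine ⟨treeCases 0 fun i x => r (g i) x + 1, fun e he x hx => ?_⟩
      rcases hedges e he with rfl | ⟨s, hs, e, he₁, rfl⟩
      · obtain ⟨s, hs, rfl⟩ := Finset.mem_image.1 hx
        simp
      · obtain ⟨y, hy, rfl⟩ := Finset.mem_image.1 hx
        simpa [hg s hs] using hr s hs e he₁ y hy
    · intro x hx
      obtain rfl | ⟨s, hs, y, hy, rfl⟩ := hverts x hx
      · exact .inl ⟨_, hroot, rfl⟩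
      · rcases (hP s hs).leaf_mem y hy with ⟨e, he, rfl⟩ | hl
        · exact .inl ⟨_, hsub s hs e he, rfl⟩
        · right
          simpa [Q, hg s hs] using hl
    · intro x hx
      obtain rfl | ⟨s, hs, y, hy, rfl⟩ := hverts x hx
      · exact ⟨H.conclusion_mem _ he0, rfl⟩
      · simpa [Q, hg s hs] using (hP s hs).hom.1 y hy
    · intro e he
      rcases hedges e he with rfl | ⟨s, hs, e, he₁, rfl⟩
      · have : (S'.image ((treeCases v fun i x => h (g i) x) ∘ fun s => subtreeCode (f s) (t s))) =
            S' :=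
          (Finset.image_congr fun s hs => by simp [hg s hs, ht s hs]).trans Finset.image_id
        simpa only [Finset.image_image, treeCases_zero, this] using he0
      · simp only [Finset.image_image, treeCases_subtreeCode, hg s hs]
        convert (hP s hs).hom.2 e he₁ using 3
        funext x
        simp [hg s hs]
    · change (insert 0 _ : Finset ℕ).card = _
      rw [Finset.card_insert_of_notMem, Finset.card_biUnion, add_comm]
      · congr 1
        refine Finset.sum_congr rfl fun s hs => ?_
        rw [Finset.card_image_of_injective _ (hinj _), hcard s hs]
      · intro s hs s' hs' hne
        rw [Function.onFun, Finset.disjoint_left]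
        intro x hx hx'
        obtain ⟨y, -, rfl⟩ := Finset.mem_image.1 hx
        obtain ⟨z, -, hz⟩ := Finset.mem_image.1 hx'
        exact hne ((hcode _ hs' _ hs _ _).1 hz).1.symm
      · intro h0
        obtain ⟨s, -, h0⟩ := Finset.mem_biUnion.1 h0
        obtain ⟨x, -, hx⟩ := Finset.mem_image.1 h0
        exact subtreeCode_ne_zero hx

end Hypergraph

/-- From left to right, the only sink is the root, and the unravelling at its image is no larger
than the tree. From right to left, the inferences of the constructed tree are sound because the
homomorphism preserves labels and the derivation structure is sound. -/
theorem Deriver.mtp_iff {L : SententialLogic} (D : Deriver L) (T : Finset L.Sentence) (η : D.goals)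
    (n : ℕ) : D.MTP T η n ↔ ∃ v, (D.struct T η).label v = η ∧
      ∃ k ≤ n, (D.struct T η).Unravels (T : Set L.Sentence) k v := by
  classical
  constructor
  · rintro ⟨P, ⟨⟨hder, ⟨v, hv, hlab, huniq⟩, hac⟩, t, ht⟩, ⟨h, hh⟩, hcard⟩
    obtain rfl := huniq t ht.1
    obtain ⟨k, hk, hk'⟩ := Hypergraph.exists_unravels (T := (T : Set L.Sentence)) hh ht hac
      (fun v hv => by simpa using hder.1 v hv) hv.1
    refine ⟨h t, by rw [(hh.1 t hv.1).2, hlab], k, ?_, hk'⟩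
    exact hk.trans ((Finset.card_filter_le _ _).trans hcard)
  · rintro ⟨v, hv, k, hk, hun⟩
    obtain ⟨P, t, h, hP, rfl, rfl⟩ := hun.exists_tree
    refine ⟨P, ⟨⟨⟨fun w hw => ?_, fun e he => ?_⟩, ⟨t, hP.isSink, ?_, fun w => hP.eq_of_isSink⟩,
      hP.isAcyclic⟩, t, hP.isTreeWithRoot⟩, ⟨h, hP.hom⟩, hk⟩
    · rcases hP.leaf_mem w hw.1 with ⟨e, he, h⟩ | h
      · exact (hw.2 e he h).elim
      · simpa using h
    · have h1 := (D.struct_isDerivationStructure T η).2 _ (hP.hom.2 e he)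
      rw [(hP.hom.1 _ (P.conclusion_mem e he)).2] at h1
      intro M hM
      refine h1 M ?_
      rintro α ⟨v, hv, rfl⟩
      obtain ⟨w, hw, rfl⟩ := Finset.mem_image.1 hv
      refine hM _ ⟨w, hw, ?_⟩
      rw [(hP.hom.1 _ (P.premise_mem e he hw)).2]
    · rw [← (hP.hom.1 t hP.root_mem).2, hv]

end MinTreeProof

namespace MinTreeProof

open Enc

namespace Hypergraph

variable {S V : Type*}

/-! ## Iterated relaxation -/

open scoped Classical in
/-- Improve the cost of the conclusion of a hyperedge. -/
noncomputable def relax (c : V → ℕ) (e : Finset V × V) : V → ℕ := fun v =>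
  if v = e.2 then min (c v) (1 + ∑ s ∈ e.1, c s) else c v

noncomputable def relaxList (es : List (Finset V × V)) (c : V → ℕ) : V → ℕ := es.foldl relax c

theorem relax_le (c : V → ℕ) (e : Finset V × V) (v : V) : relax c e v ≤ c v := by
  unfold relax; split_ifs <;> simp

theorem relaxList_le (es : List (Finset V × V)) (c : V → ℕ) (v : V) : relaxList es c v ≤ c v := by
  unfold relaxList
  induction es generalizing c with
  | nil => simp
  | cons e es ih => exact (ih _).trans (relax_le c e v)

/-- When `e` has its turn, the costs of its premises have at most decreased, and afterwards the cost
of its conclusion cannot rise. -/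
theorem relaxList_le_of_mem {es : List (Finset V × V)} (c : V → ℕ) {e : Finset V × V}
    (he : e ∈ es) : relaxList es c e.2 ≤ 1 + ∑ s ∈ e.1, c s := by
  induction es generalizing c with
  | nil => simp at he
  | cons e' es ih =>
    rcases List.mem_cons.1 he with rfl | he
    · refine (relaxList_le es (relax c e) e.2).trans ?_
      simp [relax]
    · refine (ih (relax c e') he).trans ?_
      gcongr
      exact relax_le _ _ _

variable (H : Hypergraph S V) (T : Set S)

open scoped Classical in
noncomputable def initialCost (n : ℕ) (v : V) : ℕ := if H.label v ∈ T then 1 else n + 1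

/-- Costs up to `n` are sizes of trees, or larger. -/
def Sound (n : ℕ) (c : V → ℕ) : Prop :=
  ∀ v ∈ H.verts, c v ≤ n → ∃ k ≤ c v, H.Unravels T k v

variable {H T}

/-- If the new cost is at most `n`, so are its summands. Hence each premise has a tree within its
cost, and `e` joins these trees. -/
theorem Sound.relax {n : ℕ} {c : V → ℕ} (h : H.Sound T n c) {e : Finset V × V} (he : e ∈ H.edges) :
    H.Sound T n (relax c e) := by
  intro v hv hn
  unfold Hypergraph.relax at *
  split_ifs at hn ⊢ with hve
  · subst hve
    rcases min_choice (c e.2) (1 + ∑ s ∈ e.1, c s) with hm | hm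
    · rw [hm] at hn ⊢
      exact h _ hv hn
    · rw [hm] at hn ⊢
      have hs : ∀ s ∈ e.1, ∃ k ≤ c s, H.Unravels T k s := by
        intro s hs
        refine h s (H.premise_mem e he hs) ?_
        have := Finset.single_le_sum (f := c) (fun _ _ => Nat.zero_le _) hs
        omega
      have : Nonempty V := ⟨e.2⟩
      choose! k hk hk' using hs
      exact ⟨1 + ∑ s ∈ e.1, k s, Nat.add_le_add_left (Finset.sum_le_sum hk) 1, .edge k he hk'⟩
  · exact h v hv hn

theorem Sound.relaxList {n : ℕ} {es : List (Finset V × V)} (hes : ∀ e ∈ es, e ∈ H.edges)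
    {c : V → ℕ} (h : H.Sound T n c) : H.Sound T n (relaxList es c) := by
  unfold Hypergraph.relaxList
  induction es generalizing c with
  | nil => exact h
  | cons e es ih =>
    exact ih (fun e he => hes e (List.mem_cons_of_mem _ he)) (h.relax (hes e List.mem_cons_self))

theorem sound_initialCost (n : ℕ) : H.Sound T n (H.initialCost T n) := by
  intro v hv hn
  unfold initialCost at *
  split_ifs at hn ⊢ with h
  · exact ⟨1, le_rfl, .leaf hv h⟩
  · omega

variable (H T) in
/-- The least size of a tree with root `v`. -/
noncomputable def bestCost (v : V) : ℕ := sInf {k | H.Unravels T k v}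

variable (H T) in
open scoped Classical in
/-- The number of vertices with smaller trees. -/
noncomputable def costRank (v : V) : ℕ :=
  (H.verts.filter fun u => (∃ k, H.Unravels T k u) ∧ H.bestCost T u < H.bestCost T v).card

theorem unravels_bestCost {v : V} (h : ∃ k, H.Unravels T k v) :
    H.Unravels T (H.bestCost T v) v := Nat.sInf_mem (s := {k | H.Unravels T k v}) h

theorem bestCost_le {v : V} {k : ℕ} (h : H.Unravels T k v) : H.bestCost T v ≤ k := Nat.sInf_le h

theorem costRank_lt_of_bestCost_lt {u v : V} (hu : ∃ k, H.Unravels T k u)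
    (h : H.bestCost T u < H.bestCost T v) : H.costRank T u < H.costRank T v := by
  classical
  refine Finset.card_lt_card ((Finset.ssubset_iff_of_subset ?_).2 ⟨u, ?_, ?_⟩)
  · exact Finset.monotone_filter_right _ fun w _ hw => ⟨hw.1, hw.2.trans h⟩
  · exact Finset.mem_filter.2 ⟨hu.choose_spec.mem_verts, hu, h⟩
  · simp

theorem costRank_lt_card {v : V} (hv : v ∈ H.verts) : H.costRank T v < H.verts.card := by
  classical
  refine Finset.card_lt_card ((Finset.ssubset_iff_of_subset (Finset.filter_subset _ _)).2
    ⟨v, hv, ?_⟩)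
  simp

/-- The Bellman–Ford argument. The last hyperedge of a smallest tree has premises with strictly
smaller best costs, hence of smaller rank; their costs have come down one round earlier, and
relaxing this hyperedge brings down that of the conclusion. -/
theorem cost_le_bestCost (n : ℕ) {es : List (Finset V × V)} (hes : ∀ e ∈ H.edges, e ∈ es) (i : ℕ) :
    ∀ v, (∃ k, H.Unravels T k v) → H.costRank T v < i →
      (relaxList es)^[i] (H.initialCost T n) v ≤ H.bestCost T v := by
  have hle : ∀ i v, (relaxList es)^[i] (H.initialCost T n) v ≤ H.initialCost T n v := by
    intro i v
    induction i with
    | zero => simp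
    | succ i ih =>
      rw [Function.iterate_succ_apply']
      exact (relaxList_le _ _ _).trans ih
  induction i with
  | zero => intro v _ h; omega
  | succ i ih =>
    intro v hv hr
    have hbest := unravels_bestCost hv
    rw [Function.iterate_succ_apply']
    generalize hb : H.bestCost T v = b at *
    cases hbest with
    | leaf hv' hl =>
      refine (relaxList_le _ _ _).trans ((hle i v).trans ?_)
      simp [initialCost, hl]
    | @edge e c he hc =>
      refine (relaxList_le_of_mem _ (hes e he)).trans ?_
      gcongr with s hs
      refine (ih s ⟨_, hc s hs⟩ ?_).trans (bestCost_le (hc s hs))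
      have h1 : H.bestCost T s < H.bestCost T e.2 := by
        have h2 := bestCost_le (hc s hs)
        have h3 := Finset.single_le_sum (f := c) (fun _ _ => Nat.zero_le _) hs
        omega
      have := costRank_lt_of_bestCost_lt ⟨_, hc s hs⟩ h1
      omega

/-- Soundness gives one direction. For the other, ranks are less than the number of vertices, so
this many rounds suffice. -/
theorem cost_le_iff (n : ℕ) {es : List (Finset V × V)} (hes : ∀ e, e ∈ es ↔ e ∈ H.edges) {v : V}
    (hv : v ∈ H.verts) : (relaxList es)^[H.verts.card] (H.initialCost T n) v ≤ n ↔
      ∃ k ≤ n, H.Unravels T k v := by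
  constructor
  · intro h
    have : ∀ i, H.Sound T n ((relaxList es)^[i] (H.initialCost T n)) := by
      intro i
      induction i with
      | zero => exact sound_initialCost n
      | succ i ih =>
        rw [Function.iterate_succ_apply']
        exact ih.relaxList fun e => (hes e).1
    obtain ⟨k, hk, hk'⟩ := this _ v hv h
    exact ⟨k, hk.trans h, hk'⟩
  · rintro ⟨k, hk, hk'⟩
    exact ((cost_le_bestCost n (fun e => (hes e).2) _ v ⟨k, hk'⟩ (costRank_lt_card hv)).trans
      (bestCost_le hk')).trans hk

end Hypergraph

/-! ## Correctness of the decision procedure -/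

section Parse

variable {A : Type} [Finite A]

theorem split_eq_foldr (sep : Symbol A) (w : List (Symbol A)) :
    split sep w = w.foldr (fun s acc => splitStep sep acc s) [] := by
  rw [split, List.foldl_reverse]

theorem splitStep_sep (sep : Symbol A) (acc : List (List (Symbol A))) :
    splitStep sep acc sep = [] :: acc := by
  rw [splitStep, encEq_iff.2 rfl, cond_true]

theorem splitStep_of_ne {sep s : Symbol A} (h : s ≠ sep) (acc : List (List (Symbol A))) :
    splitStep sep acc s = (s :: acc.headD []) :: acc.tail := by
  have : encEq s sep = false := by rwa [← Bool.not_eq_true, encEq_iff]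
  rw [splitStep, this, cond_false]

/-- The assumption `h` excludes the case where no item has been opened at all, which would give `[]`
and not `[[]]`. -/
theorem foldr_splitStep {sep : Symbol A} {w : List (Symbol A)} (hw : sep ∉ w)
    {acc : List (List (Symbol A))} (h : acc ≠ [] ∨ w ≠ []) :
    w.foldr (fun s acc => splitStep sep acc s) acc = (w ++ acc.headD []) :: acc.tail := by
  induction w with
  | nil => cases acc <;> simp_all
  | cons s w ih =>
    rw [List.foldr_cons, splitStep_of_ne (fun e => hw (by simp [e]))]
    by_cases h' : acc ≠ [] ∨ w ≠ []
    · rw [ih (fun e => hw (by simp [e])) h']; simp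
    · push Not at h'
      obtain ⟨rfl, rfl⟩ := h'
      simp

theorem split_append {sep : Symbol A} {w w' : List (Symbol A)} (hw : sep ∉ w) :
    split sep (w ++ sep :: w') = w :: split sep w' := by
  rw [split_eq_foldr, List.foldr_append, List.foldr_cons, splitStep_sep,
    foldr_splitStep hw (.inl (by simp)), split_eq_foldr]
  simp

theorem split_nil (sep : Symbol A) : split sep [] = [] := rfl

theorem split_of_notMem {sep : Symbol A} {w : List (Symbol A)} (hw : sep ∉ w) (h : w ≠ []) :
    split sep w = [w] := by
  rw [split_eq_foldr, foldr_splitStep hw (.inr h)]; simp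

theorem split_flatMap {X : Type*} {sep : Symbol A} (l : List X) (f : X → List (Symbol A))
    (hf : ∀ x ∈ l, sep ∉ f x) : split sep (l.flatMap fun x => f x ++ [sep]) = l.map f := by
  induction l with
  | nil => rfl
  | cons x l ih =>
    rw [List.flatMap_cons, List.append_assoc, List.singleton_append,
      split_append (hf x (by simp)), ih fun y hy => hf y (by simp [hy]), List.map_cons]

omit [Finite A] in
theorem binary_injective : Function.Injective (binary : ℕ → List (Symbol A)) := by
  intro m n h
  have h' := (List.map_injective_iff (f := (Symbol.digit : Bool → Symbol A))).2
    (fun a b h => by simpa using h) h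
  rw [← Computability.decode_encodeNat m, h', Computability.decode_encodeNat]

omit [Finite A] in
theorem readNat_binary (n : ℕ) : readNat (binary n : List (Symbol A)) = n := by
  have : (digitValue : Symbol A → Bool) ∘ Symbol.digit = id := rfl
  rw [readNat, binary, List.map_reverse, List.map_map, this, List.map_id, List.foldl_reverse,
    encodeNat_eq_bits]
  exact foldr_bit_bits n

theorem readEdges_flatMap {X : Type*} (l : List X) (f : X → List (List (Symbol A)))
    (d : X → List (Symbol A)) (hf : ∀ x, ∀ w ∈ f x, w.headD .bar ≠ .colon) :
    readEdges (l.flatMap fun x => f x ++ [.colon :: d x]) = l.map fun x => (d x, f x) := by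
  rw [readEdges, List.foldl_reverse]
  induction l with
  | nil => rfl
  | cons x l ih =>
    rw [List.flatMap_cons, List.foldr_append, List.foldr_append, ih]
    generalize hacc : l.map (fun x => (d x, f x)) = acc
    have hstep : readEdgesStep acc (.colon :: d x) = (d x, []) :: acc := by
      rw [readEdgesStep, List.headD_cons, encEq_iff.2 rfl, cond_true]; rfl
    have key : ∀ ws : List (List (Symbol A)), (∀ w ∈ ws, w.headD .bar ≠ .colon) →
        ws.foldr (fun w acc => readEdgesStep acc w) ((d x, []) :: acc) = (d x, ws) :: acc := by
      intro ws hws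
      induction ws with
      | nil => rfl
      | cons w ws ih =>
        have : encEq (w.headD .bar) (.colon : Symbol A) = false := by
          rw [← Bool.not_eq_true, encEq_iff]; exact hws w (by simp)
        rw [List.foldr_cons, ih fun w hw => hws w (by simp [hw]), readEdgesStep, this]
        rfl
    rw [List.foldr_cons, List.foldr_nil, hstep, key _ (hf x), List.map_cons, hacc]

theorem rowCost_eq {tbl : List (Row A)} {i : List (Symbol A)} {k : ℕ}
    (h : ∀ r ∈ tbl, r.1 = i → r.2.2 = k) (h' : ∃ r ∈ tbl, r.1 = i) : rowCost tbl i = k := by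
  have key : ∀ (tbl : List (Row A)) (k₀ : ℕ), (∀ r ∈ tbl, r.1 = i → r.2.2 = k) →
      ((∃ r ∈ tbl, r.1 = i) ∨ k₀ = k) →
      tbl.foldl (fun k r => bif encEq r.1 i then r.2.2 else k) k₀ = k := by
    intro tbl
    induction tbl with
    | nil => intro k₀ _ h; simpa using h
    | cons r tbl ih =>
      intro k₀ h h'
      rw [List.foldl_cons]
      refine ih _ (fun r hr => h r (by simp [hr])) ?_
      cases hr : encEq r.1 i
      · have hne : r.1 ≠ i := fun e => by rw [encEq_iff.2 e] at hr; cases hr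
        rcases h' with ⟨r', hr', e⟩ | h'
        · rcases List.mem_cons.1 hr' with rfl | hr'
          · exact (hne e).elim
          · exact .inl ⟨r', hr', e⟩
        · exact .inr h'
      · exact .inr (h r (by simp) (encEq_iff.1 hr))
  exact key tbl 0 h (.inl h')

end Parse

instance (L : SententialLogic) : Finite L.Alphabet := L.alphabet_finite

/-! ### Simulation of relaxation on the table read from a description. -/

section Table

variable {L : SententialLogic}

theorem word_injective : Function.Injective (word L) := fun α β h =>
  L.code_injective ((List.map_injective_iff (f := (Symbol.letter : L.Alphabet → _))).2
    (fun a b h => by simpa using h) h)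

variable {V : Type*} {H : Hypergraph L.Sentence V} (l : Listing H)

/-- The table for the costs `c`. -/
noncomputable def table (c : V → ℕ) : List (Row L.Alphabet) :=
  l.vertexList.map fun v => (binary (l.number v), word L (H.label v), c v)

noncomputable def edgeCode (e : Finset V × V) : EdgeCode L.Alphabet :=
  (binary (l.number e.2), (l.premiseList e).map fun v => binary (l.number v))

variable {l}

theorem Listing.mem_vertexList {v : V} : v ∈ l.vertexList ↔ v ∈ H.verts := by
  rw [← Multiset.mem_coe, l.vertexList_eq]; rfl

theorem Listing.mem_edgeList {e : Finset V × V} : e ∈ l.edgeList ↔ e ∈ H.edges := by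
  rw [← Multiset.mem_coe, l.edgeList_eq]; rfl

theorem Listing.length_vertexList : l.vertexList.length = H.verts.card := by
  rw [← Multiset.coe_card, l.vertexList_eq]; rfl

theorem rowCost_table (c : V → ℕ) {v : V} (hv : v ∈ H.verts) :
    rowCost (table l c) (binary (l.number v)) = c v := by
  refine rowCost_eq ?_ ⟨_, List.mem_map.2 ⟨v, l.mem_vertexList.2 hv, rfl⟩, rfl⟩
  intro r hr h
  obtain ⟨u, hu, rfl⟩ := List.mem_map.1 hr
  rw [l.number_injOn (l.mem_vertexList.1 hu) hv (binary_injective h)]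

theorem sum_premiseList {e : Finset V × V} (he : e ∈ H.edges) (c : V → ℕ) :
    ((l.premiseList e).map c).sum = ∑ s ∈ e.1, c s := by
  rw [← Multiset.sum_coe, ← Multiset.map_coe, l.premiseList_eq e he]; rfl

theorem mem_premiseList {e : Finset V × V} (he : e ∈ H.edges) {v : V} :
    v ∈ l.premiseList e ↔ v ∈ e.1 := by
  rw [← Multiset.mem_coe, l.premiseList_eq e he]; rfl

/-- Rows are found by their numbers, which determine the vertices because the numbering and the
binary notation are injective. -/
theorem relaxTable_table (c : V → ℕ) {e : Finset V × V} (he : e ∈ H.edges) :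
    relaxTable (table l c) (edgeCode l e) = table l (Hypergraph.relax c e) := by
  have hsum : ((edgeCode l e).2.map (rowCost (table l c))).sum = ∑ s ∈ e.1, c s := by
    rw [← sum_premiseList (l := l) he, edgeCode, List.map_map]
    congr 1
    refine List.map_congr_left fun v hv => ?_
    exact rowCost_table c (H.premise_mem e he ((mem_premiseList he).1 hv))
  rw [relaxTable, hsum, table, table, List.map_map]
  refine List.map_congr_left fun v hv => ?_
  rw [l.mem_vertexList] at hv
  simp only [Function.comp_apply, relaxRow, Hypergraph.relax, edgeCode]
  by_cases hve : v = e.2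
  · subst hve
    rw [encEq_iff.2 rfl]
    simp
  · have : encEq (binary (l.number v)) (binary (l.number e.2) : List (Symbol L.Alphabet)) =
        false := by
      rw [← Bool.not_eq_true, encEq_iff]
      exact fun h => hve (l.number_injOn hv (H.conclusion_mem e he) (binary_injective h))
    rw [this]
    simp [hve]

theorem relaxAll_table (es : List (Finset V × V)) (hes : ∀ e ∈ es, e ∈ H.edges) (c : V → ℕ) :
    relaxAll (es.map (edgeCode l)) (table l c) = table l (Hypergraph.relaxList es c) := by
  unfold relaxAll Hypergraph.relaxList
  induction es generalizing c with
  | nil => rfl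
  | cons e es ih =>
    rw [List.map_cons, List.foldl_cons, relaxTable_table c (hes e (by simp)),
      ih (fun e he => hes e (by simp [he])), List.foldl_cons]

theorem finalTable_table (c : V → ℕ) :
    finalTable (table l c) (l.edgeList.map (edgeCode l)) =
      table l ((Hypergraph.relaxList l.edgeList)^[H.verts.card] c) := by
  have hlen : (table l c).length = H.verts.card := by simp [table, l.length_vertexList]
  rw [finalTable, PT.foldl_const_eq_iterate, hlen]
  generalize H.verts.card = k
  induction k with
  | zero => rfl
  | succ k ih =>
    rw [Function.iterate_succ_apply', ih, Function.iterate_succ_apply',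
      relaxAll_table _ fun e => l.mem_edgeList.1]

theorem accepts_table (c : V → ℕ) (η : L.Sentence) (n : ℕ) :
    accepts (word L η) n (table l c) = true ↔ ∃ v ∈ H.verts, H.label v = η ∧ c v ≤ n := by
  simp [accepts, table, l.mem_vertexList, word_injective.eq_iff]

theorem headD_binary (n : ℕ) (h : (binary n : List (Symbol L.Alphabet)).headD .bar = .colon) :
    False := by
  unfold binary at h
  cases hb : Computability.encodeNat n <;> simp [hb] at h

theorem comma_notMem_word (α : L.Sentence) : .comma ∉ word L α := by simp [word]
theorem colon_notMem_word (α : L.Sentence) : .colon ∉ word L α := by simp [word]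
theorem bar_notMem_word (α : L.Sentence) : .bar ∉ word L α := by simp [word]
theorem comma_notMem_binary {A : Type} (n : ℕ) : .comma ∉ (binary n : List (Symbol A)) := by
  simp [binary]
theorem colon_notMem_binary {A : Type} (n : ℕ) : .colon ∉ (binary n : List (Symbol A)) := by
  simp [binary]
theorem bar_notMem_binary {A : Type} (n : ℕ) : .bar ∉ (binary n : List (Symbol A)) := by
  simp [binary]

theorem word_ne_nil (α : L.Sentence) : word L α ≠ [] := by simpa [word] using L.code_ne_nil α

/-- The items that describe the hyperedge `e`. -/
def edgeItems (l : Listing H) (e : Finset V × V) : List (List (Symbol L.Alphabet)) :=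
  ((l.premiseList e).map fun v => binary (l.number v)) ++ [.colon :: binary (l.number e.2)]

theorem edgeItems_flatMap (e : Finset V × V) :
    (edgeItems l e).flatMap (fun w => w ++ [.comma]) =
      (l.premiseList e).flatMap (fun v => binary (l.number v) ++ [Symbol.comma]) ++
        [Symbol.colon] ++ binary (l.number e.2) ++ [Symbol.comma] := by
  simp [edgeItems, List.flatMap_map]

/-- Bars separate the five fields, commas the items of a field, and colons the parts of a vertex
item. No separator occurs inside what it separates, so parsing undoes writing; the rest is
relaxation of the initial costs. -/
theorem solve_string (l : Listing H) (ts : List L.Sentence) (η : L.Sentence) (n : ℕ) :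
    solve (ts.flatMap (fun α => word L α ++ [Symbol.comma]) ++ [Symbol.bar] ++ word L η ++ [Symbol.bar] ++
      binary n ++ [Symbol.bar] ++ l.string).reverse = true ↔
      ∃ v, H.label v = η ∧ ∃ k ≤ n, H.Unravels {α | α ∈ ts} k v := by
  set thy : List (Symbol L.Alphabet) :=
    ts.flatMap (fun α => word L α ++ [Symbol.comma]) with hthy
  set vs : List (Symbol L.Alphabet) := l.vertexList.flatMap
      (fun v => binary (l.number v) ++ [Symbol.colon] ++ word L (H.label v) ++ [Symbol.comma])
    with hvs
  set es : List (Symbol L.Alphabet) := l.edgeList.flatMap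
      (fun e => (l.premiseList e).flatMap (fun v => binary (l.number v) ++ [Symbol.comma]) ++
        [Symbol.colon] ++ binary (l.number e.2) ++ [Symbol.comma]) with hes
  have hstr : thy ++ [Symbol.bar] ++ word L η ++ [Symbol.bar] ++ binary n ++ [Symbol.bar] ++ l.string =
      thy ++ .bar :: (word L η ++ .bar :: (binary n ++ .bar :: (vs ++ .bar :: (es ++ .bar :: [])))) := by
    simp [Listing.string, hthy, hvs, hes]
  have hbt : .bar ∉ thy := by simp [hthy, bar_notMem_word]
  have hbv : .bar ∉ vs := by simp [hvs, bar_notMem_word, bar_notMem_binary]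
  have hbe : .bar ∉ es := by simp [hes, bar_notMem_binary]
  have hsplit : (thy ++ [Symbol.bar] ++ word L η ++ [Symbol.bar] ++ binary n ++ [Symbol.bar] ++
      l.string).reverse.foldl (splitStep .bar) [] = [thy, word L η, binary n, vs, es] := by
    rw [List.foldl_reverse, ← split_eq_foldr, hstr, split_append hbt,
      split_append (bar_notMem_word _), split_append (bar_notMem_binary _), split_append hbv,
      split_append hbe, split_nil]
  have hthy' : split .comma thy = ts.map (word L) :=
    split_flatMap _ _ fun α _ => comma_notMem_word α
  have hvs' : split .comma vs = l.vertexList.map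
      fun v => binary (l.number v) ++ .colon :: word L (H.label v) := by
    rw [← split_flatMap (sep := .comma)]
    · simp [hvs]
    · simp [comma_notMem_binary, comma_notMem_word]
  have hes' : readEdges (split .comma es) = l.edgeList.map (edgeCode l) := by
    have : es = (l.edgeList.flatMap (edgeItems l)).flatMap fun w => w ++ [.comma] := by
      rw [List.flatMap_assoc, hes]
      simp only [edgeItems_flatMap]
    rw [this, split_flatMap, List.map_id']
    · exact readEdges_flatMap l.edgeList _ _ fun e w hw h => by
        obtain ⟨v, -, rfl⟩ := List.mem_map.1 hw
        exact headD_binary _ h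
    · intro w hw
      obtain ⟨e, -, hw⟩ := List.mem_flatMap.1 hw
      rcases List.mem_append.1 hw with hw | hw
      · obtain ⟨v, -, rfl⟩ := List.mem_map.1 hw
        exact comma_notMem_binary _
      · rw [List.mem_singleton.1 hw]
        simp [comma_notMem_binary]
  have hrow : (split .comma vs).map (fun w => initialRow (split .comma thy)
      (readNat (binary n : List (Symbol L.Alphabet))) (split .colon w)) =
      table l (H.initialCost {α | α ∈ ts} n) := by
    rw [hvs', hthy', readNat_binary, List.map_map, table]
    refine List.map_congr_left fun v hv => ?_
    simp only [Function.comp_apply]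
    -- Sentences are non-empty words; nothing after the colon would leave no second item.
    rw [split_append (colon_notMem_binary _), split_of_notMem (colon_notMem_word _) (word_ne_nil _)]
    simp only [initialRow, List.headD_cons, List.tail_cons, Hypergraph.initialCost, Set.mem_ofPred_eq]
    refine Prod.ext rfl (Prod.ext rfl ?_)
    by_cases h : H.label v ∈ ts
    · rw [if_pos h, List.any_eq_true.2 ⟨_, List.mem_map_of_mem h, encEq_iff.2 rfl⟩]
      rfl
    · rw [if_neg h]
      have : ((ts.map (word L)).any (encEq (word L (H.label v)))) = false := by
        rw [← Bool.not_eq_true, List.any_eq_true]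
        rintro ⟨w, hw, hw'⟩
        obtain ⟨α, hα, rfl⟩ := List.mem_map.1 hw
        rw [encEq_iff, word_injective.eq_iff] at hw'
        exact h (hw' ▸ hα)
      rw [this]
      rfl
  rw [solve, hsplit]
  simp only [List.headD_cons, List.tail_cons]
  rw [solveParts, hrow, hes', finalTable_table, readNat_binary, accepts_table]
  constructor
  · rintro ⟨v, hv, h1, h2⟩
    exact ⟨v, h1, (Hypergraph.cost_le_iff _ (fun e => l.mem_edgeList) hv).1 h2⟩
  · rintro ⟨v, h1, k, hk, hun⟩
    exact ⟨v, hun.mem_verts, h1,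
      (Hypergraph.cost_le_iff _ (fun e => l.mem_edgeList) hun.mem_verts).2 ⟨k, hk, hun⟩⟩

theorem solve_eq {D : Deriver L} (x : Instance D)
    (l : Listing (D.struct x.query.theory x.query.goal)) :
    solve (x.string ++ l.string).reverse = true ↔ x.Holds := by
  have hT : {α | α ∈ x.query.theoryList} = (x.query.theory : Set L.Sentence) := by
    ext α
    rw [Set.mem_ofPred_eq, ← Multiset.mem_coe, x.query.theoryList_eq]; rfl
  rw [Instance.Holds, Deriver.mtp_iff, ← hT, ← solve_string l]
  simp only [Instance.string, Query.string, List.append_assoc]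

end Table

end MinTreeProof

namespace MinTreeProof

open Enc

/-! ## Input and output -/

namespace Frag

section Read

variable {E : Env} [Enc E.Input] {x : E.State} {m l r c : List Mark} {y : ∀ k, List (E.Sym k)}

/-- Add an element to the list on top of the main stack. -/
def pushInput (s : E.Input) : Frag E :=
  (pushAll (enc s).str.reverse).seq (push (.inl .main) .cons)

theorem pushInput_runs (s : E.Input) (w : List E.Input) :
    (pushInput s).Runs (encSize s + 2) x (E.combine (works ((enc w).str ++ m) l r c) y) x
      (E.combine (works ((enc (s :: w)).str ++ m) l r c) y) := by
  refine (seq_runs (pushAll_str_runs (enc s)) (workPush_main_runs .cons)).of_eq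
    (by simp [encSize]) ?_
  simp [enc, encList, Data.str]

def inputSymbol : E.Reg → Option E.Input
  | some (.inr s) => some s
  | _ => none

variable [Finite E.Input]

/-- Add all symbols on stack `k` to the list on top of the main stack. -/
def readAll (k : E.Stack) (f : E.Sym k → E.Input) : Frag E :=
  pop (.inr k) (fun s => .inr (f s)) inputSymbol true pushInput

/-- Symbols are put in front of the list, so it comes out reversed; this is why `solve` takes the
reversed input. A symbol costs a pop and at most `C + 2` steps for its code and the `cons`. -/
theorem readAll_runs {C : ℕ} (hC : ∀ s : E.Input, encSize s ≤ C) (k : E.Stack)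
    (f : E.Sym k → E.Input) (w : List E.Input) :
    (readAll k f).Runs ((C + 3) * (y k).length + 1)
      x (E.combine (works ((enc w).str ++ m) l r c) y)
      x (E.combine (works ((enc (((y k).map f).reverse ++ w)).str ++ m) l r c)
        (Function.update y k [])) := by
  generalize h : y k = u
  induction u generalizing y w with
  | nil =>
    refine (pop_runs_none (by simp [h, inputSymbol])).of_eq (by simp) ?_
    simp [h]
  | cons a u ih =>
    have h1 := ih (y := Function.update y k u) (f a :: w) (by simp)
    have h2 : (pushInput (f a)).Runs (C + 2) x
        (Function.update (E.combine (works ((enc w).str ++ m) l r c) y) (.inr k) u) x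
        (E.combine (works ((enc (f a :: w)).str ++ m) l r c) (Function.update y k u)) := by
      rw [Env.update_combine_inr]
      exact (pushInput_runs (f a) w).mono (by have := hC (f a); omega)
    refine (pop_runs_again (i := f a) (by simp [h, inputSymbol]) (by simpa [h] using h2) h1).of_eq
      ?_ ?_
    · rw [List.length_cons, Nat.mul_succ]; omega
    · simp

end Read

end Frag

/-- The stacks for input, output and a copy of a part of the input. -/
inductive Port where
  | input
  | output
  | copy
  deriving DecidableEq

instance : Fintype Port := ⟨{.input, .output, .copy}, fun a => by cases a <;> simp⟩

/-- The symbols on the ports and on further stacks. -/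
abbrev portSym (A : Type) {K : Type} (Γ : K → Type) : Port ⊕ K → Type
  | .inl .input => Symbol A
  | .inl .output => Bool
  | .inl .copy => Symbol A
  | .inr k => Γ k

/-- The environment for machines that read words over `Symbol A` and output truth values, with
further stacks and a further state. -/
abbrev portEnv (A K : Type) [DecidableEq K] (Γ : K → Type) (σ : Type) : Env where
  Input := Symbol A
  Stack := Port ⊕ K
  Sym := portSym A Γ
  State := σ

/-- Contents of the stacks in `portEnv`. -/
def ports {A K : Type} {Γ : K → Type} (i : List (Symbol A)) (o : List Bool) (c : List (Symbol A))
    (S : ∀ k, List (Γ k)) : ∀ k : Port ⊕ K, List (portSym A Γ k)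
  | .inl .input => i
  | .inl .output => o
  | .inl .copy => c
  | .inr k => S k

section ports

variable {A K : Type} {Γ : K → Type} {i : List (Symbol A)} {o : List Bool}
  {c : List (Symbol A)} {S : ∀ k, List (Γ k)}

@[simp] theorem ports_input : ports i o c S (.inl .input) = i := rfl
@[simp] theorem ports_output : ports i o c S (.inl .output) = o := rfl
@[simp] theorem ports_copy : ports i o c S (.inl .copy) = c := rfl
@[simp] theorem ports_inr (k : K) : ports i o c S (.inr k) = S k := rfl

variable [DecidableEq K]

@[simp] theorem update_ports_input (i' : List (Symbol A)) :
    Function.update (ports i o c S) (.inl .input) i' = ports i' o c S := by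
  funext k
  rcases k with (_ | _ | _) | k
  · exact Function.update_self _ _ _
  · exact Function.update_of_ne (by simp) _ _
  · exact Function.update_of_ne (by simp) _ _
  · exact Function.update_of_ne (by simp) _ _

@[simp] theorem update_ports_output (o' : List Bool) :
    Function.update (ports i o c S) (.inl .output) o' = ports i o' c S := by
  funext k
  rcases k with (_ | _ | _) | k
  · exact Function.update_of_ne (by simp) _ _
  · exact Function.update_self _ _ _
  · exact Function.update_of_ne (by simp) _ _
  · exact Function.update_of_ne (by simp) _ _

@[simp] theorem update_ports_copy (c' : List (Symbol A)) :
    Function.update (ports i o c S) (.inl .copy) c' = ports i o c' S := by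
  funext k
  rcases k with (_ | _ | _) | k
  · exact Function.update_of_ne (by simp) _ _
  · exact Function.update_of_ne (by simp) _ _
  · exact Function.update_self _ _ _
  · exact Function.update_of_ne (by simp) _ _

@[simp] theorem update_ports_inr (k : K) (l : List (Γ k)) :
    Function.update (ports i o c S) (.inr k) l = ports i o c (Function.update S k l) := by
  funext j
  rcases j with (_ | _ | _) | j
  · exact Function.update_of_ne (by simp) _ _
  · exact Function.update_of_ne (by simp) _ _
  · exact Function.update_of_ne (by simp) _ _
  · by_cases h : j = k
    · subst h
      exact (Function.update_self _ _ _).trans (Function.update_self j l S).symm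
    · exact (Function.update_of_ne (by simpa using h) _ _).trans
        (Function.update_of_ne h _ _).symm

end ports

namespace Frag

section Solve

variable {A K : Type} [DecidableEq K] {Γ : K → Type} {σ : Type} {x : σ} {i : List (Symbol A)}
  {o : List Bool} {c : List (Symbol A)} {S : ∀ k, List (Γ k)}

/-- Remove a truth value with a given first component from the main stack and push it on the
output stack. -/
def emitBody (b : Bool) : Frag (portEnv A K Γ σ) :=
  popMain.seq <| popMain.seq <| popMain.seq <| push (.inr (.inl .output)) b

theorem portPush_output_runs (b : Bool) (w : Work → List Mark) :
    (push (.inr (.inl .output)) b : Frag (portEnv A K Γ σ)).Runs 1 x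
      ((portEnv A K Γ σ).combine w (ports i o c S)) x
      ((portEnv A K Γ σ).combine w (ports i (b :: o) c S)) := by
  refine (push_runs _ _ _ _).of_eq le_rfl ?_
  rw [Env.update_combine_inr, update_ports_output]; rfl

theorem emitBody_runs (b : Bool) (a₁ a₂ a₃ : Mark) (m l r d : List Mark) :
    (emitBody b : Frag (portEnv A K Γ σ)).Runs 7 x
      ((portEnv A K Γ σ).combine (works (a₁ :: a₂ :: a₃ :: m) l r d) (ports i o c S)) x
      ((portEnv A K Γ σ).combine (works m l r d) (ports i (b :: o) c S)) :=
  (seq_runs (popMain_runs _ _) <| seq_runs (popMain_runs _ _) <| seq_runs (popMain_runs _ _) <|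
    portPush_output_runs _ _).mono (by omega)

/-- Move the truth value on top of the main stack to the output stack. -/
def emit : Frag (portEnv A K Γ σ) := popMain.seq <| test (emitBody true) (emitBody false)

theorem emit_runs (b : Bool) (m l r d : List Mark) :
    (emit : Frag (portEnv A K Γ σ)).Runs 10 x
      ((portEnv A K Γ σ).combine (works ((enc b).str ++ m) l r d) (ports i o c S)) x
      ((portEnv A K Γ σ).combine (works m l r d) (ports i (b :: o) c S)) := by
  cases b
  · exact seq_runs (popMain_runs .cons _) <| test_runs_nil (emitBody_runs _ .cons .nil .nil _ _ _ _)
  · exact seq_runs (popMain_runs .cons _) <| test_runs_cons (emitBody_runs _ .nil .nil .nil _ _ _ _)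

end Solve

end Frag

theorem exists_encSize_le (α : Type) [Enc α] [Finite α] : ∃ C, ∀ a : α, encSize a ≤ C := by
  obtain ⟨C, hC⟩ := (Set.finite_range (encSize : α → ℕ)).bddAbove
  exact ⟨C, fun a => hC ⟨a, rfl⟩⟩

theorem encSize_list_le {α : Type} [Enc α] {C : ℕ} (hC : ∀ a : α, encSize a ≤ C) (l : List α) :
    encSize l ≤ (C + 1) * l.length + 1 := by
  induction l with
  | nil => simp
  | cons a l ih =>
    have := hC a
    rw [encSize_cons, List.length_cons, Nat.mul_succ]
    omega

/-- A fragment that replaces the word on the main stack by the answer on the output stack. -/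
theorem exists_solve_runs (A K : Type) [Finite A] [DecidableEq K] (Γ : K → Type) (σ : Type) :
    ∃ (F : Frag (portEnv A K Γ σ)) (p : Polynomial ℕ), ∀ (w : List (Symbol A)) x S,
      F.Runs (p.eval w.length) x
        ((portEnv A K Γ σ).combine (works (enc w).str [] [] []) (ports [] [] [] S)) x
        ((portEnv A K Γ σ).combine (works [] [] [] []) (ports [] [solve w] [] S)) := by
  obtain ⟨F, p, hF⟩ := PT.solve (E := portEnv A K Γ σ) (A := A)
  obtain ⟨C, hC⟩ := exists_encSize_le (Symbol A)
  refine ⟨F.seq Frag.emit, p.comp (((C + 1 : ℕ) : Polynomial ℕ) * Polynomial.X + 1) + 10, fun w x S => ?_⟩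
  have h1 := (hF w).2 [] [] [] [] x (ports [] [] [] S)
  rw [List.append_nil] at h1
  refine (Frag.seq_runs h1 (Frag.emit_runs _ _ _ _ _)).mono ?_
  have := polynomial_eval_mono p (encSize_list_le hC w)
  simpa using this

end MinTreeProof

namespace MinTreeProof

/-! ## Machines made of fragments -/

/-- The stacks that are empty except for stack `k`. -/
def single {K : Type} [DecidableEq K] {Γ : K → Type} (k : K) (l : List (Γ k)) :
    ∀ k, List (Γ k) :=
  Function.update (fun _ => []) k l

theorem initList_stk (N : FinTM2) (s : List (N.Γ N.k₀)) : (initList N s).stk = single N.k₀ s := by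
  funext k
  by_cases h : k = N.k₀
  · subst h; simp [initList, single]
  · simp [initList, single, h]

theorem haltList_stk (N : FinTM2) (s : List (N.Γ N.k₁)) : (haltList N s).stk = single N.k₁ s := by
  funext k
  by_cases h : k = N.k₁
  · subst h; simp [haltList, single]
  · simp [haltList, single, h]

theorem initList_eq (N : FinTM2) (s : List (N.Γ N.k₀)) :
    initList N s = ⟨some N.main, N.initialState, single N.k₀ s⟩ :=
  congrArg (TM2.Cfg.mk _ _) (initList_stk N s)

theorem haltList_eq (N : FinTM2) (s : List (N.Γ N.k₁)) :
    haltList N s = ⟨none, N.initialState, single N.k₁ s⟩ :=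
  congrArg (TM2.Cfg.mk _ _) (haltList_stk N s)

/-- The machine that executes a fragment and restores its initial state. -/
noncomputable def Frag.machine {E : Env} [Finite E.Input] [Finite E.Stack] [Finite E.State]
    (F : Frag E) (k₀ k₁ : E.Stack) (x₀ : E.State) [Finite (E.Sym k₀)] : FinTM2 :=
  have := F.fin
  { K := E.K
    kFin := Fintype.ofFinite _
    k₀ := .inr k₀
    k₁ := .inr k₁
    Γ := E.Γ
    Λ := Option F.Lab
    main := some F.entry
    ΛFin := Fintype.ofFinite _
    σ := E.σ
    initialState := (none, x₀)
    σFin := Fintype.ofFinite _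
    Γk₀Fin := Fintype.ofFinite (E.Sym k₀)
    m := fun
      | none => .load (fun _ => (none, x₀)) .halt
      | some l => F.code some none l }

theorem combine_single {E : Env} (k : E.Stack) (l : List (E.Sym k)) :
    E.combine (works [] [] [] []) (single k l) = single (Γ := E.Γ) (.inr k) l := by
  rw [single, ← Env.update_combine_inr, single]
  congr 1
  funext j
  rcases j with (_ | _ | _ | _) | _ <;> rfl

/-- The configuration `haltList` has the initial state and nothing on the stacks except the output.
So the fragment has to clear all other stacks, and the one additional step resets the register. -/
theorem Frag.computableWithin {E : Env} [Finite E.Input] [Finite E.Stack] [Finite E.State]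
    (F : Frag E) (k₀ k₁ : E.Stack) (x₀ : E.State) {α : Type*} {A B : Type} [Finite A]
    (e₀ : E.Sym k₀ ≃ A) (e₁ : E.Sym k₁ ≃ B) {input : α → List A} {output : α → List B}
    {time : α → ℕ} (h : ∀ a, F.Runs (time a)
      x₀ (E.combine (works [] [] [] []) (single k₀ ((input a).map e₀.symm)))
      x₀ (E.combine (works [] [] [] []) (single k₁ ((output a).map e₁.symm)))) :
    ComputableWithin input output (fun a => time a + 1) := by
  have : Finite (E.Sym k₀) := Finite.of_equiv _ e₀.symm
  let N : FinTM2 := F.machine k₀ k₁ x₀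
  refine ⟨⟨N, e₀, e₁⟩, fun a => ?_⟩
  obtain ⟨r, hr⟩ := h a _ N.m some none (fun _ => rfl) none
  rw [combine_single, combine_single] at hr
  have h1 : Reach N.m 1 ⟨some none, (r, x₀), single (Γ := E.Γ) (.inr k₁) ((output a).map e₁.symm)⟩
      ⟨none, (none, x₀), single (Γ := E.Γ) (.inr k₁) ((output a).map e₁.symm)⟩ := ⟨1, le_rfl, rfl⟩
  obtain ⟨n, hn, e⟩ := hr.trans h1
  have hi : initList N ((input a).map e₀.symm) =
      ⟨some (some F.entry), (none, x₀), single (Γ := E.Γ) (.inr k₀) ((input a).map e₀.symm)⟩ :=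
    initList_eq N _
  have ho : haltList N ((output a).map e₁.symm) =
      ⟨none, (none, x₀), single (Γ := E.Γ) (.inr k₁) ((output a).map e₁.symm)⟩ :=
    haltList_eq N _
  refine ⟨⟨⟨n, ?_⟩, hn⟩⟩
  change (flip bind (TM2.step N.m))^[n] (some (initList N ((input a).map e₀.symm))) =
    some (haltList N ((output a).map e₁.symm))
  rw [hi, ho]
  exact e

theorem DecidableWithin.mono {α : Type*} {A : Type} {input : α → List A} {P : α → Prop}
    {t t' : α → ℕ} (h : DecidableWithin input P t) (ht : ∀ a, t a ≤ t' a) :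
    DecidableWithin input P t' := by
  obtain ⟨M, hM⟩ := h
  exact ⟨M, fun a => ⟨⟨(hM a).some.toEvalsTo, (hM a).some.steps_le_m.trans (ht a)⟩⟩⟩

theorem DecidableWithin.comp {α β : Type*} {A : Type} {input : α → List A} {P : α → Prop}
    {t : α → ℕ} (h : DecidableWithin input P t) (f : β → α) :
    DecidableWithin (fun b => input (f b)) (fun b => P (f b)) (fun b => t (f b)) := by
  obtain ⟨M, hM⟩ := h
  exact ⟨M, fun b => hM (f b)⟩

theorem DecidableWithin.congr {α : Type*} {A : Type} {input : α → List A} {P Q : α → Prop}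
    {t : α → ℕ} (h : DecidableWithin input P t) (hPQ : ∀ a, P a ↔ Q a) :
    DecidableWithin input Q t := by
  obtain rfl : P = Q := funext fun a => propext (hPQ a)
  exact h

section Access

variable {A K : Type} [DecidableEq K] {Γ : K → Type}

theorem ports_eq_single_input (i : List (Symbol A)) :
    ports i [] [] (fun _ => []) = single (Γ := portSym A Γ) (.inl .input) i := by
  rw [single, ← update_ports_input (i := []) i]
  congr 1
  funext k; rcases k with (_ | _ | _) | _ <;> rfl

theorem ports_eq_single_output (o : List Bool) :
    ports [] o [] (fun _ => []) = single (Γ := portSym A Γ) (.inl .output) o := by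
  rw [single, ← update_ports_output (o := []) o]
  congr 1
  funext k; rcases k with (_ | _ | _) | _ <;> rfl

end Access

/-- The procedure `solve` can be executed on the input. -/
theorem exists_decidableWithin_solve (A : Type) [Finite A] : ∃ p : Polynomial ℕ,
    DecidableWithin (fun w : List (Symbol A) => w) (fun w => solve w.reverse = true)
      (fun w => p.eval w.length) := by
  obtain ⟨F, p, hF⟩ := exists_solve_runs A Empty (fun _ => Empty) Unit
  obtain ⟨C, hC⟩ := exists_encSize_le (Symbol A)
  let E := portEnv A Empty (fun _ => Empty) Unit
  have hfin : Finite E.Input := inferInstanceAs (Finite (Symbol A))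
  let _ : Enc E.Input := inferInstanceAs (Enc (Symbol A))
  let R : Frag E := (Frag.push (.inl .main) .nil).seq <|
    (Frag.readAll (E := E) (Sum.inl Port.input) (fun s => s)).seq F
  refine ⟨((C + 3 : ℕ) : Polynomial ℕ) * Polynomial.X + p + 3, ?_⟩
  have := R.computableWithin (Sum.inl Port.input) (Sum.inl Port.output) () (Equiv.refl (Symbol A))
    (Equiv.refl Bool) (input := fun w => w) (output := fun w => [solve w.reverse])
    (time := fun w => 1 + ((C + 3) * w.length + 1 + p.eval w.length)) fun w => by
      have h1 := Frag.readAll_runs (E := E) (x := ()) (m := []) (l := []) (r := []) (c := [])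
        (y := ports w [] [] fun _ => []) hC (Sum.inl Port.input) (fun s => s) []
      have h2 := hF w.reverse () fun _ => []
      rw [update_ports_input, ports_input, List.map_id'] at h1
      simp only [List.append_nil] at h1
      simp only [List.length_reverse] at h2
      rw [Equiv.refl_symm, Equiv.refl_symm, Equiv.coe_refl, Equiv.coe_refl, List.map_id,
        List.map_id, ← ports_eq_single_input, ← ports_eq_single_output]
      exact Frag.seq_runs (Frag.workPush_main_runs _) (Frag.seq_runs h1 h2)
  refine DecidableWithin.mono (t := fun w => 1 + ((C + 3) * w.length + 1 + p.eval w.length) + 1)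
    ?_ fun w => ?_
  · unfold DecidableWithin
    convert this using 3 with w
    simp
  · simp; omega

end MinTreeProof

namespace MinTreeProof

open Enc

/-! ## Machines as fragments -/

section Embed

variable {A K : Type} [DecidableEq K] {Γ : K → Type} {Λ Λ' σ : Type}

/-- A statement of a machine in the environment with ports. -/
def liftStmt (ι : Λ → Λ') (exit : Λ') :
    TM2.Stmt Γ Λ σ → TM2.Stmt (portEnv A K Γ σ).Γ Λ' (portEnv A K Γ σ).σ
  | .push k f q => .push (.inr (.inr k)) (fun v => f v.2) (liftStmt ι exit q)
  | .peek k f q => .peek (.inr (.inr k)) (fun v o => (v.1, f v.2 o)) (liftStmt ι exit q)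
  | .pop k f q => .pop (.inr (.inr k)) (fun v o => (v.1, f v.2 o)) (liftStmt ι exit q)
  | .load f q => .load (fun v => (v.1, f v.2)) (liftStmt ι exit q)
  | .branch f q q' => .branch (fun v => f v.2) (liftStmt ι exit q) (liftStmt ι exit q')
  | .goto f => .goto fun v => ι (f v.2)
  | .halt => .goto fun _ => exit

variable {w : Work → List Mark} {i : List (Symbol A)} {o : List Bool} {c : List (Symbol A)}
  {r : (portEnv A K Γ σ).Reg}

/-- A configuration of a machine in the environment with ports. -/
def liftCfg (ι : Λ → Λ') (exit : Λ') (r : (portEnv A K Γ σ).Reg) (w : Work → List Mark)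
    (i : List (Symbol A)) (o : List Bool) (c : List (Symbol A)) (C : TM2.Cfg Γ Λ σ) :
    TM2.Cfg (portEnv A K Γ σ).Γ Λ' (portEnv A K Γ σ).σ :=
  ⟨some (C.l.elim exit ι), (r, C.var), (portEnv A K Γ σ).combine w (ports i o c C.stk)⟩

theorem update_combine_ports {S : ∀ k, List (Γ k)} (k : K) (l : List (Γ k)) :
    Function.update ((portEnv A K Γ σ).combine w (ports i o c S)) (.inr (.inr k)) l =
      (portEnv A K Γ σ).combine w (ports i o c (Function.update S k l)) :=
  (Env.update_combine_inr w _ _ _).trans (congrArg _ (update_ports_inr k l))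

theorem iterate_step_none (N : Λ → TM2.Stmt Γ Λ σ) (n : ℕ) :
    (flip bind (TM2.step N))^[n] (none : Option (TM2.Cfg Γ Λ σ)) = none := by
  induction n with
  | zero => rfl
  | succ n ih => rw [Function.iterate_succ_apply]; exact ih

/-- The lifted statement touches neither the register nor the work stacks and ports, which therefore
pass through unchanged; halting becomes a jump to `exit`. -/
theorem stepAux_liftStmt (ι : Λ → Λ') (exit : Λ') (q : TM2.Stmt Γ Λ σ) (v : σ)
    (S : ∀ k, List (Γ k)) :
    TM2.stepAux (liftStmt ι exit q) (r, v) ((portEnv A K Γ σ).combine w (ports i o c S)) =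
      liftCfg ι exit r w i o c (TM2.stepAux q v S) := by
  induction q generalizing v S with
  | push k f q ih =>
    refine Eq.trans ?_ (ih v (Function.update S k (f v :: S k)))
    exact congrArg (TM2.stepAux _ _) (update_combine_ports k _)
  | peek k f q ih => exact ih _ S
  | pop k f q ih =>
    refine Eq.trans ?_ (ih (f v (S k).head?) (Function.update S k (S k).tail))
    exact congrArg (TM2.stepAux _ _) (update_combine_ports k _)
  | load f q ih => exact ih _ S
  | branch f q q' ih ih' =>
    simp only [liftStmt, TM2.stepAux]
    cases f v
    · exact ih' v S
    · exact ih v S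
  | goto f => rfl
  | halt => rfl

theorem reach_liftCfg {N : Λ → TM2.Stmt Γ Λ σ}
    {M : Λ' → TM2.Stmt (portEnv A K Γ σ).Γ Λ' (portEnv A K Γ σ).σ} {ι : Λ → Λ'} {exit : Λ'}
    (hM : ∀ l, M (ι l) = liftStmt ι exit (N l)) {n : ℕ} {C C' : TM2.Cfg Γ Λ σ}
    (h : (flip bind (TM2.step N))^[n] (some C) = some C') :
    Reach M n (liftCfg ι exit r w i o c C) (liftCfg ι exit r w i o c C') := by
  induction n generalizing C with
  | zero =>
    obtain rfl : C = C' := by simpa using h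
    exact Reach.refl _
  | succ n ih =>
    rw [Function.iterate_succ_apply] at h
    obtain ⟨_ | l, v, S⟩ := C
    -- A halted machine has no next configuration, so it cannot have further steps to make.
    · exact absurd ((iterate_step_none N n).symm.trans h) (by simp)
    · rw [add_comm]
      exact Reach.trans (Reach.step ((congrArg (fun q => TM2.stepAux q (r, v) _) (hM l)).trans
        (stepAux_liftStmt ι exit (N l) v S))) (ih h)

/-- A machine as a fragment. -/
def Frag.ofTM (A : Type) (N : FinTM2) : Frag (portEnv A N.K N.Γ N.σ) where
  Lab := N.Λ
  fin := have := N.ΛFin; inferInstance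
  entry := N.main
  code ι exit l := liftStmt ι exit (N.m l)

theorem Frag.ofTM_runs {N : FinTM2} {s : List (N.Γ N.k₀)} {s' : List (N.Γ N.k₁)} {t : ℕ}
    (h : TM2OutputsInTime N s (some s') t) :
    (Frag.ofTM A N).Runs t
      N.initialState ((portEnv A N.K N.Γ N.σ).combine w (ports i o c (single N.k₀ s)))
      N.initialState ((portEnv A N.K N.Γ N.σ).combine w (ports i o c (single N.k₁ s'))) := by
  intro Λ M ι exit hM r
  refine ⟨r, ?_⟩
  refine (reach_liftCfg hM (C := ⟨some N.main, N.initialState, single N.k₀ s⟩)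
    (C' := ⟨none, N.initialState, single N.k₁ s'⟩) ?_).mono h.steps_le_m
  refine Eq.trans ?_ (h.evals_in_steps.trans (congrArg some (haltList_eq N s')))
  exact congrArg (fun C => (flip bind N.step)^[h.steps] (some C)) (initList_eq N s).symm

/-- A bound on the number of pushes in a statement. -/
def pushCount : TM2.Stmt Γ Λ σ → ℕ
  | .push _ _ q => pushCount q + 1
  | .peek _ _ q => pushCount q
  | .pop _ _ q => pushCount q
  | .load _ q => pushCount q
  | .branch _ q q' => pushCount q + pushCount q'
  | .goto _ => 0
  | .halt => 0

theorem length_stepAux_le (q : TM2.Stmt Γ Λ σ) (v : σ) (S : ∀ k, List (Γ k)) {b : ℕ}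
    (h : ∀ k, (S k).length ≤ b) (k : K) :
    ((TM2.stepAux q v S).stk k).length ≤ b + pushCount q := by
  induction q generalizing v S b with
  | push j f q ih =>
    refine (ih v _ (b := b + 1) fun k => ?_).trans (by simp [pushCount]; omega)
    by_cases hk : k = j
    · subst hk; simpa using h k
    · simpa [hk] using (h k).trans (Nat.le_succ b)
  | peek j f q ih => exact ih _ _ h
  | pop j f q ih =>
    refine ih _ _ fun k => ?_
    by_cases hk : k = j
    · subst hk; simpa using (Nat.sub_le _ _).trans (h k)
    · simpa [hk] using h k
  | load f q ih => exact ih _ _ h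
  | branch f q q' ih ih' =>
    simp only [TM2.stepAux, pushCount]
    cases f v
    · exact (ih' v S h).trans (by omega)
    · exact (ih v S h).trans (by omega)
  | goto f => exact h k
  | halt => exact h k

theorem length_iterate_le {N : Λ → TM2.Stmt Γ Λ σ} {B : ℕ} (hB : ∀ l, pushCount (N l) ≤ B)
    {n : ℕ} {C C' : TM2.Cfg Γ Λ σ} {b : ℕ} (hb : ∀ k, (C.stk k).length ≤ b)
    (h : (flip bind (TM2.step N))^[n] (some C) = some C') (k : K) :
    (C'.stk k).length ≤ b + B * n := by
  induction n generalizing C b with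
  | zero =>
    obtain rfl : C = C' := by simpa using h
    exact hb k
  | succ n ih =>
    rw [Function.iterate_succ_apply] at h
    obtain ⟨_ | l, v, S⟩ := C
    · exact absurd ((iterate_step_none N n).symm.trans h) (by simp)
    · refine (ih (b := b + B) (fun k => ?_) h).trans (by rw [Nat.mul_succ]; omega)
      exact (length_stepAux_le (N l) v S hb k).trans (Nat.add_le_add_left (hB l) b)

/-- With finitely many labels, the number of pushes in one step is bounded. This replaces a bound on
the size of the derivation structure when only the time for computing a description is known. -/
theorem exists_output_length_le (N : FinTM2) : ∃ B : ℕ, ∀ (s : List (N.Γ N.k₀))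
    (s' : List (N.Γ N.k₁)) (t : ℕ), TM2OutputsInTime N s (some s') t →
      s'.length ≤ s.length + B * t := by
  have := N.ΛFin
  obtain ⟨B, hB⟩ := (Set.finite_range fun l => pushCount (N.m l)).bddAbove
  refine ⟨B, fun s s' t h => ?_⟩
  have h1 := length_iterate_le (N := N.m) (B := B) (fun l => hB ⟨l, rfl⟩) (b := s.length)
    (C := initList N s) (C' := haltList N s') (fun k => ?_) h.evals_in_steps N.k₁
  · rw [haltList_stk, single, Function.update_self] at h1
    exact h1.trans (Nat.add_le_add_left (Nat.mul_le_mul_left _ h.steps_le_m) _)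
  · rw [initList_stk, single]
    by_cases hk : k = N.k₀
    · subst hk; simp
    · simp [hk]

end Embed

end MinTreeProof

namespace MinTreeProof

open Enc

/-! ## Machines that compute the derivation structure themselves -/

namespace Frag

section Copy

variable {A K : Type} [DecidableEq K] {Γ : K → Type} {σ : Type} {x : σ} {m l r d : List Mark}
  {i : List (Symbol A)} {o : List Bool} {c : List (Symbol A)} {S : ∀ k, List (Γ k)}

theorem portPush_copy_runs (s : Symbol A) (w : Work → List Mark) :
    (push (.inr (.inl .copy)) s : Frag (portEnv A K Γ σ)).Runs 1 x
      ((portEnv A K Γ σ).combine w (ports i o c S)) x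
      ((portEnv A K Γ σ).combine w (ports i o (s :: c) S)) := by
  refine (push_runs _ _ _ _).of_eq le_rfl ?_
  rw [Env.update_combine_inr, update_ports_copy]; rfl

/-- The symbol in the register, if it is not a bar. -/
def nonBar : (portEnv A K Γ σ).Reg → Option (Symbol A)
  | some (.inr .bar) => none
  | some (.inr s) => some s
  | _ => none

/-- Move the symbols on stack `copy` to stack `k`. -/
def pourCopy [Finite A] (k : K) (f : Symbol A → Γ k) : Frag (portEnv A K Γ σ) :=
  pop (I := Symbol A) (.inr (.inl .copy)) .inr inputSymbol true fun s => push (.inr (.inr k)) (f s)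

theorem pourCopy_runs [Finite A] (k : K) (f : Symbol A → Γ k) (w : Work → List Mark) :
    (pourCopy k f : Frag (portEnv A K Γ σ)).Runs (2 * c.length + 1) x
      ((portEnv A K Γ σ).combine w (ports i o c S)) x
      ((portEnv A K Γ σ).combine w
        (ports i o [] (Function.update S k ((c.map f).reverse ++ S k)))) := by
  have hu : ∀ c c' (S : ∀ k, List (Γ k)),
      Function.update ((portEnv A K Γ σ).combine w (ports i o c S)) (.inr (.inl .copy)) c' =
        (portEnv A K Γ σ).combine w (ports i o c' S) := fun c c' S =>
    (Env.update_combine_inr w _ _ _).trans (congrArg _ (update_ports_copy c'))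
  induction c generalizing S with
  | nil =>
    refine (pop_runs_none rfl).of_eq (by simp) ((hu _ _ _).trans ?_)
    rw [List.map_nil, List.reverse_nil, List.nil_append, Function.update_eq_self]
    rfl
  | cons s c ih =>
    have h1 : (push (.inr (.inr k)) (f s) : Frag (portEnv A K Γ σ)).Runs 1 x
        (Function.update ((portEnv A K Γ σ).combine w (ports i o (s :: c) S))
          (.inr (.inl .copy)) c) x
        ((portEnv A K Γ σ).combine w (ports i o c (Function.update S k (f s :: S k)))) := by
      rw [hu]
      exact (push_runs _ _ _ _).of_eq le_rfl (update_combine_ports k _)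
    refine (pop_runs_again (i := s) rfl h1 ih).of_eq (by simp; omega) ?_
    simp

variable [Finite A]

/-- Add the symbols before the next bar to the list on the main stack and copy them. -/
noncomputable def copyLoop : Frag (portEnv A K Γ σ) :=
  pop (I := Symbol A) (.inr (.inl .input)) .inr nonBar true fun s =>
    (pushInput (E := portEnv A K Γ σ) s).seq (push (.inr (.inl .copy)) s)

variable {C : ℕ}

theorem copyLoop_runs (hC : ∀ s : Symbol A, encSize s ≤ C) {w : List (Symbol A)} (hw : .bar ∉ w)
    (u : List (Symbol A)) :
    (copyLoop : Frag (portEnv A K Γ σ)).Runs ((C + 4) * w.length + 1) x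
      ((portEnv A K Γ σ).combine (works ((enc u).str ++ m) l r d)
        (ports (w ++ .bar :: i) o c S)) x
      ((portEnv A K Γ σ).combine (works ((enc (w.reverse ++ u)).str ++ m) l r d)
        (ports i o (w.reverse ++ c) S)) := by
  have hu : ∀ v i i' c, Function.update ((portEnv A K Γ σ).combine v (ports i o c S))
      (.inr (.inl .input)) i' = (portEnv A K Γ σ).combine v (ports i' o c S) := fun v i i' c =>
    (Env.update_combine_inr v _ _ _).trans (congrArg _ (update_ports_input i'))
  induction w generalizing u c with
  | nil => exact (pop_runs_none rfl).of_eq (by simp) (hu _ _ _ _)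
  | cons s w ih =>
    have h1 : ((pushInput (E := portEnv A K Γ σ) s).seq (push (.inr (.inl .copy)) s)).Runs (C + 3) x
        (Function.update ((portEnv A K Γ σ).combine (works ((enc u).str ++ m) l r d)
          (ports (s :: (w ++ .bar :: i)) o c S)) (.inr (.inl .input)) (w ++ .bar :: i)) x
        ((portEnv A K Γ σ).combine (works ((enc (s :: u)).str ++ m) l r d)
          (ports (w ++ .bar :: i) o (s :: c) S)) := by
      rw [hu]
      exact (seq_runs (pushInput_runs (E := portEnv A K Γ σ) s u) (portPush_copy_runs s _)).mono
        (by have := hC s; omega)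
    have hs : nonBar (K := K) (Γ := Γ) (σ := σ) (some (.inr s)) = some s := by
      cases s <;> first | rfl | exact absurd List.mem_cons_self hw
    refine (pop_runs_again (i := s) hs h1 (ih (fun h => hw (List.mem_cons_of_mem _ h)) _)).of_eq ?_ ?_
    · rw [List.length_cons, Nat.mul_succ]; omega
    · simp

/-- Add the symbols up to the next bar to the list on the main stack and copy them. -/
noncomputable def copyToBar : Frag (portEnv A K Γ σ) :=
  copyLoop.seq <| (pushInput (E := portEnv A K Γ σ) (.bar : Symbol A)).seq <|
    push (.inr (.inl .copy)) .bar

theorem copyToBar_runs (hC : ∀ s : Symbol A, encSize s ≤ C) {w : List (Symbol A)} (hw : .bar ∉ w)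
    (u : List (Symbol A)) :
    (copyToBar : Frag (portEnv A K Γ σ)).Runs ((C + 4) * (w.length + 1)) x
      ((portEnv A K Γ σ).combine (works ((enc u).str ++ m) l r d)
        (ports (w ++ .bar :: i) o c S)) x
      ((portEnv A K Γ σ).combine (works ((enc (.bar :: (w.reverse ++ u))).str ++ m) l r d)
        (ports i o (.bar :: (w.reverse ++ c)) S)) :=
  (seq_runs (copyLoop_runs hC hw u) <| seq_runs (pushInput_runs (E := portEnv A K Γ σ) .bar _)
    (portPush_copy_runs .bar _)).mono
    (by have := hC (.bar : Symbol A); rw [Nat.mul_succ]; omega)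

end Copy

end Frag

/-- The procedure `solve` can be executed on the input followed by the output of a machine on a
prefix of the input, which is marked by its second bar. -/
theorem exists_decidableWithin_solve_append {α : Type*} {A : Type} [Finite A]
    (N : TM2ComputableAux (Symbol A) (Symbol A)) (w₁ w₂ i out : α → List (Symbol A)) (t : α → ℕ)
    (h₁ : ∀ a, Symbol.bar ∉ w₁ a) (h₂ : ∀ a, Symbol.bar ∉ w₂ a)
    (hN : ∀ a, Nonempty (TM2OutputsInTime N.tm
      ((w₁ a ++ Symbol.bar :: (w₂ a ++ [Symbol.bar])).map N.inputAlphabet.invFun)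
      (some ((out a).map N.outputAlphabet.invFun)) (t a))) :
    ∃ p : Polynomial ℕ, DecidableWithin (fun a => w₁ a ++ .bar :: (w₂ a ++ .bar :: i a))
      (fun a => solve ((w₁ a ++ .bar :: (w₂ a ++ .bar :: i a)) ++ out a).reverse = true)
      (fun a => p.eval ((w₁ a ++ .bar :: (w₂ a ++ .bar :: i a)).length + t a)) := by
  obtain ⟨F, p, hF⟩ := exists_solve_runs A N.tm.K N.tm.Γ N.tm.σ
  obtain ⟨C, hC⟩ := exists_encSize_le (Symbol A)
  obtain ⟨B, hB⟩ := exists_output_length_le N.tm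
  have := N.tm.kFin
  have := N.tm.σFin
  let E := portEnv A N.tm.K N.tm.Γ N.tm.σ
  have hfin : Finite E.Input := inferInstanceAs (Finite (Symbol A))
  have hstack : Finite E.Stack := inferInstanceAs (Finite (Port ⊕ N.tm.K))
  have hstate : Finite E.State := inferInstanceAs (Finite N.tm.σ)
  let _ : Enc E.Input := inferInstanceAs (Enc (Symbol A))
  -- The whole instance goes to the list on the main stack, the query up to its second bar also to
  -- `copy`. There it lies reversed, and pouring it onto the input stack of the machine turns it
  -- round. The output is then added to the same list.
  let R : Frag E := (Frag.push (.inl .main) .nil).seq <| Frag.copyToBar.seq <|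
    Frag.copyToBar.seq <| (Frag.readAll (E := E) (Sum.inl Port.input) (fun s => s)).seq <|
    (Frag.pourCopy N.tm.k₀ N.inputAlphabet.invFun).seq <| (Frag.ofTM A N.tm).seq <|
    (Frag.readAll (E := E) (Sum.inr N.tm.k₁) N.outputAlphabet).seq F
  let full := fun a => w₁ a ++ .bar :: (w₂ a ++ .bar :: i a)
  let cfg (u i c : List (Symbol A)) (S : ∀ k, List (N.tm.Γ k)) : E.Stk :=
    E.combine (works ((enc u).str ++ []) [] [] []) (ports i [] c S)
  let time := fun a => 1 + ((C + 4) * ((w₁ a).length + 1) + ((C + 4) * ((w₂ a).length + 1) +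
      (((C + 3) * (i a).length + 1) + (2 * ((w₁ a).length + (w₂ a).length + 2) + 1 + (t a +
      ((C + 3) * (out a).length + 1 + p.eval ((w₁ a).length + (w₂ a).length + (i a).length +
        (out a).length + 2)))))))
  have hR : ∀ a, R.Runs (time a) N.tm.initialState
      (E.combine (works [] [] [] []) (ports (full a) [] [] fun _ => [])) N.tm.initialState
      (E.combine (works [] [] [] []) (ports [] [solve (full a ++ out a).reverse] [] fun _ => [])) := by
    intro a
    have r1 : (Frag.push (.inl .main) .nil : Frag E).Runs 1 N.tm.initialState
        (E.combine (works [] [] [] []) (ports (full a) [] [] fun _ => [])) N.tm.initialState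
        (cfg [] (full a) [] fun _ => []) := Frag.workPush_main_runs _
    have r2 : (Frag.copyToBar : Frag E).Runs _ N.tm.initialState (cfg [] (full a) [] fun _ => [])
        N.tm.initialState _ := Frag.copyToBar_runs (m := []) hC (h₁ a) []
    have r3 := Frag.copyToBar_runs (x := N.tm.initialState) (K := N.tm.K) (Γ := N.tm.Γ) (l := [])
      (r := []) (d := []) (o := []) (c := .bar :: ((w₁ a).reverse ++ [])) (S := fun _ => [])
      (i := i a) (m := []) hC (h₂ a) (.bar :: ((w₁ a).reverse ++ []))
    have r4 : (Frag.readAll (E := E) (Sum.inl Port.input) (fun s => s)).Runs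
        ((C + 3) * (i a).length + 1) N.tm.initialState
        (cfg (.bar :: ((w₂ a).reverse ++ (.bar :: ((w₁ a).reverse ++ [])))) (i a)
          (.bar :: ((w₂ a).reverse ++ (.bar :: ((w₁ a).reverse ++ [])))) fun _ => [])
        N.tm.initialState
        (cfg (full a).reverse []
          (.bar :: ((w₂ a).reverse ++ (.bar :: ((w₁ a).reverse ++ [])))) fun _ => []) := by
      refine (Frag.readAll_runs (E := E) hC (Sum.inl Port.input) (fun s => s) _).of_eq
          le_rfl ((congrArg _ (update_ports_input [])).trans ?_)
      have : (((i a).map fun s => s).reverse ++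
          (.bar :: ((w₂ a).reverse ++ (.bar :: ((w₁ a).reverse ++ []))))) = (full a).reverse := by
        simp [full]
      exact congrArg (cfg · _ _ _) this
    have r5 : (Frag.pourCopy N.tm.k₀ N.inputAlphabet.invFun : Frag E).Runs
        (2 * ((w₁ a).length + (w₂ a).length + 2) + 1) N.tm.initialState
        (cfg (full a).reverse []
          (.bar :: ((w₂ a).reverse ++ (.bar :: ((w₁ a).reverse ++ [])))) fun _ => [])
        N.tm.initialState (cfg (full a).reverse [] [] (single N.tm.k₀
          ((w₁ a ++ Symbol.bar :: (w₂ a ++ [Symbol.bar])).map N.inputAlphabet.invFun))) := by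
      refine (Frag.pourCopy_runs N.tm.k₀ N.inputAlphabet.invFun _).of_eq ?_ ?_
      · simp; omega
      · refine congrArg (cfg (full a).reverse [] [] ·) (congrArg (single N.tm.k₀) ?_)
        simp
    have r6 := Frag.ofTM_runs (A := A) (w := works ((enc (full a).reverse).str ++ []) [] [] [])
      (i := []) (o := []) (c := []) (hN a).some
    have r7 : (Frag.readAll (E := E) (Sum.inr N.tm.k₁) N.outputAlphabet).Runs
        ((C + 3) * (out a).length + 1) N.tm.initialState
        (cfg (full a).reverse [] [] (single N.tm.k₁ ((out a).map N.outputAlphabet.invFun)))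
        N.tm.initialState
        (cfg (full a ++ out a).reverse [] [] fun _ => []) := by
      have h1 : single N.tm.k₁ ((out a).map N.outputAlphabet.invFun) N.tm.k₁ =
        (out a).map N.outputAlphabet.invFun := Function.update_self _ _ _
      refine (Frag.readAll_runs (E := E) hC (Sum.inr N.tm.k₁) N.outputAlphabet
        (full a).reverse).of_eq ?_ ((congrArg _ (update_ports_inr N.tm.k₁ [])).trans ?_)
      · rw [ports_inr, h1, List.length_map]
      · rw [ports_inr, h1]
        have h2 : (((out a).map N.outputAlphabet.invFun).map N.outputAlphabet).reverse ++
            (full a).reverse = (full a ++ out a).reverse := by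
          rw [List.map_map]
          refine (congrArg (List.reverse · ++ (full a).reverse)
            ((List.map_congr_left fun s _ => ?_).trans (List.map_id _))).trans
              (List.reverse_append (as := full a) (bs := out a)).symm
          exact N.outputAlphabet.apply_symm_apply s
        have h3 : Function.update (single N.tm.k₁ ((out a).map N.outputAlphabet.invFun)) N.tm.k₁ []
            = fun _ => [] := by
          rw [single, Function.update_idem]
          exact Function.update_eq_self N.tm.k₁ _
        rw [h3]
        exact congrArg (cfg · _ _ _) h2
    have r8 := hF (full a ++ out a).reverse N.tm.initialState fun _ => []
    rw [← List.append_nil (enc (full a ++ out a).reverse).str] at r8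
    refine (Frag.seq_runs r1 <| Frag.seq_runs r2 <| Frag.seq_runs r3 <| Frag.seq_runs r4 <|
      Frag.seq_runs r5 <| Frag.seq_runs r6 <| Frag.seq_runs r7 r8).mono (le_of_eq ?_)
    have : (full a ++ out a).reverse.length = (w₁ a).length + (w₂ a).length + (i a).length +
        (out a).length + 2 := by simp [full]; omega
    rw [this]
  have := R.computableWithin (Sum.inl Port.input) (Sum.inl Port.output) N.tm.initialState
    (Equiv.refl (Symbol A)) (Equiv.refl Bool) (input := full)
    (output := fun a => [solve (full a ++ out a).reverse]) (time := time) fun a => by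
      rw [Equiv.refl_symm, Equiv.refl_symm, Equiv.coe_refl, Equiv.coe_refl, List.map_id,
        List.map_id, ← ports_eq_single_input, ← ports_eq_single_output]
      exact hR a
  -- With `n` the length of the input plus the time of the machine, the output has length at most
  -- `(B + 1) * n`, so `solve` is applied to a word of length at most `(B + 2) * n`.
  refine ⟨((3 * C + 20 + (C + 3) * (B + 1) : ℕ) : Polynomial ℕ) * Polynomial.X +
    p.comp (((B + 2 : ℕ) : Polynomial ℕ) * Polynomial.X) + 20, ?_⟩
  refine DecidableWithin.mono (t := fun a => time a + 1) ?_ fun a => ?_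
  · unfold DecidableWithin
    convert this using 3 with w
    simp [full]
  · have h1 := hB _ _ _ (hN a).some
    simp only [List.length_map, List.length_append, List.length_cons, List.length_nil] at h1
    set n := (w₁ a ++ .bar :: (w₂ a ++ .bar :: i a)).length + t a with hn
    have h2 : (w₁ a).length + (w₂ a).length + (i a).length + t a + 2 = n := by simp [hn]; omega
    have h3 : (out a).length ≤ (B + 1) * n := by
      refine h1.trans ?_
      rw [Nat.succ_mul]
      have : B * t a ≤ B * n := Nat.mul_le_mul_left _ (by omega)
      omega
    have h4 : p.eval ((w₁ a).length + (w₂ a).length + (i a).length + (out a).length + 2) ≤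
        p.eval ((B + 2) * n) := polynomial_eval_mono p (by
          have : (B + 2) * n = (B + 1) * n + n := by ring
          omega)
    have h5 : (C + 3) * (out a).length ≤ (C + 3) * ((B + 1) * n) := Nat.mul_le_mul_left _ h3
    have h6 : (C + 4) * ((w₁ a).length + 1) ≤ (C + 4) * n := Nat.mul_le_mul_left _ (by omega)
    have h7 : (C + 4) * ((w₂ a).length + 1) ≤ (C + 4) * n := Nat.mul_le_mul_left _ (by omega)
    have h8 : (C + 3) * (i a).length ≤ (C + 3) * n := Nat.mul_le_mul_left _ (by omega)
    have h9 : (3 * C + 20 + (C + 3) * (B + 1)) * n = (C + 4) * n + (C + 4) * n + (C + 3) * n +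
      (C + 3) * ((B + 1) * n) + 9 * n := by ring
    simp only [Polynomial.eval_add, Polynomial.eval_mul, Polynomial.eval_natCast, Polynomial.eval_X,
      Polynomial.eval_comp, Polynomial.eval_ofNat, Nat.cast_id]
    rw [h9]
    simp only [time]
    omega

end MinTreeProof

namespace MinTreeProof

/-! ## Time bounds -/

/-- A coefficient `a` is at most `2 ^ a` and a power multiplies the exponent `b`; the sum of two
bounds costs one more factor of two. -/
theorem Polynomial.exists_eval_le_two_pow (p : Polynomial ℕ) :
    ∃ c k : ℕ, ∀ m b, m ≤ 2 ^ b → p.eval m ≤ 2 ^ (c + k * b) := by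
  induction p using Polynomial.induction_on' with
  | add p q hp hq =>
    obtain ⟨c, k, h⟩ := hp
    obtain ⟨c', k', h'⟩ := hq
    refine ⟨c + c' + 1, k + k', fun m b hm => ?_⟩
    have h1 : 2 ^ (c + k * b) ≤ 2 ^ (c + c' + (k + k') * b) :=
      Nat.pow_le_pow_right (by omega) (by rw [add_mul]; omega)
    have h2 : 2 ^ (c' + k' * b) ≤ 2 ^ (c + c' + (k + k') * b) :=
      Nat.pow_le_pow_right (by omega) (by rw [add_mul]; omega)
    rw [Polynomial.eval_add, add_right_comm, pow_succ]
    have := h m b hm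
    have := h' m b hm
    omega
  | monomial n a =>
    refine ⟨a, n, fun m b hm => ?_⟩
    rw [Polynomial.eval_monomial, pow_add, mul_comm n b, pow_mul]
    exact Nat.mul_le_mul (Nat.lt_two_pow_self).le (Nat.pow_le_pow_left hm n)

/-- Rests on `n + 2 ^ q ≤ 2 ^ (n + q)`, to which the preceding bound applies. -/
theorem exists_eval_add_two_pow_le (p q : Polynomial ℕ) :
    ∃ s : Polynomial ℕ, ∀ n, p.eval (n + 2 ^ q.eval n) ≤ 2 ^ s.eval n := by
  obtain ⟨c, k, h⟩ := Polynomial.exists_eval_le_two_pow p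
  refine ⟨(c : Polynomial ℕ) + (k : Polynomial ℕ) * (Polynomial.X + q), fun n => ?_⟩
  refine (h _ (n + q.eval n) ?_).trans (by simp)
  rw [pow_add]
  have h1 : n + 1 ≤ 2 ^ n := Nat.lt_two_pow_self
  have h2 : 1 ≤ 2 ^ q.eval n := Nat.one_le_two_pow
  calc n + 2 ^ q.eval n ≤ n * 2 ^ q.eval n + 2 ^ q.eval n := by
        have := Nat.mul_le_mul_left n h2; omega
    _ = (n + 1) * 2 ^ q.eval n := by ring
    _ ≤ _ := Nat.mul_le_mul_right _ h1

variable {L : SententialLogic}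

theorem size_pos (α : L.Sentence) : 0 < L.size α := List.length_pos_iff.2 (L.code_ne_nil α)

theorem length_word (α : L.Sentence) : (word L α).length = L.size α := by
  simp [word, SententialLogic.size]

theorem length_binary_le {A : Type} (n : ℕ) : (binary n : List (Symbol A)).length ≤ n := by
  rw [binary, List.length_map, encodeNat_eq_bits, Nat.size_eq_bits_len]
  exact Nat.size_le.2 Nat.lt_two_pow_self

/-! ### Length of descriptions. -/

section Length

variable {V : Type*} {H : Hypergraph L.Sentence V} {T : Finset L.Sentence}

theorem size_le_hypergraphSize {e : Finset V × V} (he : e ∈ H.edges) :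
    L.size (H.label e.2) + ∑ v ∈ e.1, L.size (H.label v) ≤ hypergraphSize L H :=
  Finset.single_le_sum (f := fun e : Finset V × V =>
    L.size (H.label e.2) + ∑ v ∈ e.1, L.size (H.label v)) (fun _ _ => Nat.zero_le _) he

theorem card_edges_le : H.edges.card ≤ hypergraphSize L H := by
  rw [Finset.card_eq_sum_ones]
  exact Finset.sum_le_sum fun e _ => (size_pos _).trans_le (Nat.le_add_right _ _)

theorem card_premises_le {e : Finset V × V} (he : e ∈ H.edges) :
    e.1.card ≤ hypergraphSize L H := by
  refine le_trans ?_ ((Nat.le_add_left _ _).trans (size_le_hypergraphSize he))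
  rw [Finset.card_eq_sum_ones]
  exact Finset.sum_le_sum fun v _ => size_pos _

/-- The size of a hypergraph misses the labels of vertices on no hyperedge. Such vertices are
leaves, and groundedness puts their labels into `T`. -/
theorem size_label_le (hH : IsDerivationStructure L T H) {v : V} (hv : v ∈ H.verts) :
    L.size (H.label v) ≤ L.theorySize T + hypergraphSize L H := by
  by_cases h : ∃ e ∈ H.edges, e.2 = v
  · obtain ⟨e, he, rfl⟩ := h
    exact (Nat.le_add_right _ _).trans ((size_le_hypergraphSize he).trans (Nat.le_add_left _ _))
  · push Not at h
    exact (Finset.single_le_sum (f := L.size) (fun _ _ => Nat.zero_le _)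
      (hH.1 v ⟨hv, h⟩)).trans (Nat.le_add_right _ _)

theorem length_flatMap_le {X Y : Type*} (l : List X) (f : X → List Y) {b : ℕ}
    (h : ∀ x ∈ l, (f x).length ≤ b) : (l.flatMap f).length ≤ l.length * b := by
  induction l with
  | nil => simp
  | cons x l ih =>
    rw [List.flatMap_cons, List.length_append, List.length_cons, Nat.succ_mul, add_comm]
    exact add_le_add (ih fun y hy => h y (List.mem_cons_of_mem _ hy)) (h x List.mem_cons_self)

/-- There are at most `n` vertices, at most `n` hyperedges, and at most `n` premises in each. A
number is less than the number of vertices and takes at most `n` digits, a label at most `2 * n`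
symbols; the remaining constants are separators. -/
theorem Listing.length_string_le (hH : IsDerivationStructure L T H) (l : Listing H) {n : ℕ}
    (hT : L.theorySize T ≤ n) (hs : hypergraphSize L H ≤ n) (hc : H.verts.card ≤ n) :
    l.string.length ≤ n * (3 * n + 2) + n * (n * (n + 1) + n + 2) + 2 := by
  have hv : l.vertexList.length ≤ n := by
    rw [← Multiset.coe_card, l.vertexList_eq]; exact hc
  have he : l.edgeList.length ≤ n := by
    rw [← Multiset.coe_card, l.edgeList_eq]; exact card_edges_le.trans hs
  have hmv : ∀ v ∈ l.vertexList, v ∈ H.verts := fun v h => by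
    rwa [← Multiset.mem_coe, l.vertexList_eq] at h
  have hme : ∀ e ∈ l.edgeList, e ∈ H.edges := fun e h => by
    rwa [← Multiset.mem_coe, l.edgeList_eq] at h
  have hnum : ∀ v ∈ H.verts, (binary (l.number v) : List (Symbol L.Alphabet)).length ≤ n :=
    fun v h => (length_binary_le _).trans ((l.number_lt v h).le.trans hc)
  have h1 := length_flatMap_le l.vertexList
    (fun v => binary (l.number v) ++ [Symbol.colon] ++ word L (H.label v) ++ [Symbol.comma])
    (b := 3 * n + 2) fun v h => by
      have := hnum v (hmv v h)
      have := size_label_le hH (hmv v h)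
      simp only [List.length_append, length_word, List.length_singleton]
      omega
  have h2 := length_flatMap_le l.edgeList
    (fun e => (l.premiseList e).flatMap (fun v => binary (l.number v) ++ [Symbol.comma]) ++
        [Symbol.colon] ++ binary (l.number e.2) ++ [Symbol.comma])
    (b := n * (n + 1) + n + 2) fun e h => by
      have h3 := hnum e.2 (H.conclusion_mem e (hme e h))
      have h4 : (l.premiseList e).length ≤ n := by
        rw [← Multiset.coe_card, l.premiseList_eq e (hme e h)]
        exact (card_premises_le (hme e h)).trans hs
      have h5 := length_flatMap_le (l.premiseList e)
        (fun v => (binary (l.number v) ++ [Symbol.comma] : List (Symbol L.Alphabet)))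
        (b := n + 1) fun v hv => by
          rw [← Multiset.mem_coe, l.premiseList_eq e (hme e h)] at hv
          have := hnum v (H.premise_mem e (hme e h) hv)
          simpa using this
      have h6 := Nat.mul_le_mul_right (n + 1) h4
      simp only [List.length_append, List.length_singleton]
      omega
  have h3 := Nat.mul_le_mul_right (3 * n + 2) hv
  have h4 := Nat.mul_le_mul_right (n * (n + 1) + n + 2) he
  simp only [Listing.string, List.length_append, List.length_singleton] at h1 h2 ⊢
  omega

end Length

section Instances

variable {D : Deriver L}

theorem Query.size_le_length (q : Query D) :
    L.theorySize q.theory + L.size q.goal ≤ q.string.length := by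
  have h : L.theorySize q.theory = (q.theoryList.map L.size).sum := by
    rw [SententialLogic.theorySize, Finset.sum, ← q.theoryList_eq]; simp
  have h' : ∀ l : List L.Sentence, (l.map L.size).sum ≤
      (l.flatMap (fun α => word L α ++ [Symbol.comma])).length := by
    intro l
    induction l with
    | nil => simp
    | cons α l ih =>
      simp only [List.map_cons, List.sum_cons, List.flatMap_cons, List.length_append, length_word]
      omega
  have := h' q.theoryList
  simp only [Query.string, List.length_append, length_word]
  omega

theorem Instance.query_length_le (x : Instance D) :
    x.query.string.length ≤ x.string.length := by
  simp only [Instance.string, List.length_append]; omega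

/-- The polynomial is fixed before the bound `t`, so that one statement serves polynomial and
exponential derivers alike. -/
theorem Deriver.exists_access_time (D : Deriver L) : ∃ p : Polynomial ℕ,
    ∀ (t : ℕ → ℕ), (∀ (T : Finset L.Sentence) (η : D.goals),
      hypergraphSize L (D.struct T η) ≤ t (L.theorySize T + L.size η) ∧
        (D.struct T η).verts.card ≤ t (L.theorySize T + L.size η)) → Monotone t →
      DecidableWithin (fun x : D.AccessInstance => x.inst.string ++ x.listing.string)
        (fun x => x.inst.Holds) (fun x => p.eval (x.inst.string.length + t x.inst.string.length)) := by
  obtain ⟨p, h⟩ := exists_decidableWithin_solve L.Alphabet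
  refine ⟨p.comp (Polynomial.X + (Polynomial.X * (3 * Polynomial.X + 2) +
    Polynomial.X * (Polynomial.X * (Polynomial.X + 1) + Polynomial.X + 2) + 2)),
    fun t ht hmono => ?_⟩
  have h1 := (h.comp fun x : D.AccessInstance => x.inst.string ++ x.listing.string).congr
    fun x => solve_eq x.inst x.listing
  refine h1.mono fun x => ?_
  have hq := x.inst.query.size_le_length.trans x.inst.query_length_le
  obtain ⟨hs, hc⟩ := ht x.inst.query.theory x.inst.query.goal
  have hm := hmono hq
  have h2 := Listing.length_string_le (D.struct_isDerivationStructure _ _) x.listing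
    (n := x.inst.string.length + t x.inst.string.length) (by omega) (by omega) (by omega)
  rw [Polynomial.eval_comp]
  refine polynomial_eval_mono p ?_
  rw [List.length_append]
  simp
  omega

/-- The query is the prefix of the instance up to the second bar, so the given machine can be run on
it; its output is then exactly the description that a machine with access would find. -/
theorem Deriver.exists_computed_time (l : ∀ q : Query D, Listing (D.struct q.theory q.goal))
    {t : Query D → ℕ} (h : ComputableWithin (fun q : Query D => q.string)
      (fun q => (l q).string) t) : ∃ p : Polynomial ℕ,
    DecidableWithin (fun x : Instance D => x.string) (fun x => x.Holds)
      (fun x => p.eval (x.string.length + t x.query)) := by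
  obtain ⟨N, hN⟩ := h
  let w₁ : Instance D → List (Symbol L.Alphabet) := fun x =>
    x.query.theoryList.flatMap (fun α => word L α ++ [Symbol.comma])
  have hq : ∀ x : Instance D, x.query.string =
      w₁ x ++ .bar :: (word L x.query.goal ++ [Symbol.bar]) := fun x => by
    simp [Query.string, w₁]
  have hx : ∀ x : Instance D, w₁ x ++ .bar :: (word L x.query.goal ++ .bar ::
      (binary x.bound ++ [Symbol.bar])) = x.string := fun x => by
    simp [Instance.string, Query.string, w₁]
  obtain ⟨p, hp⟩ := exists_decidableWithin_solve_append N w₁ (fun x => word L x.query.goal)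
    (fun x => binary x.bound ++ [Symbol.bar]) (fun x => (l x.query).string) (fun x => t x.query)
    (fun x => by simp [w₁, bar_notMem_word]) (fun x => bar_notMem_word _)
    (fun x => by rw [← hq]; exact hN x.query)
  simp only [hx] at hp
  exact ⟨p, hp.congr fun x => solve_eq x (l x.query)⟩

end Instances

end MinTreeProof

/-! ### The four complexity bounds. -/

theorem mainTheorem3 (L : MinTreeProof.SententialLogic) (D : MinTreeProof.Deriver L) :
    (D.IsPolynomial → D.MTPInPWithAccess) ∧
    (D.IsExponential → D.MTPInExpTimeWithAccess) ∧
    (D.IsPolyTimeComputable →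
      MinTreeProof.InP (fun x : MinTreeProof.Instance D => x.string) (fun x => x.Holds)) ∧
    (D.IsExpTimeComputable →
      MinTreeProof.InExpTime (fun x : MinTreeProof.Instance D => x.string) (fun x => x.Holds)) := by
  refine ⟨?_, ?_, ?_, ?_⟩
  · rintro ⟨p, h⟩
    obtain ⟨q, hq⟩ := D.exists_access_time
    exact ⟨q.comp (Polynomial.X + p), (hq _ h fun _ _ =>
      MinTreeProof.polynomial_eval_mono p).mono fun x => by simp⟩
  · rintro ⟨p, h⟩
    obtain ⟨q, hq⟩ := D.exists_access_time
    obtain ⟨s, hs⟩ := MinTreeProof.exists_eval_add_two_pow_le q p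
    exact ⟨s, (hq _ h fun _ _ hab => Nat.pow_le_pow_right two_pos
      (MinTreeProof.polynomial_eval_mono p hab)).mono fun x => hs _⟩
  · rintro ⟨l, p, h⟩
    obtain ⟨q, hq⟩ := MinTreeProof.Deriver.exists_computed_time l h
    exact ⟨q.comp (Polynomial.X + p), hq.mono fun x => by
      simpa using MinTreeProof.polynomial_eval_mono q (Nat.add_le_add_left
        (MinTreeProof.polynomial_eval_mono p x.query_length_le) _)⟩
  · rintro ⟨l, p, h⟩
    obtain ⟨q, hq⟩ := MinTreeProof.Deriver.exists_computed_time l h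
    obtain ⟨s, hs⟩ := MinTreeProof.exists_eval_add_two_pow_le q p
    exact ⟨s, hq.mono fun x => (MinTreeProof.polynomial_eval_mono q (Nat.add_le_add_left
      (Nat.pow_le_pow_right two_pos
        (MinTreeProof.polynomial_eval_mono p x.query_length_le)) _)).trans (hs _)⟩
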